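/- Let $K$ be an algebraically closed field. Let $N$ be a lattice of finite rank and let $Y$ be the toric variety over $K$ of a fan $\Sigma$ in $N\otimes\mathbb R$. Assume that $Y$ is complete and that its divisor class group $\mathrm{Cl}(Y)$ is torsion-free. Let $r_1,\dots,r_n\in N$ be the integral generators of the rays of $\Sigma$, let $D_1,\dots,D_n$ be the corresponding torus-invariant prime divisors of $Y$, and let $d_1,\dots,d_n$ be positive integers not divisible by the characteristic of $K$. Let $K_{\min}\subseteq\bigoplus_{i=1}^n\mathbb Z/d_i$ be the image of the map $\mathrm{Hom}(\mathrm{Cl}(Y),\mathbb Z)\to\bigoplus_{i=1}^n\mathbb Z/d_i$, $\psi\mapsto(\psi([D_i])\bmod d_i)_i$, and let $G_{\max}=\bigl(\bigoplus_{i=1}^n\mathbb Z/d_i\bigr)/K_{\min}$. A toric cover of $Y$ is the finite morphism $X_{N'}\to Y$ given by a map of fans $(N',\Sigma)\to(N,\Sigma)$, where $N'\subseteq N$ is a sublattice of finite index. A cover is said to be branched on the $D_i$ with orders $d_i$ if it is unramified over every prime divisor of $Y$ other than $D_1,\dots,D_n$ and its ramification order over $D_i$ is $d_i$ for every $i$ (the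 value $d_i=1$ is allowed). Then: 1. There exists a toric cover of $Y$ branched on the $D_i$ with orders $d_i$ if and only if the map $\mathbb Z/d_i\to G_{\max}$ is injective for every $i=1,\dots,n$. 2. If this condition holds, let $N'_{\min}\subseteq N$ be the subgroup generated by $d_1r_1,\dots,d_nr_n$. It has finite index in $N$, and the corresponding toric cover $X_{\mathrm{tmax}}\to Y$ is branched on the $D_i$ with orders $d_i$ and is Galois with Galois group isomorphic to $G_{\max}$. It is maximal: every toric cover $X\to Y$ branched on the $D_i$ with orders $d_i$ is, as a cover of $Y$, the quotient $X_{\mathrm{tmax}}/H$ by a subgroup $H$ of the Galois group of $X_{\mathrm{tmax}}\to Y$. -/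

import Mathlib

universe u

namespace Toric

open AlgebraicGeometry CategoryTheory Limits

section Fans

variable {V : Type u} [NormedAddCommGroup V] [NormedSpace ℝ V]

/-- The dual lattice `M = Hom(N, ℤ)` of a lattice `N ⊆ V`, realised as the group of those real
linear forms on `V` that take integral values on `N`. -/
def dualLattice (N : Submodule ℤ V) : AddSubgroup (Module.Dual ℝ V) where
  carrier := {m | ∀ v ∈ N, ∃ k : ℤ, m v = k}
  zero_mem' := fun _ _ => ⟨0, by simp⟩
  add_mem' := by
    intro a b ha hb v hv
    obtain ⟨k, hk⟩ := ha v hv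
    obtain ⟨l, hl⟩ := hb v hv
    exact ⟨k + l, by simp [hk, hl]⟩
  neg_mem' := by
    intro a ha v hv
    obtain ⟨k, hk⟩ := ha v hv
    exact ⟨-k, by simp [hk]⟩

/-- The monoid `S_σ = σ^∨ ∩ M` of characters that are regular on the affine chart of `σ`. -/
def dualMonoid (N : Submodule ℤ V) (σ : PointedCone ℝ V) : AddSubmonoid (Module.Dual ℝ V) where
  carrier := {m | m ∈ dualLattice N ∧ ∀ v ∈ σ, 0 ≤ m v}
  zero_mem' := ⟨zero_mem _, fun _ _ => le_rfl⟩
  add_mem' := fun ha hb => ⟨add_mem ha.1 hb.1, fun v hv => add_nonneg (ha.2 v hv) (hb.2 v hv)⟩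

/-- `τ` is a face of the rational cone `σ`: it is cut out of `σ` by a supporting hyperplane
`m = 0` with `m ∈ σ^∨ ∩ M`. -/
def IsFace (N : Submodule ℤ V) (τ σ : PointedCone ℝ V) : Prop :=
  ∃ m ∈ dualMonoid N σ, ∀ v, v ∈ τ ↔ v ∈ σ ∧ m v = 0

variable (V) in
/-- A fan in the vector space `V = N ⊗ ℝ`, together with the lattice `N` with respect to which it
is rational. -/
structure Fan where
  /-- the lattice `N` -/
  lattice : Submodule ℤ V
  [discrete : DiscreteTopology lattice]
  [isZLattice : IsZLattice ℝ lattice]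
  /-- the cones of the fan -/
  cones : Set (PointedCone ℝ V)
  finite : cones.Finite
  nonempty : cones.Nonempty
  /-- every cone is a rational polyhedral cone -/
  rational : ∀ σ ∈ cones, ∃ s : Finset V, (∀ v ∈ s, v ∈ lattice) ∧
    σ = Submodule.span _ (s : Set V)
  /-- every cone is strongly convex -/
  pointed : ∀ σ ∈ cones, ∀ v ∈ σ, -v ∈ σ → v = 0
  /-- faces of cones of the fan belong to the fan -/
  face_mem : ∀ σ ∈ cones, ∀ τ, IsFace lattice τ σ → τ ∈ cones
  /-- two cones of the fan meet along a common face -/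
  inter_face : ∀ σ ∈ cones, ∀ τ ∈ cones, IsFace lattice (σ ⊓ τ) σ

attribute [instance] Fan.discrete Fan.isZLattice

/-- A sublattice of finite index of the lattice of a fan. -/
structure Fan.Sublattice (F : Fan V) where
  /-- the sublattice `N' ⊆ N` -/
  carrier : Submodule ℤ V
  le : carrier ≤ F.lattice
  relIndex_ne_zero : carrier.toAddSubgroup.relIndex F.lattice.toAddSubgroup ≠ 0

theorem dualLattice_anti {N N' : Submodule ℤ V} (h : N' ≤ N) : dualLattice N ≤ dualLattice N' :=
  fun _ hm v hv => hm v (h hv)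

theorem dualMonoid_mono {N N' : Submodule ℤ V} (h : N' ≤ N) {σ τ : PointedCone ℝ V} (hστ : τ ≤ σ) :
    dualMonoid N σ ≤ dualMonoid N' τ :=
  fun _ hm => ⟨dualLattice_anti h hm.1, fun v hv => hm.2 v (hστ hv)⟩

namespace Fan.Sublattice

variable {F : Fan V} (L : F.Sublattice)

theorem exists_smul_mem : ∃ n : ℕ, n ≠ 0 ∧ ∀ v ∈ F.lattice, n • v ∈ L.carrier :=
  ⟨(L.carrier.toAddSubgroup.relIndex F.lattice.toAddSubgroup).factorial, Nat.factorial_ne_zero _,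
    fun _ hv => (AddSubgroup.nsmul_mem_of_relIndex_ne_zero_of_dvd L.relIndex_ne_zero hv
      (fun _ h0 h1 => Nat.dvd_factorial h0 h1)).1⟩

theorem isFace_iff (τ σ : PointedCone ℝ V) : IsFace L.carrier τ σ ↔ IsFace F.lattice τ σ := by
  obtain ⟨n, hn, hmem⟩ := L.exists_smul_mem
  constructor
  · rintro ⟨m, hm, h⟩
    refine ⟨n • m, ⟨?_, ?_⟩, fun v => ?_⟩
    · intro v hv
      obtain ⟨k, hk⟩ := hm.1 _ (hmem v hv)
      exact ⟨k, by rw [← hk]; simp⟩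
    · intro v hv
      have := hm.2 v hv
      simp only [LinearMap.smul_apply]
      positivity
    · rw [h v]
      simp [hn]
  · rintro ⟨m, hm, h⟩
    exact ⟨m, dualMonoid_mono L.le le_rfl hm, h⟩

theorem discreteTopology : DiscreteTopology L.carrier :=
  DiscreteTopology.of_subset (s := (F.lattice : Set V)) F.discrete L.le

/-- The fan `(N', Σ)` for a sublattice `N' ⊆ N` of finite index: the cones do not change. -/
def fan : Fan V where
  lattice := L.carrier
  discrete := L.discreteTopology
  isZLattice := by
    have := L.discreteTopology
    obtain ⟨n, hn, hmem⟩ := L.exists_smul_mem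
    refine ⟨?_⟩
    rw [eq_top_iff, ← IsZLattice.span_top (K := ℝ) (L := F.lattice), Submodule.span_le]
    intro v hv
    have h2 := Submodule.smul_mem _ ((n : ℝ)⁻¹) (Submodule.subset_span (R := ℝ) (hmem v hv))
    rw [← Nat.cast_smul_eq_nsmul ℝ, smul_smul,
      inv_mul_cancel₀ (Nat.cast_ne_zero.mpr hn), one_smul] at h2
    exact h2
  cones := F.cones
  finite := F.finite
  nonempty := F.nonempty
  rational := by
    classical
    intro σ hσ
    obtain ⟨n, hn, hmem⟩ := L.exists_smul_mem
    obtain ⟨s, hs, rfl⟩ := F.rational σ hσ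
    have hn' : (0 : ℝ) ≤ n := Nat.cast_nonneg n
    refine ⟨s.image (fun v => n • v), ?_, le_antisymm ?_ ?_⟩
    · intro w hw
      obtain ⟨v, hv, rfl⟩ := Finset.mem_image.1 hw
      exact hmem v (hs v hv)
    · rw [Submodule.span_le]
      intro v hv
      have h1 : n • v ∈ Submodule.span {c : ℝ // 0 ≤ c}
          ((s.image (fun v => n • v) : Finset V) : Set V) :=
        Submodule.subset_span (Finset.mem_coe.2 (Finset.mem_image_of_mem _ hv))
      have h2 := Submodule.smul_mem _ (⟨(n : ℝ)⁻¹, inv_nonneg.2 hn'⟩ : {c : ℝ // 0 ≤ c}) h1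
      have h3 : (⟨(n : ℝ)⁻¹, inv_nonneg.2 hn'⟩ : {c : ℝ // 0 ≤ c}) • (n • v) = v := by
        change (n : ℝ)⁻¹ • (n • v) = v
        rw [← Nat.cast_smul_eq_nsmul ℝ, smul_smul,
          inv_mul_cancel₀ (Nat.cast_ne_zero.mpr hn), one_smul]
      rw [h3] at h2
      exact h2
    · rw [Submodule.span_le]
      intro w hw
      obtain ⟨v, hv, rfl⟩ := Finset.mem_image.1 (Finset.mem_coe.1 hw)
      exact nsmul_mem (Submodule.subset_span hv) n
  pointed := F.pointed
  face_mem := fun σ hσ τ h => F.face_mem σ hσ τ ((L.isFace_iff _ _).1 h)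
  inter_face := fun σ hσ τ hτ => (L.isFace_iff _ _).2 (F.inter_face σ hσ τ hτ)

end Fan.Sublattice

end Fans

section Charts

variable (K : Type u) [Field K] {V : Type u} [NormedAddCommGroup V] [NormedSpace ℝ V]

/-- The coordinate ring `K[S_σ]` of the affine chart `U_σ`. -/
abbrev ChartRing (N : Submodule ℤ V) (σ : PointedCone ℝ V) : Type u :=
  AddMonoidAlgebra K (dualMonoid N σ)

/-- The character `χ^m`, as a regular function on the affine chart `U_σ`. -/
noncomputable def chi (N : Submodule ℤ V) (σ : PointedCone ℝ V) (m : dualMonoid N σ) :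
    ChartRing K N σ :=
  AddMonoidAlgebra.single m 1

/-- The inclusion `K[S_σ] ⊆ K[S'_τ]` for a sublattice `N' ⊆ N` and a cone `τ ⊆ σ`. -/
noncomputable def chartMap {N N' : Submodule ℤ V} (h : N' ≤ N) {σ τ : PointedCone ℝ V}
    (hτ : τ ≤ σ) : ChartRing K N σ →ₐ[K] ChartRing K N' τ :=
  AddMonoidAlgebra.mapDomainAlgHom K K (AddSubmonoid.inclusion (dualMonoid_mono h hτ))

theorem chartMap_single {N N' : Submodule ℤ V} (h : N' ≤ N) {σ τ : PointedCone ℝ V}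
    (hτ : τ ≤ σ) (m : dualMonoid N σ) (a : K) :
    chartMap K h hτ (AddMonoidAlgebra.single m a) =
      AddMonoidAlgebra.single (AddSubmonoid.inclusion (dualMonoid_mono h hτ) m) a := by
  simp [chartMap]

theorem chartMap_injective {N N' : Submodule ℤ V} (h : N' ≤ N) {σ τ : PointedCone ℝ V}
    (hτ : τ ≤ σ) : Function.Injective (chartMap K h hτ) :=
  AddMonoidAlgebra.mapDomain_injective (AddSubmonoid.inclusion_injective _)

theorem chartRing_algHom_ext {N : Submodule ℤ V} {σ : PointedCone ℝ V} {A : Type*} [Semiring A]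
    [Algebra K A] {f g : ChartRing K N σ →ₐ[K] A}
    (h : ∀ m, f (chi K N σ m) = g (chi K N σ m)) : f = g := by
  refine AlgHom.ext fun x => ?_
  induction x using AddMonoidAlgebra.induction_linear with
  | zero => simp
  | add x y hx hy => rw [map_add, map_add, hx, hy]
  | single m a =>
    have : (AddMonoidAlgebra.single m a : ChartRing K N σ) = a • chi K N σ m := by
      rw [chi, AddMonoidAlgebra.smul_single, smul_eq_mul, mul_one]
    rw [this, map_smul, map_smul, h]

theorem chartMap_refl (N : Submodule ℤ V) (σ : PointedCone ℝ V) :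
    chartMap K (le_refl N) (le_refl σ) = AlgHom.id K _ :=
  chartRing_algHom_ext K fun m => by
    rw [chi, chartMap_single]; rfl

theorem chartMap_comp {N N' N'' : Submodule ℤ V} (h : N' ≤ N) (h' : N'' ≤ N')
    {σ τ ρ : PointedCone ℝ V} (hτ : τ ≤ σ) (hρ : ρ ≤ τ) :
    (chartMap K h' hρ).comp (chartMap K h hτ) = chartMap K (h'.trans h) (hρ.trans hτ) :=
  chartRing_algHom_ext K fun m => by
    rw [chi, AlgHom.comp_apply, chartMap_single, chartMap_single, chartMap_single]; rfl

/-- The affine toric variety `U_σ = Spec K[S_σ]`. -/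
noncomputable def chart (N : Submodule ℤ V) (σ : PointedCone ℝ V) : Scheme.{u} :=
  Spec (.of (ChartRing K N σ))

/-- The morphism `U'_τ ⟶ U_σ` for a sublattice `N' ⊆ N` and a cone `τ ⊆ σ`. -/
noncomputable def chartHom {N N' : Submodule ℤ V} (h : N' ≤ N) {σ τ : PointedCone ℝ V}
    (hτ : τ ≤ σ) : chart K N' τ ⟶ chart K N σ :=
  Spec.map (CommRingCat.ofHom (chartMap K h hτ).toRingHom)

theorem chartHom_refl (N : Submodule ℤ V) (σ : PointedCone ℝ V) :
    chartHom K (le_refl N) (le_refl σ) = 𝟙 _ := by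
  rw [chartHom, chartMap_refl]
  exact Spec.map_id _

theorem chartHom_comp {N N' N'' : Submodule ℤ V} (h : N' ≤ N) (h' : N'' ≤ N')
    {σ τ ρ : PointedCone ℝ V} (hτ : τ ≤ σ) (hρ : ρ ≤ τ) :
    chartHom K h' hρ ≫ chartHom K h hτ = chartHom K (h'.trans h) (hρ.trans hτ) := by
  rw [chartHom, chartHom, chartHom, ← chartMap_comp K h h' hτ hρ]
  exact (Spec.map_comp _ _).symm

/-- The diagram of the affine charts `U_σ`, `σ ∈ C`, with the inclusions `U_τ ⊆ U_σ` for
`τ ⊆ σ`. -/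
noncomputable def chartDiagram (N : Submodule ℤ V) (C : Set (PointedCone ℝ V)) :
    C ⥤ Scheme.{u} where
  obj σ := chart K N σ.1
  map f := chartHom K le_rfl (leOfHom f)
  map_id σ := chartHom_refl K N σ.1
  map_comp _ _ := (chartHom_comp K _ _ _ _).symm

theorem exists_smul_add_mem (F : Fan V) {σ τ : PointedCone ℝ V} (hσ : σ ∈ F.cones)
    {m : Module.Dual ℝ V} (hm : m ∈ dualMonoid F.lattice σ) (h : ∀ v, v ∈ τ ↔ v ∈ σ ∧ m v = 0)
    {u : Module.Dual ℝ V} (hu : u ∈ dualMonoid F.lattice τ) :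
    ∃ n : ℕ, u + n • m ∈ dualMonoid F.lattice σ := by
  obtain ⟨s, hs, rfl⟩ := F.rational σ hσ
  have key : ∀ v ∈ s, ∃ n : ℕ, 0 ≤ u v + n * m v := by
    intro v hv
    have hvσ : v ∈ Submodule.span {c : ℝ // 0 ≤ c} (s : Set V) := Submodule.subset_span hv
    rcases (hm.2 v hvσ).eq_or_lt with h0 | h0
    · exact ⟨0, by simpa using hu.2 v ((h v).2 ⟨hvσ, h0.symm⟩)⟩
    · obtain ⟨n, hn⟩ := exists_nat_ge (-(u v) / m v)
      rw [div_le_iff₀ h0] at hn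
      exact ⟨n, by linarith⟩
  choose! n hn using key
  refine ⟨s.sup n, add_mem (hu.1) (nsmul_mem hm.1 _), fun v hv => ?_⟩
  induction hv using Submodule.span_induction with
  | mem v hv =>
    have h1 := hn v hv
    have h2 : (n v : ℝ) ≤ (s.sup n : ℕ) := by exact_mod_cast Finset.le_sup (f := n) hv
    have h3 := mul_le_mul_of_nonneg_right h2 (hm.2 v (Submodule.subset_span hv))
    simp only [LinearMap.add_apply, LinearMap.smul_apply, nsmul_eq_mul]
    linarith
  | zero => simp
  | add x y _ _ hx hy => rw [map_add]; exact add_nonneg hx hy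
  | smul a x _ hx =>
    have : (u + s.sup n • m) (a • x) = (a : ℝ) * (u + s.sup n • m) x :=
      map_smul (u + s.sup n • m) (a : ℝ) x
    rw [this]
    exact mul_nonneg a.2 hx

/-- If `τ` is the face of `σ` cut out by `m`, then `K[S_τ]` is the localization of `K[S_σ]` at
the character `χ^m`. -/
theorem chartMap_isLocalization (F : Fan V) {σ τ : PointedCone ℝ V} (hσ : σ ∈ F.cones)
    (hτ : τ ≤ σ) {m : Module.Dual ℝ V} (hm : m ∈ dualMonoid F.lattice σ)
    (h : ∀ v, v ∈ τ ↔ v ∈ σ ∧ m v = 0) :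
    letI := (chartMap K (le_refl F.lattice) hτ).toRingHom.toAlgebra
    IsLocalization.Away (chi K F.lattice σ ⟨m, hm⟩) (ChartRing K F.lattice τ) := by
  let := (chartMap K (le_refl F.lattice) hτ).toRingHom.toAlgebra
  have halg : ∀ x, algebraMap (ChartRing K F.lattice σ) (ChartRing K F.lattice τ) x =
    chartMap K (le_refl F.lattice) hτ x := fun _ => rfl
  have hneg : -m ∈ dualMonoid F.lattice τ :=
    ⟨neg_mem hm.1, fun v hv => by simp [((h v).1 hv).2]⟩
  refine IsLocalization.Away.mk _ ?_ ?_ ?_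
  · rw [halg, chi, chartMap_single]
    refine IsUnit.of_mul_eq_one (AddMonoidAlgebra.single ⟨-m, hneg⟩ 1) ?_
    rw [AddMonoidAlgebra.single_mul_single, AddMonoidAlgebra.one_def, mul_one]
    congr 1
    exact Subtype.ext (add_neg_cancel m)
  · intro x
    induction x using AddMonoidAlgebra.induction_linear with
    | zero => exact ⟨0, 0, by simp⟩
    | add x y hx hy =>
      obtain ⟨n, a, ha⟩ := hx
      obtain ⟨k, b, hb⟩ := hy
      refine ⟨n + k, a * chi K F.lattice σ ⟨m, hm⟩ ^ k + b * chi K F.lattice σ ⟨m, hm⟩ ^ n, ?_⟩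
      rw [map_add, map_mul, map_mul, ← ha, ← hb, map_pow, map_pow]
      ring
    | single u a =>
      obtain ⟨n, hn⟩ := exists_smul_add_mem F hσ hm h u.2
      refine ⟨n, AddMonoidAlgebra.single ⟨_, hn⟩ a, ?_⟩
      rw [halg, halg, chi, chartMap_single, chartMap_single, AddMonoidAlgebra.single_pow, one_pow,
        AddMonoidAlgebra.single_mul_single, mul_one]
      congr 1
  · intro a b hab
    exact ⟨0, by rw [chartMap_injective K _ _ hab]⟩

theorem chartHom_range (F : Fan V) {σ τ : PointedCone ℝ V} (hσ : σ ∈ F.cones)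
    (hτ : τ ≤ σ) {m : Module.Dual ℝ V} (hm : m ∈ dualMonoid F.lattice σ)
    (h : ∀ v, v ∈ τ ↔ v ∈ σ ∧ m v = 0) :
    Set.range (chartHom K (le_refl F.lattice) hτ) =
      (PrimeSpectrum.basicOpen (chi K F.lattice σ ⟨m, hm⟩) :
        Set (PrimeSpectrum (ChartRing K F.lattice σ))) := by
  let := (chartMap K (le_refl F.lattice) hτ).toRingHom.toAlgebra
  have := chartMap_isLocalization K F hσ hτ hm h
  exact PrimeSpectrum.localization_away_comap_range (ChartRing K F.lattice τ)
    (chi K F.lattice σ ⟨m, hm⟩)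

theorem exists_face (F : Fan V) {σ τ : PointedCone ℝ V} (hσ : σ ∈ F.cones) (hτ : τ ∈ F.cones)
    (h : τ ≤ σ) : ∃ m, ∃ _ : m ∈ dualMonoid F.lattice σ, ∀ v, v ∈ τ ↔ v ∈ σ ∧ m v = 0 := by
  obtain ⟨m, hm, hf⟩ := F.inter_face σ hσ τ hτ
  rw [inf_eq_right.2 h] at hf
  exact ⟨m, hm, hf⟩

instance chartDiagram_isOpenImmersion (F : Fan V) {σ τ : F.cones} (f : τ ⟶ σ) :
    IsOpenImmersion ((chartDiagram K F.lattice F.cones).map f) := by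
  obtain ⟨m, hm, h⟩ := exists_face F σ.2 τ.2 (leOfHom f)
  let := (chartMap K (le_refl F.lattice) (leOfHom f)).toRingHom.toAlgebra
  have := chartMap_isLocalization K F σ.2 (leOfHom f) hm h
  exact IsOpenImmersion.of_isLocalization (S := ChartRing K F.lattice τ)
    (chi K F.lattice σ ⟨m, hm⟩)

instance chartDiagram_isLocallyDirected (F : Fan V) :
    ((chartDiagram K F.lattice F.cones) ⋙ Scheme.forget).IsLocallyDirected where
  cond := by
    intro τ₁ τ₂ σ f₁ f₂ x₁ x₂ hx
    obtain ⟨m₁, hm₁, h₁⟩ := exists_face F σ.2 τ₁.2 (leOfHom f₁)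
    obtain ⟨m₂, hm₂, h₂⟩ := exists_face F σ.2 τ₂.2 (leOfHom f₂)
    have hm : m₁ + m₂ ∈ dualMonoid F.lattice σ := add_mem hm₁ hm₂
    have h : ∀ v, v ∈ τ₁.1 ⊓ τ₂.1 ↔ v ∈ σ.1 ∧ (m₁ + m₂) v = 0 := by
      intro v
      rw [Submodule.mem_inf, h₁, h₂, LinearMap.add_apply]
      constructor
      · rintro ⟨⟨h0, h1⟩, _, h2⟩
        exact ⟨h0, by rw [h1, h2, add_zero]⟩
      · rintro ⟨h0, h1⟩
        have := hm₁.2 v h0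
        have := hm₂.2 v h0
        exact ⟨⟨h0, by linarith⟩, h0, by linarith⟩
    have hρ : τ₁.1 ⊓ τ₂.1 ∈ F.cones := F.face_mem σ.1 σ.2 _ ⟨_, hm, h⟩
    let ρ : F.cones := ⟨_, hρ⟩
    let g₁ : ρ ⟶ τ₁ := homOfLE (inf_le_left : τ₁.1 ⊓ τ₂.1 ≤ τ₁.1)
    let g₂ : ρ ⟶ τ₂ := homOfLE (inf_le_right : τ₁.1 ⊓ τ₂.1 ≤ τ₂.1)
    have r₁ := chartHom_range K F σ.2 (leOfHom f₁) hm₁ h₁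
    have r₂ := chartHom_range K F σ.2 (leOfHom f₂) hm₂ h₂
    have r := chartHom_range K F σ.2 (inf_le_left.trans (leOfHom f₁)) hm h
    let D := chartDiagram K F.lattice F.cones
    have hx' : D.map f₁ x₁ = D.map f₂ x₂ := hx
    have hr : D.map f₁ x₁ ∈ Set.range (D.map (g₁ ≫ f₁)) := by
      refine (Set.ext_iff.1 r (D.map f₁ x₁)).2 ?_
      have e₁ := (Set.ext_iff.1 r₁ (D.map f₁ x₁)).1 ⟨x₁, rfl⟩
      have e₂ := (Set.ext_iff.1 r₂ (D.map f₁ x₁)).1 ⟨x₂, hx'.symm⟩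
      have e : chi K F.lattice σ ⟨m₁ + m₂, hm⟩ =
          chi K F.lattice σ ⟨m₁, hm₁⟩ * chi K F.lattice σ ⟨m₂, hm₂⟩ := by
        rw [chi, chi, chi, AddMonoidAlgebra.single_mul_single, mul_one]
        rfl
      rw [e, PrimeSpectrum.basicOpen_mul]
      exact ⟨e₁, e₂⟩
    obtain ⟨y, hy⟩ := hr
    refine ⟨ρ, g₁, g₂, y, ?_, ?_⟩
    · refine (D.map f₁).isOpenEmbedding.injective ?_
      change (D.map g₁ ≫ D.map f₁) y = _
      rw [← D.map_comp]
      exact hy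
    · refine (D.map f₂).isOpenEmbedding.injective ?_
      change (D.map g₂ ≫ D.map f₂) y = _
      rw [← D.map_comp, Subsingleton.elim (g₂ ≫ f₂) (g₁ ≫ f₁)]
      exact hy.trans hx'

end Charts
section FG

variable {V : Type u} [NormedAddCommGroup V] [NormedSpace ℝ V] [FiniteDimensional ℝ V]

/-- Gordan's lemma: `S_σ` is finitely generated. -/
theorem dualMonoid_fg (F : Fan V) {σ : PointedCone ℝ V} (hσ : σ ∈ F.cones) :
    (dualMonoid F.lattice σ).FG := by
  classical
  obtain ⟨s, hs, rfl⟩ := F.rational σ hσ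
  have : Module.Free ℤ F.lattice := ZLattice.module_free ℝ F.lattice
  have : Module.Finite ℤ F.lattice := ZLattice.module_finite ℝ F.lattice
  let b := Module.Free.chooseBasis ℤ F.lattice
  let ι := Module.Free.ChooseBasisIndex ℤ F.lattice
  let B := b.ofZLatticeBasis ℝ F.lattice
  let h : ((s ⊕ (ι ⊕ ι)) → ℕ) →+ Module.Dual ℝ V :=
    { toFun := fun x => ∑ i, ((x (.inr (.inl i)) : ℝ) - x (.inr (.inr i))) • B.coord i
      map_zero' := by simp
      map_add' := fun x y => by
        rw [← Finset.sum_add_distrib]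
        refine Finset.sum_congr rfl fun i _ => ?_
        rw [← add_smul]
        congr 1
        simp only [Pi.add_apply, Nat.cast_add]
        ring }
  let f : ((s ⊕ (ι ⊕ ι)) → ℕ) →+ (s → ℝ) :=
    { toFun := fun x j => h x j.1
      map_zero' := by ext; simp
      map_add' := fun x y => by ext; simp }
  let g : ((s ⊕ (ι ⊕ ι)) → ℕ) →+ (s → ℝ) :=
    { toFun := fun x j => (x (.inl j) : ℝ)
      map_zero' := by ext; simp
      map_add' := fun x y => by ext; simp }
  have hBN : ∀ i, ∀ v ∈ F.lattice, ∃ k : ℤ, B.coord i v = k := by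
    intro i v hv
    exact ⟨b.repr ⟨v, hv⟩ i, b.ofZLatticeBasis_repr_apply ℝ F.lattice ⟨v, hv⟩ i⟩
  have key : dualMonoid F.lattice (Submodule.span {c : ℝ // 0 ≤ c} (s : Set V)) =
      (f.eqLocusM g).map h := by
    ext m
    constructor
    · rintro ⟨hm1, hm2⟩
      choose k hk using fun i => hm1 (B i) (by simp [B])
      choose l hl using fun j : s => hm1 j.1 (hs j.1 j.2)
      have hm : m = h (Sum.elim (fun j => (l j).toNat)
          (Sum.elim (fun i => (k i).toNat) (fun i => (-(k i)).toNat))) := by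
        refine B.ext fun i => ?_
        simp only [h, AddMonoidHom.coe_mk, ZeroHom.coe_mk, Sum.elim_inr, Sum.elim_inl,
          LinearMap.sum_apply, LinearMap.smul_apply, Module.Basis.coord_apply,
          Module.Basis.repr_self, hk]
        rw [Finset.sum_eq_single i (by intro j _ hj; simp [hj.symm])
          (by simp)]
        have : (((k i).toNat : ℤ) - ((-(k i)).toNat : ℤ) : ℤ) = k i := by omega
        simp only [Finsupp.single_eq_same, smul_eq_mul, mul_one]
        exact_mod_cast this.symm
      refine ⟨_, ?_, hm.symm⟩
      change f _ = g _
      ext j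
      change h _ j.1 = _
      rw [← hm, hl]
      have h0 : 0 ≤ l j := by
        have := hm2 j.1 (Submodule.subset_span j.2)
        rw [hl] at this
        exact_mod_cast this
      change ((l j : ℤ) : ℝ) = (((l j).toNat : ℕ) : ℝ)
      exact_mod_cast (Int.toNat_of_nonneg h0).symm
    · rintro ⟨x, hx, rfl⟩
      have hx' : ∀ j : s, h x j.1 = x (.inl j) := fun j => congrFun (show f x = g x from hx) j
      constructor
      · refine sum_mem fun i _ => fun v hv => ?_
        obtain ⟨k, hk⟩ := hBN i v hv
        refine ⟨((x (.inr (.inl i)) : ℤ) - x (.inr (.inr i))) * k, ?_⟩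
        rw [LinearMap.smul_apply, hk]
        push_cast
        rfl
      · intro v hv
        induction hv using Submodule.span_induction with
        | mem v hv =>
          rw [hx' ⟨v, hv⟩]
          exact Nat.cast_nonneg _
        | zero => simp
        | add x y _ _ hx hy => rw [map_add]; exact add_nonneg hx hy
        | smul a y _ hy =>
          have : (h x) (a • y) = (a : ℝ) * h x y := map_smul (h x) (a : ℝ) y
          rw [this]
          exact mul_nonneg a.2 hy
  rw [key]
  exact (AddSubmonoid.fg_eqLocusM f g).map h

end FG
section ToricVariety

variable (K : Type u) [Field K] {V : Type u} [NormedAddCommGroup V] [NormedSpace ℝ V]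

/-- The toric variety `Y` over `K` of a fan: the affine charts `U_σ = Spec K[S_σ]` glued along the
open inclusions `U_τ ⊆ U_σ`, for `τ` a face of `σ`. -/
noncomputable def Fan.toricVariety (F : Fan V) : Scheme.{u} :=
  colimit (chartDiagram K F.lattice F.cones)

/-- The open immersion of the affine chart `U_σ` into the toric variety. -/
noncomputable def Fan.chartι (F : Fan V) (σ : F.cones) :
    chart K F.lattice σ.1 ⟶ F.toricVariety K :=
  colimit.ι (chartDiagram K F.lattice F.cones) σ

theorem Fan.chartHom_chartι (F : Fan V) {τ σ : F.cones} (h : τ ≤ σ) :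
    chartHom K (le_refl F.lattice) (σ := σ.1) (τ := τ.1) h ≫ F.chartι K σ = F.chartι K τ :=
  colimit.w (chartDiagram K F.lattice F.cones) (homOfLE h)

/-- The structure morphism of the toric variety to `Spec K`. -/
noncomputable def Fan.structureMorphism (F : Fan V) : F.toricVariety K ⟶ Spec (.of K) :=
  colimit.desc (chartDiagram K F.lattice F.cones)
    { pt := Spec (.of K)
      ι :=
        { app := fun σ =>
            Spec.map (CommRingCat.ofHom (algebraMap K (ChartRing K F.lattice σ.1)))
          naturality := fun τ σ f => by
            change Spec.map _ ≫ Spec.map _ = Spec.map _ ≫ 𝟙 _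
            rw [Category.comp_id, ← Spec.map_comp, ← CommRingCat.ofHom_comp]
            congr 2
            exact (chartMap K (le_refl F.lattice) (leOfHom f)).comp_algebraMap } }

/-- The toric cover `X ⟶ Y` of the toric variety `Y` of the fan `(N, Σ)` corresponding to the map
of fans `(N', Σ) → (N, Σ)`, for a sublattice `N' ⊆ N` of finite index. On the affine charts it is
given by the inclusions `K[σ^∨ ∩ M] ⊆ K[σ^∨ ∩ M']`. -/
noncomputable def Fan.Sublattice.toricCover {F : Fan V} (L : F.Sublattice) :
    L.fan.toricVariety K ⟶ F.toricVariety K :=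
  colimit.desc (chartDiagram K L.fan.lattice L.fan.cones)
    { pt := F.toricVariety K
      ι :=
        { app := fun σ => chartHom K L.le (le_refl σ.1) ≫ F.chartι K ⟨σ.1, σ.2⟩
          naturality := fun τ σ f => by
            have h : τ.1 ≤ σ.1 := leOfHom f
            have e : chartHom K (le_refl L.carrier) h ≫ chartHom K L.le (le_refl σ.1) =
                chartHom K L.le (le_refl τ.1) ≫ chartHom K (le_refl F.lattice) h := by
              rw [chartHom_comp, chartHom_comp]
            refine (Category.assoc _ _ _).symm.trans ?_
            refine (congrArg (fun g => g ≫ F.chartι K ⟨σ.1, σ.2⟩) e).trans ?_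
            refine (Category.assoc _ _ _).trans (Eq.trans ?_ (Category.comp_id _).symm)
            exact congrArg (fun g => chartHom K L.le (le_refl τ.1) ≫ g)
              (F.chartHom_chartι K (τ := ⟨τ.1, τ.2⟩) (σ := ⟨σ.1, σ.2⟩) h) } }

variable (F : Fan V)

instance chartι_isOpenImmersion (σ : F.cones) : IsOpenImmersion (F.chartι K σ) :=
  inferInstanceAs (IsOpenImmersion (colimit.ι (chartDiagram K F.lattice F.cones) σ))

/-- The cover of a toric variety by its affine charts. -/
noncomputable def Fan.openCover : (F.toricVariety K).OpenCover :=
  Scheme.IsLocallyDirected.openCover (chartDiagram K F.lattice F.cones)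

theorem exists_chartι (x : F.toricVariety K) : ∃ σ, ∃ y, F.chartι K σ y = x :=
  (F.openCover K).exists_eq x

instance dualMonoid_twoUniqueSums (N : Submodule ℤ V) (σ : PointedCone ℝ V) :
    TwoUniqueSums (dualMonoid N σ) :=
  letI : Module ℚ (Module.Dual ℝ V) := Module.compHom _ (algebraMap ℚ ℝ)
  TwoUniqueSums.of_injective_addHom (dualMonoid N σ).subtype.toAddHom
    Subtype.val_injective inferInstance

instance chartRing_isDomain (N : Submodule ℤ V) (σ : PointedCone ℝ V) :
    IsDomain (ChartRing K N σ) :=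
  NoZeroDivisors.to_isDomain _

instance chart_isIntegral (N : Submodule ℤ V) (σ : PointedCone ℝ V) :
    IsIntegral (chart K N σ) :=
  inferInstanceAs (IsIntegral (Spec (.of (ChartRing K N σ))))

theorem chartι_genericPoint_of_le {τ σ : F.cones} (h : τ ≤ σ) :
    F.chartι K τ (genericPoint (chart K F.lattice τ.1)) =
      F.chartι K σ (genericPoint (chart K F.lattice σ.1)) := by
  have : IsOpenImmersion
      (chartHom K (le_refl F.lattice) (show τ.1 ≤ σ.1 from h)) :=
    chartDiagram_isOpenImmersion K F (homOfLE h)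
  rw [← genericPoint_eq_of_isOpenImmersion
    (chartHom K (le_refl F.lattice) (show τ.1 ≤ σ.1 from h)), ← F.chartHom_chartι K h]
  rfl

instance toricVariety_isIntegral : IsIntegral (F.toricVariety K) := by
  obtain ⟨σ₀, hσ₀⟩ := F.nonempty
  let η := F.chartι K ⟨σ₀, hσ₀⟩ (genericPoint (chart K F.lattice σ₀))
  have hη : ∀ σ : F.cones, F.chartι K σ (genericPoint (chart K F.lattice σ.1)) = η := by
    intro σ
    let ρ : F.cones := ⟨σ.1 ⊓ σ₀, F.face_mem _ σ.2 _ (F.inter_face _ σ.2 _ hσ₀)⟩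
    rw [← chartι_genericPoint_of_le K F (τ := ρ) (σ := σ) (show σ.1 ⊓ σ₀ ≤ σ.1 from inf_le_left),
      chartι_genericPoint_of_le K F (τ := ρ) (σ := ⟨σ₀, hσ₀⟩)
        (show σ.1 ⊓ σ₀ ≤ σ₀ from inf_le_right)]
  have hcl : closure {η} = (Set.univ : Set (F.toricVariety K)) := by
    refine Set.eq_univ_of_forall fun x => ?_
    obtain ⟨σ, y, rfl⟩ := exists_chartι K F x
    rw [← hη σ]
    exact specializes_iff_mem_closure.1
      ((genericPoint_specializes y).map (F.chartι K σ).continuous)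
  have : IrreducibleSpace (F.toricVariety K) := by
    have : PreirreducibleSpace (F.toricVariety K) :=
      ⟨hcl ▸ isIrreducible_singleton.closure.isPreirreducible⟩
    exact { toNonempty := ⟨η⟩ }
  have : ∀ i, IsReduced ((F.openCover K).X i) := fun i =>
    inferInstanceAs (IsReduced (chart K F.lattice i.1))
  have : IsReduced (F.toricVariety K) := IsReduced.of_openCover _ (F.openCover K)
  exact isIntegral_of_irreducibleSpace_of_isReduced _

instance toricVariety_isLocallyNoetherian [FiniteDimensional ℝ V] :
    IsLocallyNoetherian (F.toricVariety K) := by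
  refine (isLocallyNoetherian_iff_openCover (F.openCover K)).2 fun σ => ?_
  have : AddMonoid.FG (dualMonoid F.lattice σ.1) :=
    (AddMonoid.fg_iff_addSubmonoid_fg _).2 (dualMonoid_fg F σ.2)
  have : IsNoetherianRing (ChartRing K F.lattice σ.1) :=
    Algebra.FiniteType.isNoetherianRing K _
  exact inferInstanceAs (IsLocallyNoetherian (Spec (.of (ChartRing K F.lattice σ.1))))

end ToricVariety
section Divisors

/-- The group of Weil divisors of a Noetherian scheme `X`: finite integral combinations of prime
divisors, a prime divisor being represented by its generic point, a point of codimension one. -/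
def WeilDivisor (X : Scheme.{u}) : AddSubgroup (X →₀ ℤ) where
  carrier := {D | ∀ x, D x ≠ 0 → Order.coheight x = 1}
  zero_mem' := fun x hx => (hx rfl).elim
  add_mem' := by
    intro a b ha hb x hx
    by_cases h : a x = 0
    · exact hb x fun h' => hx (by simp [h, h'])
    · exact ha x h
  neg_mem' := fun ha x hx => ha x fun h => hx (by simp [h])

theorem ord_one {X : Scheme.{u}} [IsIntegral X] [IsLocallyNoetherian X] (x : X) :
    Scheme.ord (1 : X.functionField) x = 0 := by
  have h := Scheme.ord_mul (x := x) (one_ne_zero (α := X.functionField)) one_ne_zero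
  rw [mul_one] at h
  omega

/-- The subgroup of principal divisors `div f = ∑ ord_D(f) D`, for `f` a nonzero rational
function. -/
noncomputable def principalDivisors (X : Scheme.{u}) [IsIntegral X] [IsLocallyNoetherian X] :
    AddSubgroup (WeilDivisor X) where
  carrier := {D | ∃ f : X.functionField, f ≠ 0 ∧ ∀ x, D.1 x = Scheme.ord f x}
  zero_mem' := ⟨1, one_ne_zero, fun x => (ord_one x).symm⟩
  add_mem' := by
    rintro a b ⟨f, hf, ha⟩ ⟨g, hg, hb⟩
    refine ⟨f * g, mul_ne_zero hf hg, fun x => ?_⟩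
    rw [Scheme.ord_mul hf hg, ← ha, ← hb]
    rfl
  neg_mem' := by
    rintro a ⟨f, hf, ha⟩
    refine ⟨f⁻¹, inv_ne_zero hf, fun x => ?_⟩
    have h := Scheme.ord_mul (x := x) hf (inv_ne_zero hf)
    rw [mul_inv_cancel₀ hf, ord_one, ← ha] at h
    change -(a.1 x) = _
    omega

/-- The class group `Cl(X)` of Weil divisors modulo linear equivalence. -/
abbrev Cl (X : Scheme.{u}) [IsIntegral X] [IsLocallyNoetherian X] : Type u :=
  WeilDivisor X ⧸ principalDivisors X

/-- The class in `Cl(X)` of the prime divisor with generic point `x`. -/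
noncomputable def primeDivisorClass {X : Scheme.{u}} [IsIntegral X] [IsLocallyNoetherian X]
    (x : X) (hx : Order.coheight x = 1) : Cl X :=
  QuotientAddGroup.mk ⟨Finsupp.single x 1, fun y hy => by
    classical
    by_cases h : x = y
    · exact h ▸ hx
    · exact (hy (by simp [h])).elim⟩

end Divisors

section Rays

variable (K : Type u) [Field K] {V : Type u} [NormedAddCommGroup V] [NormedSpace ℝ V]

/-- A ray of the fan, given by its integral generator `r`: the cone `ℝ_{≥0} r` belongs to the fan
and `N ∩ ℝ_{≥0} r` is generated by `r`. -/
structure Fan.Ray (F : Fan V) where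
  /-- the integral generator `r` -/
  gen : V
  gen_mem : gen ∈ F.lattice
  gen_ne_zero : gen ≠ 0
  cone_mem : Submodule.span {c : ℝ // 0 ≤ c} {gen} ∈ F.cones
  generates : ∀ v ∈ F.lattice, v ∈ Submodule.span {c : ℝ // 0 ≤ c} {gen} → ∃ k : ℕ, v = k • gen

variable {F : Fan V}

/-- The one-dimensional cone `ρ = ℝ_{≥0} r` of a ray, as a cone of the fan. -/
def Fan.Ray.cone (r : F.Ray) : F.cones :=
  ⟨Submodule.span {c : ℝ // 0 ≤ c} {r.gen}, r.cone_mem⟩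

theorem Fan.Ray.cone_injective : Function.Injective (Fan.Ray.cone (F := F)) := by
  intro r s h
  have hc : r.cone.1 = s.cone.1 := congrArg Subtype.val h
  obtain ⟨k, hk⟩ := s.generates _ r.gen_mem 
    (by change r.gen ∈ s.cone.1; rw [← hc]; exact Submodule.mem_span_singleton_self r.gen)
  obtain ⟨l, hl⟩ := r.generates _ s.gen_mem 
    (by change s.gen ∈ r.cone.1; rw [hc]; exact Submodule.mem_span_singleton_self s.gen)
  have h1 : (k * l) • r.gen = (1 : ℕ) • r.gen := by
    rw [mul_smul, ← hl, ← hk, one_smul]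
  have h2 : k * l = 1 := by
    rw [← Nat.cast_smul_eq_nsmul ℝ, ← Nat.cast_smul_eq_nsmul ℝ] at h1
    exact_mod_cast smul_left_injective ℝ r.gen_ne_zero h1
  have h3 : r.gen = s.gen := by rw [hk, Nat.eq_one_of_mul_eq_one_right h2, one_smul]
  cases r; cases s; cases h3; rfl

instance Fan.Ray.finite : Finite F.Ray :=
  have : Finite F.cones := F.finite
  Finite.of_injective _ Fan.Ray.cone_injective

theorem Fan.Ray.gen_mem_cone (r : F.Ray) : r.gen ∈ r.cone.1 :=
  Submodule.mem_span_singleton_self _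

theorem Fan.Ray.mem_dualMonoid_iff (r : F.Ray) (m : Module.Dual ℝ V) :
    m ∈ dualMonoid F.lattice r.cone.1 ↔ m ∈ dualLattice F.lattice ∧ 0 ≤ m r.gen := by
  refine ⟨fun h => ⟨h.1, h.2 _ r.gen_mem_cone⟩, fun h => ⟨h.1, fun v hv => ?_⟩⟩
  obtain ⟨a, rfl⟩ := Submodule.mem_span_singleton.1 hv
  have : m (a • r.gen) = (a : ℝ) * m r.gen := map_smul m (a : ℝ) r.gen
  rw [this]
  exact mul_nonneg a.2 h.2

open Classical in
/-- The homomorphism `K[S_ρ] → K[ρ^⊥ ∩ M] ⊆ K[S_ρ]` restricting functions on the chart `U_ρ` to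
the closed torus orbit `O_ρ = Spec K[ρ^⊥ ∩ M]`: it sends `χ^m` to itself if `m` vanishes on `ρ` and
to zero otherwise. -/
noncomputable def Fan.Ray.orbitHom (r : F.Ray) :
    ChartRing K F.lattice r.cone.1 →ₐ[K] ChartRing K F.lattice r.cone.1 :=
  AddMonoidAlgebra.lift K (ChartRing K F.lattice r.cone.1) (dualMonoid F.lattice r.cone.1)
    { toFun := fun m =>
        if m.toAdd.1 r.gen = 0 then chi K F.lattice r.cone.1 m.toAdd else 0
      map_one' := by
        rw [if_pos (by simp)]
        rfl
      map_mul' := fun a b => by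
        have ha := a.toAdd.2.2 _ r.gen_mem_cone
        have hb := b.toAdd.2.2 _ r.gen_mem_cone
        have hab : (a * b).toAdd.1 r.gen = a.toAdd.1 r.gen + b.toAdd.1 r.gen := rfl
        by_cases h1 : a.toAdd.1 r.gen = 0
        · by_cases h2 : b.toAdd.1 r.gen = 0
          · rw [if_pos h1, if_pos h2, if_pos (by rw [hab, h1, h2, add_zero]), chi, chi, chi,
              AddMonoidAlgebra.single_mul_single, mul_one]
            rfl
          · rw [if_neg h2, if_neg (by rw [hab, h1, zero_add]; exact h2), mul_zero]
        · rw [if_neg h1, if_neg (by rw [hab]; intro h; exact h1 (by linarith)), zero_mul] }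

/-- The prime ideal of the closed torus orbit `O_ρ = D_ρ ∩ U_ρ` in the chart `U_ρ` of a ray. -/
noncomputable def Fan.Ray.orbitPoint (r : F.Ray) : chart K F.lattice r.cone.1 :=
  (⟨RingHom.ker (r.orbitHom K).toRingHom, RingHom.ker_isPrime _⟩ :
    PrimeSpectrum (ChartRing K F.lattice r.cone.1))

/-- The generic point of the torus-invariant prime divisor `D_ρ` of the toric variety that
corresponds to a ray `ρ` of the fan, that is, of the closure of the orbit `O_ρ`. -/
noncomputable def Fan.Ray.divisor (r : F.Ray) : F.toricVariety K :=
  F.chartι K r.cone (r.orbitPoint K)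

theorem Fan.Ray.orbitHom_chi (r : F.Ray) (m : dualMonoid F.lattice r.cone.1) (a : K) :
    r.orbitHom K (AddMonoidAlgebra.single m a) =
      if m.1 r.gen = 0 then AddMonoidAlgebra.single m a else 0 := by
  classical
  rw [orbitHom, AddMonoidAlgebra.lift_single]
  change a • (if m.1 r.gen = 0 then chi K F.lattice r.cone.1 m else 0) = _
  split_ifs
  · rw [chi, AddMonoidAlgebra.smul_single, smul_eq_mul, mul_one]
  · rw [smul_zero]

theorem Fan.Ray.exists_minimal [FiniteDimensional ℝ V] (r : F.Ray) :
    ∃ m ∈ dualLattice F.lattice, 0 < m r.gen ∧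
      ∀ m' ∈ dualLattice F.lattice, 0 < m' r.gen → m r.gen ≤ m' r.gen := by
  classical
  have : Module.Free ℤ F.lattice := ZLattice.module_free ℝ F.lattice
  have : Module.Finite ℤ F.lattice := ZLattice.module_finite ℝ F.lattice
  let b := Module.Free.chooseBasis ℤ F.lattice
  let B := b.ofZLatticeBasis ℝ F.lattice
  have hB : ∀ i, B.coord i ∈ dualLattice F.lattice := fun i v hv =>
    ⟨b.repr ⟨v, hv⟩ i, b.ofZLatticeBasis_repr_apply ℝ F.lattice ⟨v, hv⟩ i⟩
  have hex : ∃ n : ℕ, 0 < n ∧ ∃ m ∈ dualLattice F.lattice, m r.gen = n := by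
    obtain ⟨i, hi⟩ : ∃ i, B.coord i r.gen ≠ 0 := by
      by_contra! h
      exact r.gen_ne_zero (B.forall_coord_eq_zero_iff.1 h)
    obtain ⟨k, hk⟩ := hB i _ r.gen_mem
    rcases lt_trichotomy k 0 with h | h | h
    · refine ⟨(-k).toNat, by omega, -B.coord i, neg_mem (hB i), ?_⟩
      have : (((-k).toNat : ℕ) : ℤ) = -k := Int.toNat_of_nonneg (by omega)
      rw [LinearMap.neg_apply, hk]
      exact_mod_cast this.symm
    · exact (hi (by rw [hk, h, Int.cast_zero])).elim
    · refine ⟨k.toNat, by omega, B.coord i, hB i, ?_⟩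
      have : ((k.toNat : ℕ) : ℤ) = k := Int.toNat_of_nonneg (by omega)
      rw [hk]
      exact_mod_cast this.symm
  obtain ⟨h0, m, hm, hmr⟩ := Nat.find_spec hex
  refine ⟨m, hm, by rw [hmr]; exact_mod_cast h0, fun m' hm' hpos => ?_⟩
  obtain ⟨k, hk⟩ := hm' _ r.gen_mem
  rw [hk] at hpos
  have hk0 : 0 < k := by exact_mod_cast hpos
  have hk1 : ((k.toNat : ℕ) : ℤ) = k := Int.toNat_of_nonneg hk0.le
  have := Nat.find_min' hex ⟨(by omega : 0 < k.toNat), m', hm', by rw [hk]; exact_mod_cast hk1.symm⟩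
  rw [hmr, hk, ← hk1]
  exact_mod_cast this

theorem Fan.Ray.coheight_divisor [FiniteDimensional ℝ V] (r : F.Ray) :
    Order.coheight (r.divisor K) = 1 := by
  classical
  obtain ⟨m, hm, hpos, hmin⟩ := r.exists_minimal
  have hmS : m ∈ dualMonoid F.lattice r.cone.1 := (r.mem_dualMonoid_iff m).2 ⟨hm, hpos.le⟩
  let P : Ideal (ChartRing K F.lattice r.cone.1) := RingHom.ker (r.orbitHom K).toRingHom
  have hP : P.IsPrime := RingHom.ker_isPrime _
  let t := chi K F.lattice r.cone.1 ⟨m, hmS⟩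
  have htP : t ∈ P := by
    change r.orbitHom K (AddMonoidAlgebra.single _ _) = 0
    rw [orbitHom_chi, if_neg hpos.ne']
  have ht0 : t ≠ 0 := by
    simp [t, chi]
  have hsub : ∀ f : ChartRing K F.lattice r.cone.1, f - r.orbitHom K f ∈ Ideal.span {t} := by
    intro f
    induction f using AddMonoidAlgebra.induction_linear with
    | zero => simp
    | add f g hf hg =>
      rw [map_add, add_sub_add_comm]
      exact add_mem hf hg
    | single u a =>
      rw [orbitHom_chi]
      split_ifs with h
      · simp
      · rw [sub_zero]
        have hu : 0 < u.1 r.gen := lt_of_le_of_ne (u.2.2 _ r.gen_mem_cone) (Ne.symm h)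
        have hw : u.1 - m ∈ dualMonoid F.lattice r.cone.1 := by
          refine (r.mem_dualMonoid_iff _).2 ⟨sub_mem u.2.1 hm, ?_⟩
          have := hmin u.1 u.2.1 hu
          rw [LinearMap.sub_apply]
          linarith
        refine Ideal.mem_span_singleton.2 ⟨AddMonoidAlgebra.single ⟨_, hw⟩ a, ?_⟩
        change _ = AddMonoidAlgebra.single _ _ * _
        rw [AddMonoidAlgebra.single_mul_single, one_mul]
        congr 1
        exact Subtype.ext (add_sub_cancel m u.1).symm
  have hPt : P = Ideal.span {t} := by
    refine le_antisymm (fun f hf => ?_) ((Ideal.span_singleton_le_iff_mem _).2 htP)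
    have := hsub f
    rwa [show r.orbitHom K f = 0 from hf, sub_zero] at this
  have : AddMonoid.FG (dualMonoid F.lattice r.cone.1) :=
    (AddMonoid.fg_iff_addSubmonoid_fg _).2 (dualMonoid_fg F r.cone.2)
  have : IsNoetherianRing (ChartRing K F.lattice r.cone.1) :=
    Algebra.FiniteType.isNoetherianRing K _
  have h1 : P.height ≤ 1 := by
    have : (Ideal.span {t}).IsPrincipal := ⟨⟨t, rfl⟩⟩
    refine Ideal.height_le_one_of_isPrincipal_of_mem_minimalPrimes (Ideal.span {t}) P ?_
    rw [← hPt]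
    exact ⟨⟨hP, le_refl _⟩, fun Q hQ _ => hQ.2⟩
  have h2 : P.height ≠ 0 := by
    intro h
    rw [Ideal.height_eq_zero_iff_eq_bot.1 h] at htP
    exact ht0 htP
  have h3 : P.height = 1 := le_antisymm h1 (Order.one_le_iff_ne_zero.2 h2)
  rw [divisor]
  refine (coheight_eq_of_isOpenImmersion (F.chartι K r.cone)).trans ?_
  rw [← h3]
  exact (idealHeight_eq_coheight (.of (ChartRing K F.lattice r.cone.1)) (r.orbitPoint K)).symm

end Rays
section Covers

/-- `q : X ⟶ Z` is the (geometric) quotient of the scheme `X` by the group `H` of automorphisms: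
`q` is `H`-invariant, `Z` is the topological orbit space `X / H`, and the functions on an open subset
`U` of `Z` are the `H`-invariant functions on `q⁻¹(U)`. -/
structure IsQuotient {X Z : Scheme.{u}} (H : Subgroup (Aut X)) (q : X ⟶ Z) : Prop where
  invariant : ∀ g ∈ H, g.hom ≫ q = q
  isQuotientMap : Topology.IsQuotientMap q
  orbit : ∀ x y : X, q x = q y → ∃ g ∈ H, g.hom x = y
  sections : ∀ (U : Z.Opens) (s : Γ(X, q ⁻¹ᵁ U)),
    (∀ g, ∀ hg : g ∈ H, (g.hom.appLE (q ⁻¹ᵁ U) (q ⁻¹ᵁ U)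
      (by rw [← Scheme.Hom.comp_preimage, invariant g hg])).hom s = s) →
    ∃! t : Γ(Z, U), (q.app U).hom t = s

/-- The group `Aut(X/Y)` of a morphism `X ⟶ Y`. -/
abbrev CoverGroup {X Y : Scheme.{u}} (f : X ⟶ Y) : Type u := Aut (Over.mk f)

/-- The action of `Aut(X/Y)` on `X`. -/
def coverAction {X Y : Scheme.{u}} (f : X ⟶ Y) : CoverGroup f →* Aut X :=
  (Over.forget Y).mapAut (Over.mk f)

/-- A Galois cover: a finite morphism `X ⟶ Y` for which `Y` is the quotient of `X` by the group
`Aut(X/Y)`, which is then the Galois group of the cover. -/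
structure IsGaloisCover {X Y : Scheme.{u}} (f : X ⟶ Y) : Prop where
  isFinite : IsFinite f
  isQuotient : IsQuotient (coverAction f).range f

/-- The cover `f' : X' ⟶ Y` is the quotient of the cover `f : X ⟶ Y` by a subgroup
`H` of `Aut(X/Y)`. -/
def IsQuotientCover {X X' Y : Scheme.{u}} (f : X ⟶ Y) (f' : X' ⟶ Y)
    (H : Subgroup (CoverGroup f)) : Prop :=
  ∃ q : X ⟶ X', q ≫ f' = f ∧ IsQuotient (H.map (coverAction f)) q

/-- The cover `f : X ⟶ Y` is branched on the prime divisors `D_i` of `Y` (given by their generic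
points) with orders `d_i`: the divisorial part of the branch locus is contained in `∑ D_i`, that is,
`f` is unramified over every point of codimension one of `Y` other than the `D_i`, and the
ramification order of `f` over `D_i` is `d_i`, that is, `𝔪_y 𝒪_{X,x} = 𝔪_x ^ d_i` for every point
`x` of `X` over the generic point `y` of `D_i`. -/
structure IsBranchedWithOrders {X Y : Scheme.{u}} (f : X ⟶ Y) {ι : Type*} (D : ι → Y)
    (d : ι → ℕ) : Prop where
  unramified : ∀ x : X, Order.coheight (f x) = 1 → (∀ i, f x ≠ D i) →
    (f.stalkMap x).hom.FormallyUnramified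
  ramificationOrder : ∀ i, ∀ x : X, f x = D i →
    (IsLocalRing.maximalIdeal (Y.presheaf.stalk (f x))).map (f.stalkMap x).hom =
      IsLocalRing.maximalIdeal (X.presheaf.stalk x) ^ d i

end Covers

section MaximalGroup

variable (K : Type u) [Field K] {V : Type u} [NormedAddCommGroup V] [NormedSpace ℝ V]
  [FiniteDimensional ℝ V] (F : Fan V)

/-- The map `φ : Cl(Y)^∨ → ⨁ ℤ/d_i`, the dual of `ℤ^n → Cl(Y)`, `e_i ↦ [D_i]`, followed by the
reduction modulo the `d_i`. (There are finitely many rays, so that the product is the direct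
sum.) -/
noncomputable def phi (d : F.Ray → ℕ) :
    (Cl (F.toricVariety K) →+ ℤ) →+ ((r : F.Ray) → ZMod (d r)) where
  toFun ψ r := (ψ (primeDivisorClass (r.divisor K) (r.coheight_divisor K)) : ℤ)
  map_zero' := by ext; simp
  map_add' := fun _ _ => by ext; simp

/-- The subgroup `K_min`, the image of `φ`. -/
noncomputable def Kmin (d : F.Ray → ℕ) : AddSubgroup ((r : F.Ray) → ZMod (d r)) :=
  (phi K F d).range

/-- The group `G_max`, the cokernel of `K_min → ⨁ ℤ/d_i`. -/
abbrev Gmax (d : F.Ray → ℕ) : Type u :=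
  ((r : F.Ray) → ZMod (d r)) ⧸ Kmin K F d

open Classical in
/-- The map `ℤ/d_i → G_max`. -/
noncomputable def toGmax (d : F.Ray → ℕ) (r : F.Ray) : ZMod (d r) →+ Gmax K F d :=
  (QuotientAddGroup.mk' (Kmin K F d)).comp (AddMonoidHom.single (fun r => ZMod (d r)) r)

end MaximalGroup

end Toric

/-!
Let `M = Hom(N, ℤ)` and let `N' ⊆ N` be a sublattice of finite index, with `M' = Hom(N', ℤ) ⊇ M`.

*Ramification.* On the chart of a ray with integral generator `r`, the divisor `D_r` is cut out by
any character `χ^m` with `m(r) = 1`. If `r` has order `e` in `N / N'`, the generator of the ray in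
`N'` is `e r`, and `χ^m` is the `e`-th power of a uniformizer `χ^{m'}`, `m' ∈ M'`, up to a unit.
Hence the ramification order over `D_r` is the order of `r` in `N / N'`
(`Fan.Sublattice.exists_uniformizer`, `Fan.Sublattice.map_maximalIdeal`). All other points of
codimension one lie in the torus (`Fan.exists_of_coheight_eq_one`), where the cover is an isogeny
of tori. It is unramified when the exponent of `N / N'` is prime to the characteristic
(`chartMap_formallyUnramified`). So being branched with the orders `d_r` means that `k r ∈ N' ↔
d_r ∣ k` for all `r` and `k`. In particular `N'` contains `N'_min = ⟨d_r r⟩`.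

*The class group.* The ring of functions on the torus is factorial and its units are monomials, so
that `Cl(Y)` is the quotient of `ℤ^n` by the divisors `(m(r))_r` of the characters
(`Fan.invClass_surjective`, `Fan.exists_charDivisor_eq`), and `Hom(Cl(Y), ℤ)` is the group of
relations `∑ a_r r = 0` (`Fan.exists_hom_cl_iff`). On a complete variety a character vanishing on
all rays is a global function, hence trivial (`Fan.eq_zero_of_forall_ray`), and if moreover
`Cl(Y)` is torsion-free, the rays generate `N` (`Fan.raySpan_eq`). Therefore `e_r ↦ r` induces an
isomorphism `G_max ≅ N / N'_min` (`Fan.mkGmax_eq_zero_iff`), and `ℤ/d_r → G_max` is injective if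
and only if `r` has order `d_r` in `N / N'_min` (`toGmax_injective_iff`). If some `N'` is branched
with the orders `d_r`, then the order of `r` in `N / N'_min` is at least its order `d_r` in `N /
N'`, and it divides `d_r`. Conversely, the product of the `d_r` is an exponent of `N / N'_min`, so
that the cover of `N'_min` is branched as required if the maps are injective.

*Galois groups.* When an exponent `e` of `N / N'` is prime to the characteristic, a primitive
`e`-th root of unity identifies `N / N'` with the kernel of the isogeny of tori
(`rootHom_surjective`, `rootHom_eq_one_iff`). This kernel acts on the cover with quotient `Y`
(`Fan.Sublattice.isGaloisCover`), since its invariants in `K[M']` are `K[M]` on every chart, and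
it is the whole automorphism group (`Fan.Sublattice.toCoverGroup_surjective`), as automorphisms
preserve the torus and `K[M']` has no units but monomials. Applied to `N'_min ⊆ N'` for an
intermediate lattice `N'`, this shows that the cover of `N'` is a quotient of that of `N'_min`
(`Fan.Sublattice.exists_isQuotientCover`).
-/

namespace Toric

open AlgebraicGeometry CategoryTheory Limits

/-! ### Lattices, their duals, and the rays of a fan -/

section Lattice

variable {V : Type u} [NormedAddCommGroup V] [NormedSpace ℝ V]

/-- A lattice has a basis of `V` for which it is the set of vectors with integral coordinates. -/
theorem exists_latticeBasis [FiniteDimensional ℝ V] (N : Submodule ℤ V) [DiscreteTopology N]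
    [IsZLattice ℝ N] :
    ∃ (ι : Type u) (_ : Fintype ι) (B : Module.Basis ι ℝ V),
      ∀ v, v ∈ N ↔ ∀ i, ∃ k : ℤ, B.repr v i = k := by
  classical
  have : Module.Free ℤ N := ZLattice.module_free ℝ N
  have : Module.Finite ℤ N := ZLattice.module_finite ℝ N
  let b := Module.Free.chooseBasis ℤ N
  let B := b.ofZLatticeBasis ℝ N
  refine ⟨_, inferInstance, B, fun v => ⟨fun hv i => ⟨b.repr ⟨v, hv⟩ i,
    b.ofZLatticeBasis_repr_apply ℝ N ⟨v, hv⟩ i⟩, fun h => ?_⟩⟩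
  rw [← B.sum_repr v]
  refine sum_mem fun i _ => ?_
  obtain ⟨k, hk⟩ := h i
  have h1 : B i = b i := b.ofZLatticeBasis_apply ℝ N i
  rw [hk, h1, Int.cast_smul_eq_zsmul]
  exact zsmul_mem (b i).2 k

variable {N : Submodule ℤ V} {ι : Type u} {B : Module.Basis ι ℝ V}

theorem basis_mem_lattice (hB : ∀ v, v ∈ N ↔ ∀ i, ∃ k : ℤ, B.repr v i = k)
    (i : ι) : B i ∈ N := by
  classical
  refine (hB _).2 fun j => ⟨if i = j then 1 else 0, ?_⟩
  rw [B.repr_self, Finsupp.single_apply]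
  split_ifs <;> simp

theorem coord_mem_dualLattice (hB : ∀ v, v ∈ N ↔ ∀ i, ∃ k : ℤ, B.repr v i = k)
    (i : ι) : B.coord i ∈ dualLattice N :=
  fun v hv => (hB v).1 hv i

theorem mem_dualLattice_iff_basis [Fintype ι]
    (hB : ∀ v, v ∈ N ↔ ∀ i, ∃ k : ℤ, B.repr v i = k)
    (m : Module.Dual ℝ V) :
    m ∈ dualLattice N ↔ ∀ i, ∃ k : ℤ, m (B i) = k := by
  refine ⟨fun h i => h _ (basis_mem_lattice hB i), fun h v hv => ?_⟩
  choose k hk using h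
  choose l hl using (hB v).1 hv
  refine ⟨∑ i, l i * k i, ?_⟩
  rw [← B.sum_repr v, map_sum]
  simp [hk, hl]

variable [FiniteDimensional ℝ V] [DiscreteTopology N] [IsZLattice ℝ N]

/-- A lattice is its own bidual. -/
theorem mem_lattice_of_forall_dualLattice {v : V}
    (h : ∀ m ∈ dualLattice N, ∃ k : ℤ, m v = k) : v ∈ N := by
  obtain ⟨ι, _, B, hB⟩ := exists_latticeBasis N
  exact (hB v).2 fun i => h _ (coord_mem_dualLattice hB i)

theorem eq_zero_of_forall_dualLattice {v : V} (h : ∀ m ∈ dualLattice N, m v = 0) : v = 0 := by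
  obtain ⟨ι, _, B, hB⟩ := exists_latticeBasis N
  exact B.forall_coord_eq_zero_iff.1 fun i => h _ (coord_mem_dualLattice hB i)

theorem dual_ext_of_lattice {m m' : Module.Dual ℝ V} (h : ∀ v ∈ N, m v = m' v) : m = m' := by
  obtain ⟨ι, _, B, hB⟩ := exists_latticeBasis N
  exact B.ext fun i => h _ (basis_mem_lattice hB i)

/-- Every homomorphism from a lattice to `ℝ` extends to a linear form. -/
theorem exists_dual_extension (φ : N →+ ℝ) : ∃ m : Module.Dual ℝ V, ∀ v : N, m v.1 = φ v := by
  obtain ⟨ι, _, B, hB⟩ := exists_latticeBasis N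
  let b : ι → N := fun i => ⟨B i, basis_mem_lattice hB i⟩
  refine ⟨B.constr ℝ fun i => φ (b i), fun v => ?_⟩
  choose l hl using (hB v.1).1 v.2
  have hv : v = ∑ i, l i • b i := by
    refine Subtype.ext ?_
    rw [AddSubmonoidClass.coe_finsetSum]
    conv_lhs => rw [← B.sum_repr v.1]
    refine Finset.sum_congr rfl fun i _ => ?_
    rw [hl, Int.cast_smul_eq_zsmul]
    rfl
  conv_rhs => rw [hv, map_sum]
  rw [← B.sum_repr v.1, map_sum]
  refine Finset.sum_congr rfl fun i _ => ?_
  rw [map_smul, B.constr_basis, hl, map_zsmul]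
  simp

/-- Linear forms with integral values are dense up to scaling: a form that is positive on finitely
many vectors can be replaced by an integral one. -/
theorem exists_integral_pos (s : Finset V) (f : Module.Dual ℝ V) (hf : ∀ v ∈ s, 0 < f v) :
    ∃ m ∈ dualLattice N, ∀ v ∈ s, 0 < m v := by
  obtain ⟨ι, _, B, hB⟩ := exists_latticeBasis N
  have key : ∀ v ∈ s, ∀ᶠ n : ℕ in Filter.atTop,
      0 < (∑ i, ⌊n * f (B i)⌋ • B.coord i : Module.Dual ℝ V) v := by
    intro v hv
    have h1 : Filter.Tendsto (fun n : ℕ => (n : ℝ) * f v) Filter.atTop Filter.atTop :=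
      tendsto_natCast_atTop_atTop.atTop_mul_const (hf v hv)
    filter_upwards [h1.eventually_gt_atTop (∑ i, |B.repr v i|)] with n hn
    have h2 : (n : ℝ) * f v = ∑ i, (n * f (B i)) * B.repr v i := by
      conv_lhs => rw [← B.sum_repr v, map_sum, Finset.mul_sum]
      refine Finset.sum_congr rfl fun i _ => ?_
      rw [map_smul, smul_eq_mul]
      ring
    have h3 : (n : ℝ) * f v - (∑ i, ⌊n * f (B i)⌋ • B.coord i : Module.Dual ℝ V) v ≤
        ∑ i, |B.repr v i| := by
      rw [h2, LinearMap.sum_apply, ← Finset.sum_sub_distrib]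
      refine Finset.sum_le_sum fun i _ => ?_
      have h4 := Int.floor_le ((n : ℝ) * f (B i))
      have h5 := (Int.lt_floor_add_one ((n : ℝ) * f (B i))).le
      rw [LinearMap.smul_apply, zsmul_eq_mul, Module.Basis.coord_apply, ← sub_mul]
      refine (le_abs_self _).trans ?_
      rw [abs_mul]
      refine mul_le_of_le_one_left (abs_nonneg _) ?_
      rw [abs_le]
      constructor <;> linarith
    linarith
  obtain ⟨n, hn⟩ := ((Filter.eventually_all_finset s).2 key).exists
  exact ⟨_, sum_mem fun i _ => zsmul_mem (coord_mem_dualLattice hB i) _, hn⟩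

end Lattice

section Cones

variable {V : Type u} [NormedAddCommGroup V] [NormedSpace ℝ V]

theorem cone_smul_mem {σ : PointedCone ℝ V} {v : V} (hv : v ∈ σ) {a : ℝ} (ha : 0 ≤ a) :
    a • v ∈ σ :=
  Submodule.smul_mem σ (⟨a, ha⟩ : {c : ℝ // 0 ≤ c}) hv

variable (F : Fan V)

/-- A strongly convex rational cone has an integral linear form that is positive away from the
origin. -/
theorem exists_strictlyPositive [FiniteDimensional ℝ V] {σ : PointedCone ℝ V} (hσ : σ ∈ F.cones) :
    ∃ l ∈ dualMonoid F.lattice σ, ∀ v ∈ σ, v ≠ 0 → 0 < l v := by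
  classical
  obtain ⟨s, hs, hspan⟩ := F.rational σ hσ
  let t := s.filter (· ≠ 0)
  have hsσ : ∀ v ∈ s, v ∈ σ := fun v hv => hspan ▸ Submodule.subset_span hv
  have h0 : (0 : V) ∉ convexHull ℝ (t : Set V) := by
    intro h
    obtain ⟨w, hw0, hw1, hw⟩ := Finset.mem_convexHull'.1 h
    obtain ⟨v, hv, hpos⟩ : ∃ v ∈ t, 0 < w v := by
      by_contra! hle
      have := Finset.sum_nonpos hle
      linarith
    have hvs := Finset.mem_filter.1 hv
    have hmem : ∀ u ∈ t, w u • u ∈ σ := fun u hu =>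
      cone_smul_mem (hsσ u (Finset.mem_filter.1 hu).1) (hw0 u hu)
    have hneg : -(w v • v) ∈ σ := by
      rw [← Finset.add_sum_erase t _ hv] at hw
      rw [neg_eq_of_add_eq_zero_right hw]
      exact sum_mem fun u hu => hmem u (Finset.mem_of_mem_erase hu)
    rcases smul_eq_zero.1 (F.pointed σ hσ _ (hmem v hv) hneg) with h | h
    · exact hpos.ne' h
    · exact hvs.2 h
  obtain ⟨f, u, hu, hf⟩ := geometric_hahn_banach_point_closed (convex_convexHull ℝ (t : Set V))
    (t.finite_toSet.isClosed_convexHull ℝ) h0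
  obtain ⟨l, hl, hpos⟩ := exists_integral_pos (N := F.lattice) t f.toLinearMap fun v hv => by
    have h1 := hf v (subset_convexHull ℝ _ hv)
    rw [map_zero] at hu
    exact hu.trans h1
  have key : ∀ v ∈ σ, v = 0 ∨ 0 < l v := by
    intro v hv
    rw [hspan] at hv
    induction hv using Submodule.span_induction with
    | mem v hv =>
      by_cases h : v = 0
      · exact .inl h
      · exact .inr (hpos v (Finset.mem_filter.2 ⟨hv, h⟩))
    | zero => exact .inl rfl
    | add x y _ _ hx hy =>
      rcases hx with rfl | hx
      · simpa using hy
      · rcases hy with rfl | hy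
        · simpa using Or.inr hx
        · exact .inr (by rw [map_add]; exact add_pos hx hy)
    | smul a x _ hx =>
      rcases a.2.eq_or_lt with ha | ha
      · left
        change (a : ℝ) • x = 0
        rw [← ha, zero_smul]
      · rcases hx with rfl | hx
        · exact .inl (smul_zero _)
        · right
          have : l (a • x) = (a : ℝ) * l x := map_smul l (a : ℝ) x
          rw [this]
          exact mul_pos ha hx
  refine ⟨l, ⟨hl, fun v hv => ?_⟩, fun v hv h => (key v hv).resolve_left h⟩
  rcases key v hv with rfl | h
  · simp
  · exact h.le

/-- The zero cone belongs to every fan; its chart is the torus. -/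
theorem bot_mem_cones [FiniteDimensional ℝ V] : (⊥ : PointedCone ℝ V) ∈ F.cones := by
  obtain ⟨σ, hσ⟩ := F.nonempty
  obtain ⟨l, hl, hpos⟩ := exists_strictlyPositive F hσ
  refine F.face_mem σ hσ _ ⟨l, hl, fun v => ⟨?_, fun h => ?_⟩⟩
  · intro h
    rw [(Submodule.mem_bot _).1 h]
    simp
  · by_contra hv
    exact (hpos v h.1 hv).ne' h.2

/-- On a rational cone, the slope `m / l` of integral forms with `l > 0` attains its maximum at a
lattice vector. -/
theorem exists_max_slope {σ : PointedCone ℝ V} (hσ : σ ∈ F.cones) (hne : σ ≠ ⊥)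
    {l : Module.Dual ℝ V} (hpos : ∀ v ∈ σ, v ≠ 0 → 0 < l v) (m : Module.Dual ℝ V) :
    ∃ g ∈ σ, g ∈ F.lattice ∧ g ≠ 0 ∧ ∀ v ∈ σ, 0 ≤ m g * l v - l g * m v := by
  classical
  obtain ⟨s, hs, hspan⟩ := F.rational σ hσ
  let t := s.filter (· ≠ 0)
  have hsσ : ∀ v ∈ s, v ∈ σ := fun v hv => hspan ▸ Submodule.subset_span hv
  have ht : t.Nonempty := by
    by_contra h
    rw [Finset.not_nonempty_iff_eq_empty] at h
    refine hne (hspan.trans (Submodule.span_eq_bot.2 fun v hv => ?_))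
    by_contra h0
    exact Finset.notMem_empty v (h ▸ Finset.mem_filter.2 ⟨hv, h0⟩)
  obtain ⟨g, hg, hmax⟩ := Finset.exists_max_image t (fun v => m v / l v) ht
  have hg' := Finset.mem_filter.1 hg
  have hlg := hpos g (hsσ g hg'.1) hg'.2
  refine ⟨g, hsσ g hg'.1, hs g hg'.1, hg'.2, fun v hv => ?_⟩
  rw [hspan] at hv
  induction hv using Submodule.span_induction with
  | mem v hv =>
    by_cases h : v = 0
    · simp [h]
    · have hlv := hpos v (hsσ v hv) h
      have := hmax v (Finset.mem_filter.2 ⟨hv, h⟩)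
      rw [div_le_div_iff₀ hlv hlg] at this
      linarith
  | zero => simp
  | add x y _ _ hx hy =>
    rw [map_add, map_add]
    linarith
  | smul a x _ hx =>
    have h1 : l (a • x) = (a : ℝ) * l x := map_smul l (a : ℝ) x
    have h2 : m (a • x) = (a : ℝ) * m x := map_smul m (a : ℝ) x
    rw [h1, h2]
    have := mul_nonneg a.2 hx
    linarith

theorem exists_int_comb {l m : Module.Dual ℝ V} {N : Submodule ℤ V} (hl : l ∈ dualLattice N)
    (hm : m ∈ dualLattice N) {g : V} (hg : g ∈ N) :
    m g • l - l g • m ∈ dualLattice N := by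
  obtain ⟨a, ha⟩ := hl g hg
  obtain ⟨b, hb⟩ := hm g hg
  have e : (b : ℝ) • l - (a : ℝ) • m = b • l - a • m := by
    ext v
    simp
  rw [ha, hb, e]
  exact sub_mem (zsmul_mem hl b) (zsmul_mem hm a)

/-- A cone of the fan whose lattice points are all real multiples of one vector is a ray. -/
theorem exists_ray_of_forall_proportional {σ : PointedCone ℝ V} (hσ : σ ∈ F.cones)
    {l : Module.Dual ℝ V} (hl : l ∈ dualLattice F.lattice)
    (hpos : ∀ v ∈ σ, v ≠ 0 → 0 < l v) {g : V} (hg : g ∈ σ) (hgN : g ∈ F.lattice) (hg0 : g ≠ 0)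
    (h : ∀ v ∈ σ, l g • v = l v • g) : ∃ r : F.Ray, r.cone.1 = σ := by
  classical
  have hex : ∃ n : ℕ, 0 < n ∧ ∃ v ∈ σ, v ∈ F.lattice ∧ l v = n := by
    obtain ⟨k, hk⟩ := hl g hgN
    have h1 := hpos g hg hg0
    rw [hk] at h1
    have h2 : 0 < k := by exact_mod_cast h1
    have h3 : ((k.toNat : ℕ) : ℤ) = k := Int.toNat_of_nonneg h2.le
    exact ⟨k.toNat, by omega, g, hg, hgN, by rw [hk]; exact_mod_cast h3.symm⟩
  obtain ⟨hn0, r, hr, hrN, hlr⟩ := Nat.find_spec hex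
  have hlr0 : 0 < l r := by rw [hlr]; exact_mod_cast hn0
  have hlg0 := hpos g hg hg0
  have hr0 : r ≠ 0 := by rintro rfl; simp at hlr0
  have hprop : ∀ v ∈ σ, v = (l v / l r) • r := by
    intro v hv
    have h1 := h v hv
    have h2 := h r hr
    have h3 : l g • (l r • v) = l g • (l v • r) := by
      rw [smul_comm, h1, smul_comm (l g), h2, smul_comm]
    have h4 := smul_right_injective V hlg0.ne' h3
    rw [div_eq_inv_mul, mul_smul, ← h4, smul_smul, inv_mul_cancel₀ hlr0.ne', one_smul]
  have hσr : Submodule.span {c : ℝ // 0 ≤ c} {r} = σ := by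
    refine le_antisymm (Submodule.span_le.2 (Set.singleton_subset_iff.2 hr)) fun v hv => ?_
    rw [hprop v hv]
    refine cone_smul_mem (Submodule.mem_span_singleton_self r) (div_nonneg ?_ hlr0.le)
    by_cases hv0 : v = 0
    · simp [hv0]
    · exact (hpos v hv hv0).le
  refine ⟨⟨r, hrN, hr0, hσr ▸ hσ, fun v hvN hv => ?_⟩, hσr⟩
  rw [hσr] at hv
  have hlv : 0 ≤ l v := by
    by_cases hv0 : v = 0
    · simp [hv0]
    · exact (hpos v hv hv0).le
  obtain ⟨k, hk⟩ := hl v hvN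
  let n := Nat.find hex
  have hk0 : 0 ≤ k := by
    rw [hk] at hlv
    exact_mod_cast hlv
  -- Division with remainder: the remainder lies on the cone and has smaller height than `r`.
  have hw : v - (k / n).toNat • r = (((k % n : ℤ) : ℝ) / l r) • r := by
    have h1 : (((k / n).toNat : ℕ) : ℤ) = k / n :=
      Int.toNat_of_nonneg (Int.ediv_nonneg hk0 (Int.natCast_nonneg n))
    have h2 : (k : ℝ) = (n : ℝ) * ((k / n : ℤ) : ℝ) + ((k % n : ℤ) : ℝ) := by
      exact_mod_cast (Int.mul_ediv_add_emod k n).symm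
    have h3 : (((k / n).toNat : ℕ) : ℝ) = ((k / n : ℤ) : ℝ) := by exact_mod_cast h1
    conv_lhs => rw [hprop v hv]
    rw [← Nat.cast_smul_eq_nsmul ℝ, ← sub_smul, h3]
    congr 1
    rw [hk, h2, hlr]
    have : (n : ℝ) ≠ 0 := by exact_mod_cast hn0.ne'
    change _ / (n : ℝ) - _ = _ / (n : ℝ)
    field_simp
    ring
  have hmod0 : 0 ≤ k % n := Int.emod_nonneg _ (by exact_mod_cast hn0.ne')
  have hmodlt : k % n < n := Int.emod_lt_of_pos _ (by exact_mod_cast hn0)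
  by_cases hz : k % n = 0
  · refine ⟨(k / n).toNat, ?_⟩
    rw [hz] at hw
    simpa [sub_eq_zero] using hw
  · exfalso
    have h1 : (((k % n).toNat : ℕ) : ℤ) = k % n := Int.toNat_of_nonneg hmod0
    refine Nat.find_min hex (m := (k % n).toNat) (by change _ < n; omega)
      ⟨by omega, v - (k / n).toNat • r, ?_, sub_mem hvN (nsmul_mem hrN _), ?_⟩
    · rw [hw]
      exact cone_smul_mem hr (div_nonneg (by exact_mod_cast hmod0) hlr0.le)
    · rw [hw, map_smul, smul_eq_mul, div_mul_cancel₀ _ hlr0.ne']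
      exact_mod_cast h1.symm

/-- An integral linear form that does not vanish on a cone of the fan does not vanish on one of
its rays. A minimal cone on which the form is not zero is a ray: otherwise the vectors of maximal
slope form a smaller such face. -/
theorem exists_ray_apply_ne_zero [FiniteDimensional ℝ V] {σ : PointedCone ℝ V} (hσ : σ ∈ F.cones)
    {m : Module.Dual ℝ V} (hm : m ∈ dualLattice F.lattice) (h : ∃ v ∈ σ, m v ≠ 0) :
    ∃ r : F.Ray, r.cone.1 ≤ σ ∧ m r.gen ≠ 0 := by
  let T : Set (PointedCone ℝ V) := {τ | τ ∈ F.cones ∧ τ ≤ σ ∧ ∃ v ∈ τ, m v ≠ 0}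
  have hT : T.Finite := F.finite.subset fun τ h => h.1
  obtain ⟨τ, hτ⟩ := hT.exists_minimal ⟨σ, hσ, le_rfl, h⟩
  obtain ⟨hτF, hτσ, v, hv, hmv⟩ := hτ.prop
  have hτne : τ ≠ ⊥ := by
    rintro rfl
    rw [(Submodule.mem_bot _).1 hv] at hmv
    simp at hmv
  obtain ⟨l, hl, hpos⟩ := exists_strictlyPositive F hτF
  -- If `m' / l` is maximal at `g` and `m g ≠ 0`, the vectors of maximal slope form a face on which
  -- `m` is not zero. By minimality it is all of `τ`, that is, `m'` is a multiple of `l` on `τ`.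
  have hface : ∀ {g : V} {m' : Module.Dual ℝ V}, g ∈ τ → g ∈ F.lattice → m g ≠ 0 →
      m' ∈ dualLattice F.lattice → (∀ w ∈ τ, 0 ≤ m' g * l w - l g * m' w) →
      ∀ w ∈ τ, m' g * l w - l g * m' w = 0 := by
    intro g m' hg hgN hmg hm' hle
    let ρ : PointedCone ℝ V :=
      { carrier := {w | w ∈ τ ∧ m' g * l w - l g * m' w = 0}
        zero_mem' := ⟨zero_mem _, by simp⟩
        add_mem' := fun ha hb => ⟨add_mem ha.1 hb.1, by
          rw [map_add, map_add]; linarith [ha.2, hb.2]⟩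
        smul_mem' := fun a w hw => ⟨Submodule.smul_mem _ a hw.1, by
          have h1 : l (a • w) = (a : ℝ) * l w := map_smul l (a : ℝ) w
          have h2 : m' (a • w) = (a : ℝ) * m' w := map_smul m' (a : ℝ) w
          rw [h1, h2]
          linear_combination (a : ℝ) * hw.2⟩ }
    have hρ : ρ ∈ F.cones := F.face_mem τ hτF ρ ⟨m' g • l - l g • m',
      ⟨exists_int_comb hl.1 hm' hgN, fun w hw => by simpa using hle w hw⟩, fun w => by
        simp [ρ, ← SetLike.mem_coe]⟩
    have hρτ : ρ ≤ τ := fun w hw => hw.1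
    have hle' := hτ.le_of_le (y := ρ) ⟨hρ, hρτ.trans hτσ, g, ⟨hg, by ring⟩, hmg⟩ hρτ
    exact fun w hw => (hle' hw).2
  -- If `± m` takes a positive value, it is a multiple of `l`, so on `τ` it vanishes only at the
  -- origin. Hence every other form is a multiple of `l` as well, and `τ` is one-dimensional.
  have hm2 : ∀ (m₁ : Module.Dual ℝ V), m₁ ∈ dualLattice F.lattice →
      (∀ w, m₁ w ≠ 0 → m w ≠ 0) → (∃ v ∈ τ, 0 < m₁ v) → ∃ g ∈ τ, g ∈ F.lattice ∧ g ≠ 0 ∧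
      ∀ w ∈ τ, l g • w = l w • g := by
    intro m₁ hm₁ himp ⟨v, hv, hmv⟩
    obtain ⟨g, hg, hgN, hg0, hmax⟩ := exists_max_slope F hτF hτne hpos m₁
    have hlg := hpos g hg hg0
    have hmg : 0 < m₁ g := by
      have h1 := hmax v hv
      have h2 := mul_pos hlg hmv
      have h3 : 0 < l v := hpos v hv (by rintro rfl; simp at hmv)
      exact pos_of_mul_pos_left (by linarith) h3.le
    have h1 := hface hg hgN (himp g hmg.ne') hm₁ hmax
    refine ⟨g, hg, hgN, hg0, fun w hw => ?_⟩
    rw [← sub_eq_zero]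
    refine eq_zero_of_forall_dualLattice (N := F.lattice) fun m₂ hm₂ => ?_
    obtain ⟨g₂, hg₂, hg₂N, hg₂0, hmax₂⟩ := exists_max_slope F hτF hτne hpos m₂
    have hlg₂ := hpos g₂ hg₂ hg₂0
    have hmg₂ : m₁ g₂ ≠ 0 := by
      intro h0
      have := h1 g₂ hg₂
      rw [h0, mul_zero, sub_zero] at this
      exact (mul_pos hmg hlg₂).ne' this
    have h2 := hface hg₂ hg₂N (himp g₂ hmg₂) hm₂ hmax₂
    have h3 := h2 w hw
    have h4 := h2 g hg
    rw [map_sub, map_smul, map_smul, smul_eq_mul, smul_eq_mul]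
    have h5 : l g₂ * (l g * m₂ w - l w * m₂ g) = 0 := by
      linear_combination (-l g) * h3 + l w * h4
    exact (mul_eq_zero.1 h5).resolve_left hlg₂.ne'
  obtain ⟨g, hg, hgN, hg0, hprop⟩ : ∃ g ∈ τ, g ∈ F.lattice ∧ g ≠ 0 ∧
      ∀ w ∈ τ, l g • w = l w • g := by
    rcases hmv.lt_or_gt with h | h
    · exact hm2 (-m) (neg_mem hm) (fun w hw => by simpa using hw)
        ⟨v, hv, by rw [LinearMap.neg_apply]; linarith⟩
    · exact hm2 m hm (fun _ => id) ⟨v, hv, h⟩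
  obtain ⟨r, hr⟩ := exists_ray_of_forall_proportional F hτF hl.1 hpos hg hgN hg0 hprop
  refine ⟨r, hr.trans_le hτσ, fun h0 => hmv ?_⟩
  rw [← hr] at hv
  obtain ⟨a, rfl⟩ := Submodule.mem_span_singleton.1 hv
  have : m (a • r.gen) = (a : ℝ) * m r.gen := map_smul m (a : ℝ) r.gen
  rw [this, h0, mul_zero]

theorem exists_ray_le [FiniteDimensional ℝ V] {σ : PointedCone ℝ V} (hσ : σ ∈ F.cones)
    (hne : σ ≠ ⊥) :
    ∃ r : F.Ray, r.cone.1 ≤ σ := by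
  obtain ⟨l, hl, hpos⟩ := exists_strictlyPositive F hσ
  obtain ⟨v, hv, hv0⟩ := Submodule.exists_mem_ne_zero_of_ne_bot hne
  obtain ⟨r, hr, -⟩ := exists_ray_apply_ne_zero F hσ hl.1 ⟨v, hv, (hpos v hv hv0).ne'⟩
  exact ⟨r, hr⟩

variable {F}

/-- The integral generator of a ray is primitive. -/
theorem Fan.Ray.exists_apply_eq_one [FiniteDimensional ℝ V] (r : F.Ray) :
    ∃ m ∈ dualLattice F.lattice, m r.gen = 1 := by
  obtain ⟨m, hm, hpos, hmin⟩ := r.exists_minimal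
  obtain ⟨k, hk⟩ := hm _ r.gen_mem
  have hk0 : 0 < k := by
    rw [hk] at hpos
    exact_mod_cast hpos
  have hkR : (0 : ℝ) < k := by exact_mod_cast hk0
  have hmem : (k : ℝ)⁻¹ • r.gen ∈ F.lattice := by
    refine mem_lattice_of_forall_dualLattice fun m' hm' => ?_
    obtain ⟨j, hj⟩ := hm' _ r.gen_mem
    refine ⟨j / k, ?_⟩
    have hdvd : j % k = 0 := by
      by_contra h0
      have h1 : 0 < j % k := lt_of_le_of_ne (Int.emod_nonneg _ hk0.ne') (Ne.symm h0)
      have h2 : (m' - (j / k) • m) r.gen = ((j % k : ℤ) : ℝ) := by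
        rw [LinearMap.sub_apply, LinearMap.smul_apply, hk, hj, zsmul_eq_mul]
        have := Int.mul_ediv_add_emod j k
        have h3 : (k : ℝ) * ((j / k : ℤ) : ℝ) + ((j % k : ℤ) : ℝ) = j := by exact_mod_cast this
        linarith
      have h3 := hmin _ (sub_mem hm' (zsmul_mem hm (j / k))) (by rw [h2]; exact_mod_cast h1)
      rw [h2, hk] at h3
      have h4 : k ≤ j % k := by exact_mod_cast h3
      exact absurd (Int.emod_lt_of_pos j hk0) (not_lt.2 h4)
    rw [map_smul, hj, smul_eq_mul, Int.cast_div (Int.dvd_of_emod_eq_zero hdvd) hkR.ne']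
    field_simp
  obtain ⟨n, hn⟩ := r.generates _ hmem
    (cone_smul_mem (Submodule.mem_span_singleton_self r.gen) (inv_nonneg.2 hkR.le))
  rw [← Nat.cast_smul_eq_nsmul ℝ] at hn
  have h1 : (k : ℝ)⁻¹ = n := smul_left_injective ℝ r.gen_ne_zero hn
  have h2 : (1 : ℝ) = n * k := by rw [← h1, inv_mul_cancel₀ hkR.ne']
  have h3 : (n : ℤ) * k = 1 := by exact_mod_cast h2.symm
  have h4 : k = 1 := by
    rcases Int.eq_one_or_neg_one_of_mul_eq_one' h3 with h | h
    · exact h.2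
    · omega
  exact ⟨m, hm, by rw [hk, h4, Int.cast_one]⟩

end Cones

/-! ### The coordinate ring of the torus -/

section MonoidAlgebras

/-- The units of a monoid algebra with the two unique sums property are monomials: a product of two
elements, one of which is not a monomial, has at least two nonzero coefficients. -/
theorem exists_eq_single_of_isUnit {k G : Type*} [Field k] [AddMonoid G] [TwoUniqueSums G]
    {x : AddMonoidAlgebra k G} (hx : IsUnit x) :
    ∃ g, ∃ a : k, a ≠ 0 ∧ x = AddMonoidAlgebra.single g a := by
  classical
  obtain ⟨y, hxy⟩ := hx.exists_right_inv
  have h1 : ¬ 1 < x.coeff.support.card * y.coeff.support.card := by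
    intro h
    obtain ⟨p, hp, q, hq, hne, hup, huq⟩ := TwoUniqueSums.uniqueAdd_of_one_lt_card h
    have key : ∀ r ∈ x.coeff.support ×ˢ y.coeff.support,
        UniqueAdd x.coeff.support y.coeff.support r.1 r.2 → r.1 + r.2 = 0 := by
      intro r hr hu
      have h2 := AddMonoidAlgebra.coeff_mul_add_of_uniqueAdd hu
      rw [Finset.mem_product, Finsupp.mem_support_iff, Finsupp.mem_support_iff] at hr
      rw [hxy, AddMonoidAlgebra.one_def, AddMonoidAlgebra.coeff_single] at h2
      by_contra h0
      rw [Finsupp.single_apply, if_neg (Ne.symm h0)] at h2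
      exact mul_ne_zero hr.1 hr.2 h2.symm
    have hp' := Finset.mem_product.1 hp
    have h4 := huq hp'.1 hp'.2 ((key p hp hup).trans (key q hq huq).symm)
    exact hne (Prod.ext h4.1 h4.2)
  have hx0 : x.coeff.support.card ≠ 0 := by
    intro h
    rw [Finset.card_eq_zero, Finsupp.support_eq_empty, AddMonoidAlgebra.coeff_eq_zero] at h
    rw [h, zero_mul] at hxy
    exact zero_ne_one hxy
  have hy0 : y.coeff.support.card ≠ 0 := by
    intro h
    rw [Finset.card_eq_zero, Finsupp.support_eq_empty, AddMonoidAlgebra.coeff_eq_zero] at h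
    rw [h, mul_zero] at hxy
    exact zero_ne_one hxy
  have hc : x.coeff.support.card = 1 := by
    by_contra h
    refine h1 (lt_of_lt_of_le (b := x.coeff.support.card) (by omega) ?_)
    exact Nat.le_mul_of_pos_right _ (Nat.pos_of_ne_zero hy0)
  obtain ⟨g, a, ha, h⟩ := Finsupp.card_support_eq_one'.1 hc
  exact ⟨g, a, ha, AddMonoidAlgebra.ext h⟩

/-- If `P → G` is injective, `G` consists of differences of elements of `P`, and the elements of `P`
become invertible in `G`, then `k[G]` is the localization of `k[P]` at the monomials. -/
theorem addMonoidAlgebra_isLocalization {k P G : Type*} [Field k] [AddCommMonoid P]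
    [AddCommMonoid G] [IsDomain (AddMonoidAlgebra k P)] (f : P →+ G) (hf : Function.Injective f)
    (hunit : ∀ p, ∃ g, f p + g = 0) (hsurj : ∀ g, ∃ p q, g + f p = f q) :
    letI := (AddMonoidAlgebra.mapDomainAlgHom k k f).toRingHom.toAlgebra
    IsLocalization (MonoidHom.mrange (AddMonoidAlgebra.of k P)) (AddMonoidAlgebra k G) := by
  let := (AddMonoidAlgebra.mapDomainAlgHom k k f).toRingHom.toAlgebra
  have halg : ∀ p (a : k), algebraMap (AddMonoidAlgebra k P) (AddMonoidAlgebra k G)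
      (AddMonoidAlgebra.single p a) = AddMonoidAlgebra.single (f p) a := fun p a => by
    change AddMonoidAlgebra.mapDomainAlgHom k k f (AddMonoidAlgebra.single p a) = _
    simp
  have hinj : Function.Injective
      (algebraMap (AddMonoidAlgebra k P) (AddMonoidAlgebra k G)) :=
    AddMonoidAlgebra.mapDomain_injective hf
  refine ⟨⟨?_, ?_, ?_⟩⟩
  · rintro ⟨_, p, rfl⟩
    obtain ⟨g, hg⟩ := hunit p.toAdd
    change IsUnit (algebraMap _ (AddMonoidAlgebra k G) (AddMonoidAlgebra.single p.toAdd 1))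
    rw [halg]
    refine IsUnit.of_mul_eq_one (AddMonoidAlgebra.single g 1) ?_
    rw [AddMonoidAlgebra.single_mul_single, AddMonoidAlgebra.one_def, mul_one, hg]
  · intro z
    induction z using AddMonoidAlgebra.induction_linear with
    | zero => exact ⟨⟨0, 1⟩, by simp⟩
    | add x y hx hy =>
      obtain ⟨⟨a, s⟩, ha⟩ := hx
      obtain ⟨⟨b, t⟩, hb⟩ := hy
      refine ⟨⟨a * t + b * s, s * t⟩, ?_⟩
      simp only [Submonoid.coe_mul, map_mul, map_add] at ha hb ⊢
      rw [← ha, ← hb]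
      ring
    | single g a =>
      obtain ⟨p, q, hpq⟩ := hsurj g
      refine ⟨⟨AddMonoidAlgebra.single q a, ⟨_, Multiplicative.ofAdd p, rfl⟩⟩, ?_⟩
      simp only [AddMonoidAlgebra.of_apply]
      rw [halg, halg, AddMonoidAlgebra.single_mul_single, mul_one, toAdd_ofAdd, hpq]
  · intro x y hxy
    exact ⟨1, by rw [hinj hxy]⟩

end MonoidAlgebras

section Torus

variable (K : Type u) [Field K] {V : Type u} [NormedAddCommGroup V] [NormedSpace ℝ V]

theorem mem_dualMonoid_bot {N : Submodule ℤ V} {m : Module.Dual ℝ V} :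
    m ∈ dualMonoid N ⊥ ↔ m ∈ dualLattice N := by
  refine ⟨fun h => h.1, fun h => ⟨h, fun v hv => ?_⟩⟩
  rw [(Submodule.mem_bot _).1 hv, map_zero]

/-- The character `χ^m` as a function on the torus. -/
noncomputable def torusChi (N : Submodule ℤ V) (m : dualLattice N) : ChartRing K N ⊥ :=
  chi K N ⊥ ⟨m.1, mem_dualMonoid_bot.2 m.2⟩

theorem torusChi_add {N : Submodule ℤ V} (m m' : dualLattice N) :
    torusChi K N (m + m') = torusChi K N m * torusChi K N m' := by
  rw [torusChi, torusChi, torusChi, chi, chi, chi, AddMonoidAlgebra.single_mul_single, mul_one]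
  rfl

theorem torusChi_zero {N : Submodule ℤ V} : torusChi K N 0 = 1 := rfl

theorem isUnit_torusChi {N : Submodule ℤ V} (m : dualLattice N) : IsUnit (torusChi K N m) :=
  IsUnit.of_mul_eq_one (torusChi K N (-m)) (by
    rw [← torusChi_add, add_neg_cancel, torusChi_zero])

theorem torusChi_nsmul {N : Submodule ℤ V} (n : ℕ) (m : dualLattice N) :
    torusChi K N (n • m) = torusChi K N m ^ n := by
  induction n with
  | zero => rw [zero_smul, torusChi_zero, pow_zero]
  | succ n ih => rw [succ_nsmul, torusChi_add, ih, pow_succ]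

/-- The units on the torus are the constant multiples of characters. -/
theorem exists_eq_smul_torusChi {N : Submodule ℤ V} {x : ChartRing K N ⊥} (hx : IsUnit x) :
    ∃ m, ∃ a : K, a ≠ 0 ∧ x = a • torusChi K N m := by
  obtain ⟨m, a, ha, rfl⟩ := exists_eq_single_of_isUnit hx
  refine ⟨⟨m.1, m.2.1⟩, a, ha, ?_⟩
  rw [torusChi, chi, AddMonoidAlgebra.smul_single, smul_eq_mul, mul_one]

/-- The coordinate ring of the torus is factorial, as a localization of a polynomial ring. -/
theorem torusRing_ufd [FiniteDimensional ℝ V] (N : Submodule ℤ V) [DiscreteTopology N]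
    [IsZLattice ℝ N] : UniqueFactorizationMonoid (ChartRing K N ⊥) := by
  classical
  obtain ⟨ι, _, B, hB⟩ := exists_latticeBasis N
  have : IsDomain (AddMonoidAlgebra K (ι →₀ ℕ)) := inferInstanceAs (IsDomain (MvPolynomial ι K))
  have : UniqueFactorizationMonoid (AddMonoidAlgebra K (ι →₀ ℕ)) :=
    inferInstanceAs (UniqueFactorizationMonoid (MvPolynomial ι K))
  let c : ι → dualMonoid N ⊥ := fun i =>
    ⟨B.coord i, mem_dualMonoid_bot.2 (coord_mem_dualLattice hB i)⟩
  let f : (ι →₀ ℕ) →+ dualMonoid N ⊥ :=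
    { toFun := fun a => ∑ i, a i • c i
      map_zero' := by simp
      map_add' := fun a b => by simp [add_smul, Finset.sum_add_distrib] }
  have hfB : ∀ a j, (f a).1 (B j) = a j := by
    intro a j
    change ((∑ i, a i • c i : dualMonoid N ⊥) : Module.Dual ℝ V) (B j) = _
    rw [AddSubmonoidClass.coe_finsetSum, LinearMap.sum_apply,
      Finset.sum_eq_single j (by intro i _ hi; simp [c, hi.symm]) (by simp)]
    simp [c]
  let := (AddMonoidAlgebra.mapDomainAlgHom K K f).toRingHom.toAlgebra
  have hloc := addMonoidAlgebra_isLocalization (k := K) f ?_ ?_ ?_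
  · exact UniqueFactorizationMonoid.of_isLocalization
      (MonoidHom.mrange (AddMonoidAlgebra.of K (ι →₀ ℕ))) _
  · intro a b hab
    ext j
    have := hfB a j
    rw [hab, hfB] at this
    exact_mod_cast this.symm
  · intro a
    exact ⟨⟨-(f a).1, mem_dualMonoid_bot.2 (neg_mem (f a).2.1)⟩,
      Subtype.ext (add_neg_cancel (f a).1)⟩
  · intro g
    choose k hk using (mem_dualLattice_iff_basis hB g.1).1 g.2.1
    refine ⟨Finsupp.equivFunOnFinite.symm fun i => (-(k i)).toNat,
      Finsupp.equivFunOnFinite.symm fun i => (k i).toNat, Subtype.ext (B.ext fun j => ?_)⟩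
    change g.1 (B j) + (f _).1 (B j) = _
    rw [hfB, hfB, hk]
    simp only [Finsupp.equivFunOnFinite_symm_apply_apply]
    have : k j + ((-(k j)).toNat : ℤ) = ((k j).toNat : ℤ) := by omega
    exact_mod_cast this

end Torus

/-! ### Toric covers on the affine charts -/

section ChartMaps

variable (K : Type u) [Field K] {V : Type u} [NormedAddCommGroup V] [NormedSpace ℝ V]

theorem chi_add {N : Submodule ℤ V} {σ : PointedCone ℝ V} (m m' : dualMonoid N σ) :
    chi K N σ (m + m') = chi K N σ m * chi K N σ m' := by
  rw [chi, chi, chi, AddMonoidAlgebra.single_mul_single, mul_one]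

theorem chi_nsmul {N : Submodule ℤ V} {σ : PointedCone ℝ V} (n : ℕ) (m : dualMonoid N σ) :
    chi K N σ (n • m) = chi K N σ m ^ n := by
  rw [chi, chi, AddMonoidAlgebra.single_pow, one_pow]

theorem single_eq_smul_chi {N : Submodule ℤ V} {σ : PointedCone ℝ V} (m : dualMonoid N σ) (a : K) :
    (AddMonoidAlgebra.single m a : ChartRing K N σ) = a • chi K N σ m := by
  rw [chi, AddMonoidAlgebra.smul_single, smul_eq_mul, mul_one]

theorem chartMap_chi {N N' : Submodule ℤ V} (h : N' ≤ N) {σ τ : PointedCone ℝ V}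
    (hτ : τ ≤ σ) (m : dualMonoid N σ) :
    chartMap K h hτ (chi K N σ m) = chi K N' τ ⟨m.1, dualMonoid_mono h hτ m.2⟩ :=
  chartMap_single K h hτ m 1

/-- The exponent of `N / N'` multiplies the dual lattice of `N'` into the dual lattice of `N`. -/
theorem nsmul_mem_dualMonoid {N N' : Submodule ℤ V} {e : ℕ} (he : ∀ v ∈ N, e • v ∈ N')
    {σ : PointedCone ℝ V} {m : Module.Dual ℝ V} (hm : m ∈ dualMonoid N' σ) :
    e • m ∈ dualMonoid N σ := by
  refine ⟨fun v hv => ?_, fun v hv => ?_⟩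
  · obtain ⟨k, hk⟩ := hm.1 _ (he v hv)
    exact ⟨k, by rw [← hk, map_nsmul]; rfl⟩
  · have := hm.2 v hv
    rw [LinearMap.smul_apply, nsmul_eq_mul]
    positivity

/-- `χ^{m'}` is a root of `X^e - χ^{e m'}`. -/
theorem chi_pow_eq_chartMap {N N' : Submodule ℤ V} (h : N' ≤ N) {e : ℕ}
    (he : ∀ v ∈ N, e • v ∈ N') {σ : PointedCone ℝ V} (m : dualMonoid N' σ) :
    chi K N' σ m ^ e =
      chartMap K h (le_refl σ) (chi K N σ ⟨e • m.1, nsmul_mem_dualMonoid he m.2⟩) := by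
  rw [chartMap_chi, ← chi_nsmul]
  rfl

theorem chartMap_isIntegral {N N' : Submodule ℤ V} (h : N' ≤ N) {e : ℕ} (he0 : e ≠ 0)
    (he : ∀ v ∈ N, e • v ∈ N') (σ : PointedCone ℝ V) :
    (chartMap K h (le_refl σ)).toRingHom.IsIntegral := by
  let := (chartMap K h (le_refl σ)).toRingHom.toAlgebra
  intro x
  change IsIntegral (ChartRing K N σ) x
  induction x using AddMonoidAlgebra.induction_linear with
  | zero => exact isIntegral_zero
  | add x y hx hy => exact hx.add hy
  | single m a =>
    have h1 : IsIntegral (ChartRing K N σ) (chi K N' σ m) := by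
      refine IsIntegral.of_pow (Nat.pos_of_ne_zero he0) ?_
      rw [chi_pow_eq_chartMap K h he]
      exact isIntegral_algebraMap
    have h2 : (AddMonoidAlgebra.single m a : ChartRing K N' σ) =
        algebraMap (ChartRing K N σ) _ (AddMonoidAlgebra.single 0 a) * chi K N' σ m := by
      change _ = chartMap K h (le_refl σ) _ * _
      rw [chartMap_single, chi, AddMonoidAlgebra.single_mul_single, mul_one, map_zero, zero_add]
    rw [h2]
    exact isIntegral_algebraMap.mul h1

end ChartMaps

section Covers

variable (K : Type u) [Field K] {V : Type u} [NormedAddCommGroup V] [NormedSpace ℝ V] {F : Fan V}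

/-- Two points of affine charts that agree on the toric variety come from a common smaller chart. -/
theorem exists_common_chart {σ τ : F.cones} {x : chart K F.lattice σ.1} {y : chart K F.lattice τ.1}
    (h : F.chartι K σ x = F.chartι K τ y) :
    ∃ (ρ : F.cones) (hσ : ρ.1 ≤ σ.1) (hτ : ρ.1 ≤ τ.1) (z : chart K F.lattice ρ.1),
      chartHom K (le_refl F.lattice) hσ z = x ∧ chartHom K (le_refl F.lattice) hτ z = y := by
  obtain ⟨ρ, f, g, z, hx, hy⟩ :=
    (Scheme.IsLocallyDirected.ι_eq_ι_iff (chartDiagram K F.lattice F.cones)).1 h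
  exact ⟨ρ, leOfHom f, leOfHom g, z, hx, hy⟩

/-- The chart of the cone `σ` on the toric variety of the fan `(N', Σ)`. -/
noncomputable def Fan.Sublattice.chartι (L : F.Sublattice) (σ : F.cones) :
    chart K L.carrier σ.1 ⟶ L.fan.toricVariety K :=
  L.fan.chartι K ⟨σ.1, σ.2⟩

instance (L : F.Sublattice) (σ : F.cones) : IsOpenImmersion (L.chartι K σ) :=
  chartι_isOpenImmersion K L.fan ⟨σ.1, σ.2⟩

theorem Fan.Sublattice.exists_chartι (L : F.Sublattice) (x : L.fan.toricVariety K) :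
    ∃ σ y, L.chartι K σ y = x := by
  obtain ⟨σ, y, h⟩ := Toric.exists_chartι K L.fan x
  exact ⟨⟨σ.1, σ.2⟩, y, h⟩

theorem Fan.Sublattice.chartHom_chartι (L : F.Sublattice) {τ σ : F.cones} (h : τ.1 ≤ σ.1) :
    chartHom K (le_refl L.carrier) h ≫ L.chartι K σ = L.chartι K τ :=
  L.fan.chartHom_chartι K (τ := ⟨τ.1, τ.2⟩) (σ := ⟨σ.1, σ.2⟩) h

theorem Fan.Sublattice.chartι_toricCover (L : F.Sublattice) (σ : F.cones) :
    L.chartι K σ ≫ L.toricCover K = chartHom K L.le (le_refl σ.1) ≫ F.chartι K σ :=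
  colimit.ι_desc _ _

theorem Fan.Sublattice.toricCover_chartι (L : F.Sublattice) (σ : F.cones)
    (x : chart K L.carrier σ.1) :
    L.toricCover K (L.chartι K σ x) = F.chartι K σ (chartHom K L.le (le_refl σ.1) x) := by
  rw [← Scheme.Hom.comp_apply, ← Scheme.Hom.comp_apply, L.chartι_toricCover K]

/-- The preimage of the chart `U_σ` under a toric cover is the chart `U'_σ`. -/
theorem Fan.Sublattice.mem_range_chartι (L : F.Sublattice) {σ : F.cones}
    {x : L.fan.toricVariety K} (hx : L.toricCover K x ∈ Set.range (F.chartι K σ)) :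
    x ∈ Set.range (L.chartι K σ) := by
  obtain ⟨τ, y, rfl⟩ := L.exists_chartι K x
  obtain ⟨w, hw⟩ := hx
  rw [L.toricCover_chartι K] at hw
  obtain ⟨ρ, hσ, hτ, z, -, hz⟩ := exists_common_chart K hw
  obtain ⟨m, hm, h⟩ := exists_face F τ.2 ρ.2 hτ
  have h1 := (Set.ext_iff.1 (chartHom_range K F τ.2 hτ hm h) _).1 ⟨z, hz⟩
  have h2 : y ∈ Set.range (chartHom K (le_refl L.carrier) hτ) := by
    refine (Set.ext_iff.1 (chartHom_range K L.fan τ.2 hτ (dualMonoid_mono L.le le_rfl hm) h) _).2 ?_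
    intro h3
    refine h1 ?_
    have h4 := chartMap_chi K L.le (le_refl τ.1) ⟨m, hm⟩
    change chartMap K L.le (le_refl τ.1) (chi K F.lattice τ.1 ⟨m, hm⟩) ∈
      PrimeSpectrum.asIdeal (R := ChartRing K L.carrier τ.1) y
    rw [h4]
    exact h3
  obtain ⟨z', hz'⟩ := h2
  refine ⟨chartHom K (le_refl L.carrier) hσ z', ?_⟩
  rw [← hz', ← Scheme.Hom.comp_apply, ← Scheme.Hom.comp_apply, L.chartHom_chartι K,
    L.chartHom_chartι K]

theorem Fan.Sublattice.isPullback_chart (L : F.Sublattice) (σ : F.cones) :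
    IsPullback (chartHom K L.le (le_refl σ.1)) (L.chartι K σ) (F.chartι K σ) (L.toricCover K) := by
  refine IsOpenImmersion.isPullback _ _ _ _ (L.chartι_toricCover K σ) ?_
  ext x
  refine ⟨fun h => L.mem_range_chartι K h, ?_⟩
  rintro ⟨y, rfl⟩
  exact ⟨_, (L.toricCover_chartι K σ y).symm⟩

theorem Fan.Sublattice.toricCover_surjective (L : F.Sublattice) :
    Function.Surjective (L.toricCover K) := by
  intro y
  obtain ⟨σ, y, rfl⟩ := Toric.exists_chartι K F y
  obtain ⟨e, he0, he⟩ := L.exists_smul_mem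
  obtain ⟨x, hx⟩ := (chartMap_isIntegral K L.le he0 he σ.1).comap_surjective
    (chartMap_injective K L.le (le_refl σ.1)) y
  exact ⟨L.chartι K σ x, (L.toricCover_chartι K σ x).trans (congrArg _ hx)⟩

variable [FiniteDimensional ℝ V]

theorem chartRing_finiteType (F : Fan V) (σ : F.cones) :
    Algebra.FiniteType K (ChartRing K F.lattice σ.1) := by
  have : AddMonoid.FG (dualMonoid F.lattice σ.1) :=
    (AddMonoid.fg_iff_addSubmonoid_fg _).2 (dualMonoid_fg F σ.2)
  infer_instance

theorem Fan.Sublattice.chartMap_finite (L : F.Sublattice) (σ : F.cones) :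
    (chartMap K L.le (le_refl σ.1)).toRingHom.Finite := by
  obtain ⟨e, he0, he⟩ := L.exists_smul_mem
  refine RingHom.IsIntegral.to_finite (chartMap_isIntegral K L.le he0 he σ.1) ?_
  refine RingHom.FiniteType.of_comp_finiteType (f := algebraMap K (ChartRing K F.lattice σ.1)) ?_
  have h := chartRing_finiteType K L.fan ⟨σ.1, σ.2⟩
  have e : (chartMap K L.le (le_refl σ.1)).toRingHom.comp (algebraMap K _) =
    algebraMap K (ChartRing K L.carrier σ.1) := (chartMap K L.le (le_refl σ.1)).comp_algebraMap
  rw [e]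
  exact RingHom.finiteType_algebraMap.2 h

theorem isFinite_isZariskiLocalAtTarget : IsZariskiLocalAtTarget (@IsFinite.{u}) :=
  @HasAffineProperty.instIsZariskiLocalAtTarget _ _
    IsFinite.instHasAffinePropertyAndIsAffineFiniteCarrierObjOppositeOpensCarrierCarrierCommRingCatPresheafOpOpensTopHomAppTop

instance Fan.Sublattice.toricCover_isFinite (L : F.Sublattice) : IsFinite (L.toricCover K) := by
  have := isFinite_isZariskiLocalAtTarget.{u}
  refine IsZariskiLocalAtTarget.of_openCover (P := @IsFinite) (F.openCover K) fun σ => ?_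
  have h := L.isPullback_chart K σ
  have hfin : IsFinite (chartHom K L.le (le_refl σ.1)) :=
    (IsFinite.SpecMap_iff _).2 (L.chartMap_finite K σ)
  change IsFinite (pullback.snd (L.toricCover K) (F.chartι K σ))
  have e := h.flip.isoPullback_inv_snd
  rw [← e]
  infer_instance

end Covers

/-! ### The torus action and the automorphisms of a toric cover -/

section TorusAction

variable (K : Type u) [Field K] {V : Type u} [NormedAddCommGroup V] [NormedSpace ℝ V]

/-- A `K`-rational point of the torus with character lattice `Hom(N, ℤ)`, as a homomorphism from
the character lattice to `Kˣ`. -/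
abbrev TorusPoint (N : Submodule ℤ V) : Type u := Multiplicative (dualLattice N) →* Kˣ

/-- The action of a point `c` of the torus on the functions on a chart: `χ^m ↦ c(m) χ^m`. -/
noncomputable def twist {N : Submodule ℤ V} (c : TorusPoint K N) (σ : PointedCone ℝ V) :
    ChartRing K N σ →ₐ[K] ChartRing K N σ :=
  AddMonoidAlgebra.lift K (ChartRing K N σ) (dualMonoid N σ)
    { toFun := fun m =>
        (c (Multiplicative.ofAdd ⟨m.toAdd.1, m.toAdd.2.1⟩) : K) • chi K N σ m.toAdd
      map_one' := by
        have h : (⟨((1 : Multiplicative (dualMonoid N σ)).toAdd).1,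
          ((1 : Multiplicative (dualMonoid N σ)).toAdd).2.1⟩ : dualLattice N) = 0 := rfl
        rw [h, ofAdd_zero, map_one, Units.val_one, one_smul]
        rfl
      map_mul' := fun a b => by
        have h : (⟨((a * b).toAdd).1, ((a * b).toAdd).2.1⟩ : dualLattice N) =
          ⟨a.toAdd.1, a.toAdd.2.1⟩ + ⟨b.toAdd.1, b.toAdd.2.1⟩ := rfl
        rw [h, ofAdd_add, map_mul, Units.val_mul, toAdd_mul, chi_add, smul_mul_smul_comm] }

variable {K}

theorem twist_single {N : Submodule ℤ V} (c : TorusPoint K N) (σ : PointedCone ℝ V)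
    (m : dualMonoid N σ) (a : K) :
    twist K c σ (AddMonoidAlgebra.single m a) =
      AddMonoidAlgebra.single m (c (Multiplicative.ofAdd ⟨m.1, m.2.1⟩) * a) := by
  rw [twist, AddMonoidAlgebra.lift_single]
  change a • ((c (Multiplicative.ofAdd ⟨m.1, m.2.1⟩) : K) • chi K N σ m) = _
  rw [smul_smul, mul_comm, chi, AddMonoidAlgebra.smul_single, smul_eq_mul, mul_one]

theorem twist_chi {N : Submodule ℤ V} (c : TorusPoint K N) (σ : PointedCone ℝ V)
    (m : dualMonoid N σ) :
    twist K c σ (chi K N σ m) = (c (Multiplicative.ofAdd ⟨m.1, m.2.1⟩) : K) • chi K N σ m := by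
  rw [chi, twist_single, AddMonoidAlgebra.smul_single, smul_eq_mul]

theorem twist_coeff {N : Submodule ℤ V} (c : TorusPoint K N) (σ : PointedCone ℝ V)
    (x : ChartRing K N σ) (m : dualMonoid N σ) :
    (twist K c σ x).coeff m = c (Multiplicative.ofAdd ⟨m.1, m.2.1⟩) * x.coeff m := by
  classical
  induction x using AddMonoidAlgebra.induction_linear with
  | zero => simp
  | add x y hx hy =>
    rw [map_add, AddMonoidAlgebra.coeff_add, AddMonoidAlgebra.coeff_add, Finsupp.add_apply,
      Finsupp.add_apply, hx, hy, mul_add]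
  | single n a =>
    rw [twist_single, AddMonoidAlgebra.coeff_single, AddMonoidAlgebra.coeff_single,
      Finsupp.single_apply, Finsupp.single_apply]
    split_ifs with h
    · rw [h]
    · rw [mul_zero]

theorem twist_mul {N : Submodule ℤ V} (c c' : TorusPoint K N) (σ : PointedCone ℝ V) :
    (twist K c σ).comp (twist K c' σ) = twist K (c * c') σ :=
  chartRing_algHom_ext K fun m => by
    rw [AlgHom.comp_apply, twist_chi, map_smul, twist_chi, twist_chi, smul_smul,
      MonoidHom.mul_apply, Units.val_mul, mul_comm]

theorem twist_one {N : Submodule ℤ V} (σ : PointedCone ℝ V) :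
    twist K (1 : TorusPoint K N) σ = AlgHom.id K _ :=
  chartRing_algHom_ext K fun m => by
    rw [twist_chi, MonoidHom.one_apply, Units.val_one, one_smul]; rfl

theorem chartMap_comp_twist {N : Submodule ℤ V} (c : TorusPoint K N) {σ τ : PointedCone ℝ V}
    (hτ : τ ≤ σ) :
    (chartMap K (le_refl N) hτ).comp (twist K c σ) =
      (twist K c τ).comp (chartMap K (le_refl N) hτ) :=
  chartRing_algHom_ext K fun m => by
    rw [AlgHom.comp_apply, AlgHom.comp_apply, twist_chi, map_smul, chartMap_chi, twist_chi]

/-- The points of the torus of `N'` that map to the identity of the torus of `N`, that is, the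
kernel of the isogeny of tori given by a sublattice `N' ⊆ N`. -/
def isogenyKernel (K : Type u) [Field K] (N N' : Submodule ℤ V) : Subgroup (TorusPoint K N') where
  carrier := {c | ∀ m : dualLattice N', m.1 ∈ dualLattice N → c (Multiplicative.ofAdd m) = 1}
  one_mem' := fun _ _ => rfl
  mul_mem' := fun ha hb m hm => by rw [MonoidHom.mul_apply, ha m hm, hb m hm, one_mul]
  inv_mem' := fun ha m hm => by rw [MonoidHom.inv_apply, ha m hm, inv_one]

theorem twist_comp_chartMap {N N' : Submodule ℤ V} (h : N' ≤ N) {c : TorusPoint K N'}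
    (hc : c ∈ isogenyKernel K N N') (σ : PointedCone ℝ V) :
    (twist K c σ).comp (chartMap K h (le_refl σ)) = chartMap K h (le_refl σ) :=
  chartRing_algHom_ext K fun m => by
    rw [AlgHom.comp_apply, chartMap_chi, twist_chi, hc _ m.2.1, Units.val_one, one_smul]

/-- The action of a point of the torus on a chart. -/
noncomputable def twistHom {N : Submodule ℤ V} (c : TorusPoint K N) (σ : PointedCone ℝ V) :
    chart K N σ ⟶ chart K N σ :=
  Spec.map (CommRingCat.ofHom (twist K c σ).toRingHom)

theorem twistHom_one {N : Submodule ℤ V} (σ : PointedCone ℝ V) :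
    twistHom (1 : TorusPoint K N) σ = 𝟙 _ := by
  rw [twistHom, twist_one]
  exact Spec.map_id _

theorem twistHom_mul {N : Submodule ℤ V} (c c' : TorusPoint K N) (σ : PointedCone ℝ V) :
    twistHom (c * c') σ = twistHom c σ ≫ twistHom c' σ := by
  have h := Spec.map_comp (CommRingCat.ofHom (twist K c' σ).toRingHom)
    (CommRingCat.ofHom (twist K c σ).toRingHom)
  rw [twistHom, ← twist_mul]
  exact h

theorem chartHom_twistHom {N : Submodule ℤ V} (c : TorusPoint K N) {σ τ : PointedCone ℝ V}
    (hτ : τ ≤ σ) :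
    chartHom K (le_refl N) hτ ≫ twistHom c σ = twistHom c τ ≫ chartHom K (le_refl N) hτ := by
  have h1 := Spec.map_comp (CommRingCat.ofHom (twist K c σ).toRingHom)
    (CommRingCat.ofHom (chartMap K (le_refl N) hτ).toRingHom)
  have h2 := Spec.map_comp (CommRingCat.ofHom (chartMap K (le_refl N) hτ).toRingHom)
    (CommRingCat.ofHom (twist K c τ).toRingHom)
  have h3 := congrArg AlgHom.toRingHom (chartMap_comp_twist c hτ)
  exact h1.symm.trans ((congrArg (fun f => Spec.map (CommRingCat.ofHom f)) h3).trans h2)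

theorem twistHom_chartHom {N N' : Submodule ℤ V} (h : N' ≤ N) {c : TorusPoint K N'}
    (hc : c ∈ isogenyKernel K N N') (σ : PointedCone ℝ V) :
    twistHom c σ ≫ chartHom K h (le_refl σ) = chartHom K h (le_refl σ) := by
  have h1 := Spec.map_comp (CommRingCat.ofHom (chartMap K h (le_refl σ)).toRingHom)
    (CommRingCat.ofHom (twist K c σ).toRingHom)
  have h3 := congrArg AlgHom.toRingHom (twist_comp_chartMap h hc σ)
  exact h1.symm.trans (congrArg (fun f => Spec.map (CommRingCat.ofHom f)) h3)

/-- The action of a point of the torus on the toric variety. -/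
noncomputable def torusAction {F : Fan V} (c : TorusPoint K F.lattice) :
    F.toricVariety K ⟶ F.toricVariety K :=
  colimit.desc (chartDiagram K F.lattice F.cones)
    { pt := F.toricVariety K
      ι :=
        { app := fun σ => twistHom c σ.1 ≫ F.chartι K σ
          naturality := fun τ σ f => by
            have h : τ.1 ≤ σ.1 := leOfHom f
            refine (Category.assoc _ _ _).symm.trans ?_
            refine (congrArg (fun g => g ≫ F.chartι K σ) (chartHom_twistHom c h)).trans ?_
            refine (Category.assoc _ _ _).trans (Eq.trans ?_ (Category.comp_id _).symm)
            exact congrArg (fun g => twistHom c τ.1 ≫ g) (F.chartHom_chartι K h) } }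

theorem chartι_torusAction {F : Fan V} (c : TorusPoint K F.lattice) (σ : F.cones) :
    F.chartι K σ ≫ torusAction c = twistHom c σ.1 ≫ F.chartι K σ :=
  colimit.ι_desc _ _

theorem toricVariety_hom_ext {F : Fan V} {Z : Scheme.{u}} {f g : F.toricVariety K ⟶ Z}
    (h : ∀ σ, F.chartι K σ ≫ f = F.chartι K σ ≫ g) : f = g :=
  colimit.hom_ext h

theorem torusAction_one {F : Fan V} : torusAction (1 : TorusPoint K F.lattice) = 𝟙 _ :=
  toricVariety_hom_ext fun σ => by
    rw [chartι_torusAction, twistHom_one, Category.id_comp, Category.comp_id]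

theorem torusAction_mul {F : Fan V} (c c' : TorusPoint K F.lattice) :
    torusAction (c * c') = torusAction c ≫ torusAction c' :=
  toricVariety_hom_ext fun σ => by
    rw [chartι_torusAction, ← Category.assoc, chartι_torusAction, Category.assoc,
      chartι_torusAction, twistHom_mul, Category.assoc]

end TorusAction

section CoverGroup

variable {K : Type u} [Field K] {V : Type u} [NormedAddCommGroup V] [NormedSpace ℝ V] {F : Fan V}

/-- The action of a point of the torus of `N'` on the toric variety of `(N', Σ)`. -/
noncomputable def Fan.Sublattice.action (L : F.Sublattice) (c : TorusPoint K L.carrier) :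
    L.fan.toricVariety K ⟶ L.fan.toricVariety K :=
  torusAction (F := L.fan) c

theorem Fan.Sublattice.action_one (L : F.Sublattice) :
    L.action (1 : TorusPoint K L.carrier) = 𝟙 _ :=
  torusAction_one (F := L.fan)

theorem Fan.Sublattice.action_mul (L : F.Sublattice) (c c' : TorusPoint K L.carrier) :
    L.action (c * c') = L.action c ≫ L.action c' :=
  torusAction_mul (F := L.fan) c c'

theorem Fan.Sublattice.chartι_action (L : F.Sublattice) (c : TorusPoint K L.carrier)
    (σ : F.cones) : L.chartι K σ ≫ L.action c = twistHom c σ.1 ≫ L.chartι K σ :=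
  chartι_torusAction (F := L.fan) c ⟨σ.1, σ.2⟩

theorem Fan.Sublattice.action_toricCover (L : F.Sublattice) {c : TorusPoint K L.carrier}
    (hc : c ∈ isogenyKernel K F.lattice L.carrier) :
    L.action c ≫ L.toricCover K = L.toricCover K := by
  refine toricVariety_hom_ext (F := L.fan) fun σ => ?_
  change L.chartι K ⟨σ.1, σ.2⟩ ≫ _ = L.chartι K ⟨σ.1, σ.2⟩ ≫ _
  rw [← Category.assoc, L.chartι_action, Category.assoc, L.chartι_toricCover K, ← Category.assoc,
    twistHom_chartHom L.le hc]

/-- The kernel of the isogeny of tori acts on the toric cover. -/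
noncomputable def Fan.Sublattice.toCoverGroup (L : F.Sublattice) :
    isogenyKernel K F.lattice L.carrier →* CoverGroup (L.toricCover K) where
  toFun c := Over.isoMk
    { hom := L.action c.1
      inv := L.action (c⁻¹).1
      hom_inv_id := by rw [← L.action_mul, Subgroup.coe_inv, mul_inv_cancel, L.action_one]; rfl
      inv_hom_id := by rw [← L.action_mul, Subgroup.coe_inv, inv_mul_cancel, L.action_one]; rfl }
    (L.action_toricCover c.2)
  map_one' := Aut.ext (Over.OverMorphism.ext L.action_one)
  map_mul' c c' := Aut.ext (Over.OverMorphism.ext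
    ((congrArg L.action (mul_comm c.1 c'.1)).trans (L.action_mul _ _)))

theorem Fan.Sublattice.toCoverGroup_left (L : F.Sublattice)
    (c : isogenyKernel K F.lattice L.carrier) : (L.toCoverGroup c).hom.left = L.action c.1 := rfl

/-- An endomorphism of the ring of functions on the torus of `N'` that fixes the functions on the
torus of `N` is given by a point of the torus: the quotient of the image of a character by the
character is a root of unity, and in particular a constant. -/
theorem exists_eq_twist {N N' : Submodule ℤ V} (h : N' ≤ N) {e : ℕ} (he0 : e ≠ 0)
    (he : ∀ v ∈ N, e • v ∈ N') (φ : ChartRing K N' ⊥ →+* ChartRing K N' ⊥)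
    (hφ : ∀ x, φ (chartMap K h le_rfl x) = chartMap K h le_rfl x) :
    ∃ c ∈ isogenyKernel K N N', φ = (twist K c ⊥).toRingHom := by
  have hsingle : ∀ m : dualLattice N', ∃ a : K, φ (torusChi K N' m) = a • torusChi K N' m := by
    intro m
    have hu : IsUnit (φ (torusChi K N' m) * torusChi K N' (-m)) :=
      ((isUnit_torusChi K m).map φ).mul (isUnit_torusChi K (-m))
    obtain ⟨m₁, a, ha, hx⟩ := exists_eq_smul_torusChi K hu
    have h1 : φ (torusChi K N' m) ^ e = torusChi K N' m ^ e := by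
      rw [← map_pow, torusChi, chi_pow_eq_chartMap K h he, hφ]
    have h2 : (a • torusChi K N' m₁) ^ e = 1 := by
      rw [← hx, mul_pow, h1, ← mul_pow, ← torusChi_add, add_neg_cancel, torusChi_zero, one_pow]
    rw [smul_pow, ← torusChi_nsmul, torusChi, chi, AddMonoidAlgebra.smul_single, smul_eq_mul,
      mul_one, AddMonoidAlgebra.one_def, AddMonoidAlgebra.single_inj] at h2
    have h3 : m₁ = 0 := by
      rcases h2 with ⟨h2, -⟩ | ⟨-, h2⟩
      · have h4 : e • m₁.1 = 0 := congrArg Subtype.val h2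
        exact Subtype.ext ((smul_eq_zero.1 h4).resolve_left he0)
      · exact (one_ne_zero h2).elim
    refine ⟨a, ?_⟩
    rw [h3, torusChi_zero] at hx
    have h4 : φ (torusChi K N' m) * torusChi K N' (-m) * torusChi K N' m =
        φ (torusChi K N' m) := by
      rw [mul_assoc, ← torusChi_add, neg_add_cancel, torusChi_zero, mul_one]
    rw [← h4, hx, smul_mul_assoc, one_mul]
  choose a ha using hsingle
  have hinj : ∀ (m : dualLattice N') {b b' : K}, b • torusChi K N' m = b' • torusChi K N' m →
      b = b' := fun m b b' hb =>
    smul_left_injective K (isUnit_torusChi K m).ne_zero hb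
  let c : TorusPoint K N' := MonoidHom.toHomUnits
    { toFun := fun m => a m.toAdd
      map_one' := hinj 0 (by rw [toAdd_one, ← ha, one_smul, torusChi_zero, map_one])
      map_mul' := fun m m' => hinj (m.toAdd + m'.toAdd) (by
        rw [toAdd_mul, ← ha, torusChi_add, map_mul, ha, ha, smul_mul_smul_comm]) }
  have hc : ∀ m, (c (Multiplicative.ofAdd m) : K) = a m := fun m => rfl
  have hconst : ∀ b : K, φ (algebraMap K _ b) = algebraMap K _ b := by
    intro b
    have := hφ (algebraMap K _ b)
    rwa [AlgHom.commutes] at this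
  refine ⟨c, fun m hm => Units.ext ?_, ?_⟩
  · rw [hc, Units.val_one]
    refine hinj m ?_
    rw [← ha, one_smul]
    have := hφ (torusChi K N ⟨m.1, hm⟩)
    rwa [torusChi, chartMap_chi] at this
  · let φ' : ChartRing K N' ⊥ →ₐ[K] ChartRing K N' ⊥ := { φ with commutes' := hconst }
    have : φ' = twist K c ⊥ := chartRing_algHom_ext K fun m => by
      rw [twist_chi, hc]
      exact ha ⟨m.1, m.2.1⟩
    rw [← this]

variable [FiniteDimensional ℝ V]

variable (F) in
/-- The zero cone, whose chart is the torus. -/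
def zeroCone : F.cones := ⟨⊥, bot_mem_cones F⟩

theorem Fan.Sublattice.toCoverGroup_injective (L : F.Sublattice) :
    Function.Injective (L.toCoverGroup (K := K)) := by
  refine (injective_iff_map_eq_one _).2 fun c hc => Subtype.ext (MonoidHom.ext fun m => ?_)
  have h1 : L.action c.1 = 𝟙 _ := congrArg (fun g => g.hom.left) hc
  have h2 := L.chartι_action c.1 (zeroCone F)
  rw [h1, Category.comp_id] at h2
  have h3 : twistHom c.1 (zeroCone F).1 = 𝟙 _ := by
    rw [← cancel_mono (L.chartι K (zeroCone F)), ← h2, Category.id_comp]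
  have h4 : CommRingCat.ofHom (twist K c.1 ⊥).toRingHom = 𝟙 _ :=
    Spec.map_injective (h3.trans (Spec.map_id _).symm)
  have h5 : twist K c.1 ⊥ (torusChi K L.carrier m.toAdd) = torusChi K L.carrier m.toAdd :=
    congrArg (fun f => f.hom (torusChi K L.carrier m.toAdd)) h4
  rw [torusChi, chi, twist_single, mul_one] at h5
  exact Units.ext (AddMonoidAlgebra.single_right_injective h5)

/-- An automorphism over `Y` preserves the torus of `N'`, on which it is the action of a point of
the kernel of the isogeny. As the torus is dense, so it is everywhere. -/
theorem Fan.Sublattice.toCoverGroup_surjective (L : F.Sublattice) :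
    Function.Surjective (L.toCoverGroup (K := K)) := by
  intro g
  obtain ⟨e, he0, he⟩ := L.exists_smul_mem
  let f := L.toricCover K
  let j := L.chartι K (zeroCone F)
  let γ : L.fan.toricVariety K ⟶ L.fan.toricVariety K := g.hom.left
  have hg : γ ≫ f = f := Over.w g.hom
  have hf := L.chartι_toricCover K (zeroCone F)
  have hrange : Set.range (j ≫ γ) ⊆ Set.range j := by
    rintro _ ⟨x, rfl⟩
    refine L.mem_range_chartι K ⟨chartHom K L.le le_rfl x, ?_⟩
    have h : (j ≫ γ) ≫ f = chartHom K L.le le_rfl ≫ F.chartι K (zeroCone F) := by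
      rw [Category.assoc, hg]; exact hf
    exact congrArg (fun k => k x) h.symm
  let t := IsOpenImmersion.lift j (j ≫ γ) hrange
  have ht : t ≫ j = j ≫ γ := IsOpenImmersion.lift_fac _ _ _
  have ht' : t ≫ chartHom K L.le (le_refl (zeroCone F).1) = chartHom K L.le le_rfl := by
    rw [← cancel_mono (F.chartι K (zeroCone F)), Category.assoc, ← hf, ← Category.assoc, ht,
      Category.assoc]
    exact congrArg (fun k => j ≫ k) hg
  obtain ⟨φ, hφ⟩ := Spec.map_surjective t
  have h1 : CommRingCat.ofHom (chartMap K L.le (le_refl (zeroCone F).1)).toRingHom ≫ φ =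
      CommRingCat.ofHom (chartMap K L.le (le_refl (zeroCone F).1)).toRingHom := by
    refine Spec.map_injective ((Spec.map_comp _ _).trans ?_)
    rw [hφ]
    exact ht'
  obtain ⟨c, hc, hcφ⟩ := exists_eq_twist L.le he0 he φ.hom fun x =>
    congrArg (fun k => k.hom x) h1
  have htw : t = twistHom c ⊥ := by
    rw [← hφ, twistHom, ← hcφ]
    rfl
  refine ⟨⟨c, hc⟩, Aut.ext (Over.OverMorphism.ext ?_)⟩
  rw [L.toCoverGroup_left]
  have hdom : IsDominant j := ⟨by
    have : Nonempty (chart K L.carrier (zeroCone F).1) := inferInstance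
    exact j.isOpenEmbedding.isOpen_range.dense (Set.range_nonempty _)⟩
  refine ext_of_isDominant_of_isSeparated f ((L.action_toricCover hc).trans hg.symm) j ?_
  rw [L.chartι_action, ← ht, htw]
  rfl

end CoverGroup

/-! ### The lattice quotient as the kernel of the isogeny of tori -/

section RootCharacters

variable {K : Type u} [Field K] {V : Type u} [NormedAddCommGroup V] [NormedSpace ℝ V]
  {N N' : Submodule ℤ V}

/-- The integral pairing of a lattice with its dual lattice. -/
noncomputable def pairing (N : Submodule ℤ V) : N →+ dualLattice N →+ ℤ :=
  AddMonoidHom.mk' (fun v => AddMonoidHom.mk' (fun m => Classical.choose (m.2 v v.2))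
    fun m m' => by
      have h := Classical.choose_spec (m.2 v v.2)
      have h' := Classical.choose_spec (m'.2 v v.2)
      have h'' := Classical.choose_spec ((m + m').2 v v.2)
      have : (m + m').1 v = m.1 v + m'.1 v := rfl
      rw [h, h', h''] at this
      exact_mod_cast this)
    fun v v' => AddMonoidHom.ext fun m => by
      have h := Classical.choose_spec (m.2 v v.2)
      have h' := Classical.choose_spec (m.2 v' v'.2)
      have h'' := Classical.choose_spec (m.2 (v + v' : N) (v + v').2)
      have : m.1 (v + v' : N) = m.1 v + m.1 v' := map_add m.1 v.1 v'.1
      rw [h, h', h''] at this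
      exact_mod_cast this

theorem pairing_cast (v : N) (m : dualLattice N) : (pairing N v m : ℝ) = m.1 v :=
  (Classical.choose_spec (m.2 v v.2)).symm

/-- For an `e`-th root of unity `ζ`, the point `m ↦ ζ ^ m(e v)` of the torus of `N'`, which is the
image of `v ∈ N` under the composite of `N / N' → e⁻¹ N' / N'` and the map from the latter group to
the `e`-torsion of the torus that `ζ` provides. -/
noncomputable def rootPoint {e : ℕ} (he : ∀ v ∈ N, e • v ∈ N') (ζ : Kˣ) (v : N) :
    TorusPoint K N' where
  toFun m := ζ ^ pairing N' ⟨e • v.1, he v v.2⟩ m.toAdd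
  map_one' := by rw [toAdd_one, map_zero, zpow_zero]
  map_mul' m m' := by rw [toAdd_mul, map_add, zpow_add]

theorem rootPoint_apply {e : ℕ} (he : ∀ v ∈ N, e • v ∈ N') (ζ : Kˣ) (v : N)
    (m : Multiplicative (dualLattice N')) :
    rootPoint he ζ v m = ζ ^ pairing N' ⟨e • v.1, he v v.2⟩ m.toAdd := rfl

theorem rootPoint_mem {e : ℕ} (he : ∀ v ∈ N, e • v ∈ N') {ζ : Kˣ} (hζ : ζ ^ e = 1) (v : N) :
    rootPoint he ζ v ∈ isogenyKernel K N N' := by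
  intro m hm
  obtain ⟨k, hk⟩ := hm v v.2
  have h := pairing_cast ⟨e • v.1, he v v.2⟩ m
  rw [map_nsmul, hk, nsmul_eq_mul] at h
  have h' : pairing N' ⟨e • v.1, he v v.2⟩ m = e * k := by exact_mod_cast h
  rw [rootPoint_apply, toAdd_ofAdd, h', zpow_mul, zpow_natCast, hζ, one_zpow]

/-- The homomorphism from `N` to the kernel of the isogeny of tori given by `N' ⊆ N`. -/
noncomputable def rootHom {e : ℕ} (he : ∀ v ∈ N, e • v ∈ N') {ζ : Kˣ} (hζ : ζ ^ e = 1) :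
    Multiplicative N →* isogenyKernel K N N' :=
  MonoidHom.mk' (fun v => ⟨rootPoint he ζ v.toAdd, rootPoint_mem he hζ _⟩) fun v v' =>
    Subtype.ext (MonoidHom.ext fun m => by
      have h : (⟨e • (v * v').toAdd.1, he _ (v * v').toAdd.2⟩ : N') =
          ⟨e • v.toAdd.1, he _ v.toAdd.2⟩ + ⟨e • v'.toAdd.1, he _ v'.toAdd.2⟩ :=
        Subtype.ext (smul_add e v.toAdd.1 v'.toAdd.1)
      change rootPoint he ζ (v * v').toAdd m = rootPoint he ζ v.toAdd m * rootPoint he ζ v'.toAdd m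
      rw [rootPoint_apply, rootPoint_apply, rootPoint_apply, h, map_add, AddMonoidHom.add_apply,
        zpow_add])

/-- The kernel of the isogeny of tori detects the dual lattice of `N` in that of `N'`. -/
theorem mem_dualLattice_of_forall_isogenyKernel {e : ℕ} (he0 : e ≠ 0) (he : ∀ v ∈ N, e • v ∈ N')
    {ζ : Kˣ} (hζ : IsPrimitiveRoot ζ e) (m : dualLattice N')
    (h : ∀ c ∈ isogenyKernel K N N', c (Multiplicative.ofAdd m) = 1) : m.1 ∈ dualLattice N := by
  intro v hv
  have h1 := h _ (rootPoint_mem he hζ.pow_eq_one ⟨v, hv⟩)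
  rw [rootPoint_apply, hζ.zpow_eq_one_iff_dvd] at h1
  obtain ⟨k, hk⟩ := h1
  have h2 := pairing_cast ⟨e • v, he v hv⟩ m
  rw [toAdd_ofAdd] at hk
  rw [hk, map_nsmul, nsmul_eq_mul] at h2
  push_cast at h2
  exact ⟨k, (mul_left_cancel₀ (Nat.cast_ne_zero.2 he0) h2).symm⟩

/-- The functions on the chart of `σ` for `N'` that are invariant under the kernel of the isogeny
of tori are the functions on the chart for `N`. -/
theorem exists_chartMap_eq {e : ℕ} (he0 : e ≠ 0) (hN : N' ≤ N) (he : ∀ v ∈ N, e • v ∈ N')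
    {ζ : Kˣ} (hζ : IsPrimitiveRoot ζ e) (σ : PointedCone ℝ V) (b : ChartRing K N' σ)
    (h : ∀ c ∈ isogenyKernel K N N', twist K c σ b = b) :
    ∃ a, chartMap K hN (le_refl σ) a = b := by
  classical
  have hmem : ∀ m ∈ b.coeff.support, m.1 ∈ dualMonoid N σ := by
    intro m hm
    refine ⟨mem_dualLattice_of_forall_isogenyKernel he0 he hζ ⟨m.1, m.2.1⟩ fun c hc => ?_, m.2.2⟩
    have h1 := congrArg (fun x => x.coeff m) (h c hc)
    simp only [twist_coeff] at h1
    exact Units.ext (mul_right_cancel₀ (Finsupp.mem_support_iff.1 hm) (h1.trans (one_mul _).symm))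
  have hsum : b = ∑ m ∈ b.coeff.support, AddMonoidAlgebra.single m (b.coeff m) := by
    exact b.sum_coeff_single.symm
  refine (AlgHom.mem_range (chartMap K hN (le_refl σ))).1 ?_
  rw [hsum]
  refine Subalgebra.sum_mem _ fun m hm => ⟨AddMonoidAlgebra.single ⟨m.1, hmem m hm⟩ (b.coeff m), ?_⟩
  exact chartMap_single K hN (le_refl σ) _ _

variable [FiniteDimensional ℝ V] [DiscreteTopology N'] [IsZLattice ℝ N']

/-- As `ζ` is a primitive root of unity, `v` acts trivially if and only if all elements of the dual
lattice of `N'` are integral on `v`, that is, if and only if `v` is in `N'`. -/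
theorem rootHom_eq_one_iff {e : ℕ} (he0 : e ≠ 0) (he : ∀ v ∈ N, e • v ∈ N') {ζ : Kˣ}
    (hζ : IsPrimitiveRoot ζ e) (v : Multiplicative N) :
    rootHom he hζ.pow_eq_one v = 1 ↔ v.toAdd.1 ∈ N' := by
  have he0' : (e : ℝ) ≠ 0 := Nat.cast_ne_zero.2 he0
  have hmul : ∀ m : dualLattice N', (pairing N' ⟨e • v.toAdd.1, he _ v.toAdd.2⟩ m : ℝ) =
      e * m.1 v.toAdd.1 := fun m => by rw [pairing_cast, map_nsmul, nsmul_eq_mul]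
  have h1 : rootHom he hζ.pow_eq_one v = 1 ↔ ∀ m : dualLattice N',
      (e : ℤ) ∣ pairing N' ⟨e • v.toAdd.1, he _ v.toAdd.2⟩ m := by
    rw [Subtype.ext_iff, MonoidHom.ext_iff]
    exact ⟨fun h m => (hζ.zpow_eq_one_iff_dvd _).1 (h (Multiplicative.ofAdd m)),
      fun h m => (hζ.zpow_eq_one_iff_dvd _).2 (h m.toAdd)⟩
  rw [h1]
  refine ⟨fun h => mem_lattice_of_forall_dualLattice fun m hm => ?_, fun h m => ?_⟩
  · obtain ⟨k, hk⟩ := h ⟨m, hm⟩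
    have := hmul ⟨m, hm⟩
    rw [hk] at this
    push_cast at this
    exact ⟨k, (mul_left_cancel₀ he0' this).symm⟩
  · obtain ⟨k, hk⟩ := m.2 _ h
    have := hmul m
    rw [hk] at this
    exact ⟨k, by exact_mod_cast this⟩

/-- The values of a point of the kernel are `e`-th roots of unity, so that the point is
`m ↦ ζ ^ m(w)` for some `w` in `N'`, and `w` has to be divisible by `e` in `N`. -/
theorem rootHom_surjective [DiscreteTopology N] [IsZLattice ℝ N] {e : ℕ} (he0 : e ≠ 0)
    (hN : N' ≤ N) (he : ∀ v ∈ N, e • v ∈ N') {ζ : Kˣ} (hζ : IsPrimitiveRoot ζ e) :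
    Function.Surjective (rootHom he hζ.pow_eq_one) := by
  classical
  intro c
  have : NeZero e := ⟨he0⟩
  have he0' : (e : ℝ) ≠ 0 := Nat.cast_ne_zero.2 he0
  obtain ⟨ι, _, B, hB⟩ := exists_latticeBasis N'
  have hpow : ∀ m, c.1 m ^ e = 1 := by
    intro m
    rw [← map_pow]
    refine c.2 (m ^ e).toAdd fun v hv => ?_
    obtain ⟨k, hk⟩ := m.toAdd.2 _ (he v hv)
    refine ⟨k, ?_⟩
    rw [← hk, map_nsmul]
    rfl
  have hk : ∀ i, ∃ k : ℕ, c.1 (Multiplicative.ofAdd ⟨B.coord i, coord_mem_dualLattice hB i⟩) =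
      ζ ^ k := fun i => by
    obtain ⟨k, -, hk⟩ := (IsPrimitiveRoot.coe_units_iff.2 hζ).eq_pow_of_pow_eq_one
      (by rw [← Units.val_pow_eq_pow_val, hpow (Multiplicative.ofAdd
        ⟨B.coord i, coord_mem_dualLattice hB i⟩), Units.val_one])
    exact ⟨k, Units.ext (by rw [← hk, Units.val_pow_eq_pow_val])⟩
  choose k hk using hk
  let w : N' := ∑ i, k i • ⟨B i, basis_mem_lattice hB i⟩
  -- `c` and `m ↦ ζ ^ m(w)` agree on the dual basis, which generates the dual lattice.
  have hc : ∀ m : dualLattice N', c.1 (Multiplicative.ofAdd m) = ζ ^ pairing N' w m := by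
    intro m
    have hm : m = ∑ i, pairing N' ⟨B i, basis_mem_lattice hB i⟩ m •
        ⟨B.coord i, coord_mem_dualLattice hB i⟩ := by
      refine Subtype.ext (B.ext fun j => ?_)
      rw [AddSubgroup.val_finsetSum, LinearMap.sum_apply, Finset.sum_eq_single j]
      · change _ = (pairing N' ⟨B j, basis_mem_lattice hB j⟩ m • B.coord j) (B j)
        rw [LinearMap.smul_apply, B.coord_apply, B.repr_self, Finsupp.single_eq_same,
          zsmul_eq_mul, mul_one, pairing_cast]
      · intro i _ hij
        change (pairing N' ⟨B i, basis_mem_lattice hB i⟩ m • B.coord i) (B j) = 0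
        rw [LinearMap.smul_apply, B.coord_apply, B.repr_self, Finsupp.single_eq_of_ne hij,
          smul_zero]
      · simp
    have hw : pairing N' w m = ∑ i, k i * pairing N' ⟨B i, basis_mem_lattice hB i⟩ m := by
      rw [map_sum, AddMonoidHom.finsetSum_apply]
      exact Finset.sum_congr rfl fun i _ => by rw [map_nsmul, AddMonoidHom.nsmul_apply,
        nsmul_eq_mul]
    conv_lhs => rw [hm]
    rw [ofAdd_sum, map_prod, hw]
    have hz := map_prod (zpowersHom Kˣ ζ)
      (fun i => Multiplicative.ofAdd ((k i : ℤ) * pairing N' ⟨B i, basis_mem_lattice hB i⟩ m))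
      Finset.univ
    rw [← ofAdd_sum] at hz
    refine Eq.trans (Finset.prod_congr rfl fun i _ => ?_) hz.symm
    rw [ofAdd_zsmul, map_zpow, hk, zpowersHom_apply, toAdd_ofAdd, zpow_mul, zpow_natCast]
  -- `w` is divisible by `e` in `N`, as `c` is trivial on the dual lattice of `N`.
  have hwN : (e : ℝ)⁻¹ • w.1 ∈ N := by
    refine mem_lattice_of_forall_dualLattice fun m hm => ?_
    have h1 := c.2 ⟨m, dualLattice_anti hN hm⟩ hm
    rw [hc, hζ.zpow_eq_one_iff_dvd] at h1
    obtain ⟨l, hl⟩ := h1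
    have h2 := pairing_cast w ⟨m, dualLattice_anti hN hm⟩
    rw [hl] at h2
    push_cast at h2
    exact ⟨l, by rw [map_smul, ← h2, smul_eq_mul, inv_mul_cancel_left₀ he0']⟩
  refine ⟨Multiplicative.ofAdd ⟨_, hwN⟩, Subtype.ext (MonoidHom.ext fun m => ?_)⟩
  have h3 : (⟨e • ((e : ℝ)⁻¹ • w.1), he _ hwN⟩ : N') = w := Subtype.ext (by
    change e • ((e : ℝ)⁻¹ • w.1) = w.1
    rw [← Nat.cast_smul_eq_nsmul ℝ, smul_smul, mul_inv_cancel₀ he0', one_smul])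
  change rootPoint he ζ ⟨_, hwN⟩ m = _
  rw [rootPoint_apply, h3]
  exact (hc m.toAdd).symm

end RootCharacters

/-! ### Quotients by finite groups and toric covers as Galois covers -/

section QuotientCriterion

variable {X Y : Scheme.{u}} (f : X ⟶ Y)

theorem le_preimage_of_comp_eq {g : X ⟶ X} (hg : g ≫ f = f) (U : Y.Opens) :
    f ⁻¹ᵁ U ≤ g ⁻¹ᵁ (f ⁻¹ᵁ U) := by
  rw [← Scheme.Hom.comp_preimage, hg]

/-- The action of an automorphism over `Y` on the functions on the preimage of an open subset. -/
noncomputable def actOn {g : X ⟶ X} (hg : g ≫ f = f) (U : Y.Opens) :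
    Γ(X, f ⁻¹ᵁ U) ⟶ Γ(X, f ⁻¹ᵁ U) :=
  g.appLE _ _ (le_preimage_of_comp_eq f hg U)

/-- Restriction of functions between preimages of open subsets. -/
noncomputable def restrict {U W : Y.Opens} (h : W ≤ U) : Γ(X, f ⁻¹ᵁ U) ⟶ Γ(X, f ⁻¹ᵁ W) :=
  X.presheaf.map (homOfLE (f.preimage_mono h)).op

theorem restrict_restrict {U W T : Y.Opens} (h : W ≤ U) (h' : T ≤ W) (s : Γ(X, f ⁻¹ᵁ U)) :
    restrict f h' (restrict f h s) = restrict f (h'.trans h) s := by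
  rw [restrict, restrict, restrict, ← ConcreteCategory.comp_apply, ← X.presheaf.map_comp]
  rfl

theorem restrict_actOn {g : X ⟶ X} (hg : g ≫ f = f) {U W : Y.Opens} (h : W ≤ U)
    (s : Γ(X, f ⁻¹ᵁ U)) :
    actOn f hg W (restrict f h s) =
      restrict f h (actOn f hg U s) := by
  rw [actOn, actOn, restrict, ← ConcreteCategory.comp_apply, ← ConcreteCategory.comp_apply,
    Scheme.Hom.appLE_map, Scheme.Hom.map_appLE]

theorem actOn_app {g : X ⟶ X} (hg : g ≫ f = f) (U : Y.Opens) (t : Γ(Y, U)) :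
    actOn f hg U (f.app U t) = f.app U t := by
  have h : (g ≫ f).appLE U (f ⁻¹ᵁ U) (by rw [hg]) = f.app U := by
    rw [f.app_eq_appLE]
    congr 1
  have h' := Scheme.Hom.comp_appLE g f U (f ⁻¹ᵁ U) (by rw [hg])
  rw [h] at h'
  exact congrArg (fun φ => φ.hom t) h'.symm

theorem restrict_app {U W : Y.Opens} (h : W ≤ U) (t : Γ(Y, U)) :
    restrict f h (f.app U t) =
      f.app W (Y.presheaf.map (homOfLE h).op t) := by
  exact congrArg (fun φ => φ.hom t) (f.naturality (homOfLE h).op).symm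

/-- Invariants of localizations: if the invariant functions on the preimage of an affine open
subset descend, then so do those on the preimage of a nonempty basic open subset of it. -/
theorem exists_app_eq_of_basicOpen [IsIntegral X] [IsAffineHom f] (S : Set (X ⟶ X))
    (hS : ∀ g ∈ S, g ≫ f = f) {U : Y.Opens} (hU : IsAffineOpen U)
    (hloc : ∀ b : Γ(X, f ⁻¹ᵁ U), (∀ g, ∀ hg : g ∈ S, actOn f (hS g hg) U b = b) →
      ∃ c, f.app U c = b)
    (a : Γ(Y, U)) (hne : Nonempty (f ⁻¹ᵁ Y.basicOpen a)) (s : Γ(X, f ⁻¹ᵁ Y.basicOpen a))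
    (hs : ∀ g, ∀ hg : g ∈ S, actOn f (hS g hg) (Y.basicOpen a) s = s) :
    ∃ t, f.app (Y.basicOpen a) t = s := by
  have hle : Y.basicOpen a ≤ U := Y.basicOpen_le a
  let ρ := restrict f hle
  let := ρ.hom.toAlgebra
  have hV : IsAffineOpen (f ⁻¹ᵁ U) := hU.preimage f
  have : IsLocalization.Away (f.app U a) Γ(X, f ⁻¹ᵁ Y.basicOpen a) :=
    hV.isLocalization_of_eq_basicOpen (f.app U a) (homOfLE (f.preimage_mono hle))
      (Scheme.preimage_basicOpen f a)
  obtain ⟨n, b, hb⟩ := IsLocalization.Away.surj (f.app U a) s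
  have hb' : s * ρ (f.app U a) ^ n = ρ b := hb
  have hinj : Function.Injective ρ := map_injective_of_isIntegral X _
  obtain ⟨c, hc⟩ := hloc b fun g hg => hinj (by
    rw [← restrict_actOn f (hS g hg) hle, ← hb', map_mul, hs g hg, map_pow,
      restrict_actOn f (hS g hg) hle, actOn_app])
  have hunit : IsUnit (Y.presheaf.map (homOfLE hle).op a) := RingedSpace.isUnit_res_basicOpen _ a
  obtain ⟨v, hv⟩ := hunit
  refine ⟨Y.presheaf.map (homOfLE hle).op c * ↑(v⁻¹) ^ n, ?_⟩
  have h1 : f.app (Y.basicOpen a) ↑v = ρ (f.app U a) := by rw [hv, ← restrict_app f hle]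
  have h2 : f.app (Y.basicOpen a) ↑v * f.app (Y.basicOpen a) ↑(v⁻¹) = 1 := by
    rw [← map_mul, Units.mul_inv, map_one]
  rw [map_mul, map_pow, ← restrict_app f hle, hc]
  change ρ b * _ = _
  rw [← hb', ← h1, mul_assoc, ← mul_pow, h2, one_pow, mul_one]

/-- A criterion for quotients: a finite surjective morphism of integral schemes is the quotient by
a group that acts transitively on its fibres if the invariant functions descend locally. -/
theorem isQuotient_of_local [IsIntegral X] [IsIntegral Y] [IsFinite f]
    (hf : Function.Surjective f) (H : Subgroup (Aut X)) (hH : ∀ g ∈ H, g.hom ≫ f = f)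
    (horb : ∀ x y : X, f x = f y → ∃ g ∈ H, g.hom x = y)
    (hloc : ∀ y : Y, ∃ U : Y.Opens, y ∈ U ∧ IsAffineOpen U ∧ ∀ b : Γ(X, f ⁻¹ᵁ U),
      (∀ g, ∀ hg : g ∈ H, actOn f (hH g hg) U b = b) → ∃ c, f.app U c = b) :
    IsQuotient H f where
  invariant := hH
  isQuotientMap := f.isClosedMap.isQuotientMap f.continuous hf
  orbit := horb
  sections := by
    intro U s hs
    have hdom : IsDominant f := ⟨hf.denseRange⟩
    have := IsSchemeTheoreticallyDominant.of_isDominant f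
    have hinj : ∀ W : Y.Opens, Function.Injective (f.app W) := fun W => f.app_injective W
    have key : ∀ y : U, ∃ W : Y.Opens, ∃ h : W ≤ U, y.1 ∈ W ∧ ∃ t, f.app W t =
        restrict f h s := by
      rintro ⟨y, hy⟩
      obtain ⟨A, hyA, hA, hinv⟩ := hloc y
      obtain ⟨a, ha, hya⟩ := hA.exists_basicOpen_le ⟨y, hy⟩ hyA
      obtain ⟨x, hx⟩ := hf y
      refine ⟨Y.basicOpen a, ha, hya, ?_⟩
      refine exists_app_eq_of_basicOpen f {g | ∃ h ∈ H, h.hom = g} ?_ hA ?_ a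
        ⟨⟨x, (congrArg (· ∈ Y.basicOpen a) hx).mpr hya⟩⟩ _ ?_
      · rintro _ ⟨g, hg, rfl⟩
        exact hH g hg
      · exact fun b hb => hinv b fun g hg => hb _ ⟨g, hg, rfl⟩
      · rintro _ ⟨g, hg, rfl⟩
        rw [restrict_actOn f _ ha]
        exact congrArg _ (hs g hg)
    choose W hWU hyW t ht using key
    obtain ⟨t', ht', -⟩ := TopCat.Sheaf.existsUnique_gluing' Y.sheaf W U (fun y => homOfLE (hWU y))
      (fun y hy => TopologicalSpace.Opens.mem_iSup.2 ⟨⟨y, hy⟩, hyW _⟩) t (by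
        intro y z
        refine hinj _ ?_
        refine ((restrict_app f inf_le_left (t y)).symm.trans ?_).trans
          (restrict_app f inf_le_right (t z))
        rw [ht, ht, restrict_restrict, restrict_restrict])
    have ht'' : f.app U t' = s := by
      refine X.IsSheaf.section_ext fun x hx => ⟨f ⁻¹ᵁ W ⟨f x, hx⟩, f.preimage_mono (hWU _),
        hyW _, ?_⟩
      refine (restrict_app f (hWU ⟨f x, hx⟩) t').trans ?_
      exact (congrArg (f.app _) (ht' ⟨f x, hx⟩)).trans (ht ⟨f x, hx⟩)
    exact ⟨t', ht'', fun t₂ ht₂ => hinj _ (ht₂.trans ht''.symm)⟩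

end QuotientCriterion

section GaloisCover

variable {K : Type u} [Field K] {V : Type u} [NormedAddCommGroup V] [NormedSpace ℝ V] {F : Fan V}

theorem isIso_appLE_top {X Y : Scheme.{u}} (j : X ⟶ Y) [IsOpenImmersion j] {W : Y.Opens}
    (hW : W = j.opensRange) (e : ⊤ ≤ j ⁻¹ᵁ W) : IsIso (j.appLE W ⊤ e) := by
  have := j.isIso_app W hW.le
  have : IsIso (homOfLE e) := homOfLE_isIso_of_eq _ (le_antisymm e le_top ▸ rfl)
  rw [Scheme.Hom.appLE]
  infer_instance

theorem bijective_appLE_top {X Y : Scheme.{u}} (j : X ⟶ Y) [IsOpenImmersion j] {W : Y.Opens}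
    (hW : W = j.opensRange) (e : ⊤ ≤ j ⁻¹ᵁ W) : Function.Bijective (j.appLE W ⊤ e) := by
  have := isIso_appLE_top j hW e
  exact ConcreteCategory.bijective_of_isIso _

theorem Fan.Sublattice.preimage_opensRange (L : F.Sublattice) (σ : F.cones) :
    L.toricCover K ⁻¹ᵁ (F.chartι K σ).opensRange = (L.chartι K σ).opensRange := by
  ext x
  refine ⟨fun h => L.mem_range_chartι K h, ?_⟩
  rintro ⟨y, rfl⟩
  exact ⟨_, (L.toricCover_chartι K σ y).symm⟩

/-- For an affine open subset `Spec R` of `Y` with preimage `Spec S` in `X`, functions on the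
preimage correspond to elements of `S`, compatibly with automorphisms of `X` over `Y`, and descend
to `Y` if they come from `R`. -/
theorem exists_section_of_spec {X Y : Scheme.{u}} (f : X ⟶ Y) {R S : CommRingCat.{u}} (φ : R ⟶ S)
    (i : Spec R ⟶ Y) (j : Spec S ⟶ X) [IsOpenImmersion i] [IsOpenImmersion j]
    (hcomm : j ≫ f = Spec.map φ ≫ i) (hpre : f ⁻¹ᵁ i.opensRange = j.opensRange)
    (b : Γ(X, f ⁻¹ᵁ i.opensRange)) :
    ∃ β : S, (∀ (g : X ⟶ X) (hg : g ≫ f = f) (ψ : S ⟶ S), j ≫ g = Spec.map ψ ≫ j →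
        actOn f hg i.opensRange b = b → ψ β = β) ∧
      ∀ α, φ α = β → ∃ a, f.app i.opensRange a = b := by
  have hU : ⊤ ≤ i ⁻¹ᵁ i.opensRange := fun x _ => ⟨x, rfl⟩
  have hV : ⊤ ≤ j ⁻¹ᵁ (f ⁻¹ᵁ i.opensRange) := by
    rw [hpre]
    exact fun x _ => ⟨x, rfl⟩
  have hj : Function.Bijective (j.appLE (f ⁻¹ᵁ i.opensRange) ⊤ hV) := bijective_appLE_top j hpre _
  have hi : Function.Bijective (i.appLE i.opensRange ⊤ hU) := bijective_appLE_top i rfl _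
  refine ⟨(Scheme.ΓSpecIso S).hom (j.appLE (f ⁻¹ᵁ i.opensRange) ⊤ hV b), fun g hg ψ hψ hb => ?_,
    fun α hα => ?_⟩
  · have h1 : actOn f hg i.opensRange ≫ j.appLE (f ⁻¹ᵁ i.opensRange) ⊤ hV =
        j.appLE (f ⁻¹ᵁ i.opensRange) ⊤ hV ≫ (Spec.map ψ).appTop := by
      rw [actOn, Scheme.Hom.appLE_comp_appLE, Scheme.Hom.appTop, Scheme.Hom.app_eq_appLE]
      refine Eq.trans ?_ (Scheme.Hom.appLE_comp_appLE _ _ _ _ _ _ _).symm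
      congr 1
    have h2 := congrArg (fun χ => χ.hom b) h1
    have h3 := congrArg (fun χ => χ.hom (j.appLE (f ⁻¹ᵁ i.opensRange) ⊤ hV b))
      (Scheme.ΓSpecIso_naturality ψ)
    have h4 : j.appLE (f ⁻¹ᵁ i.opensRange) ⊤ hV (actOn f hg i.opensRange b) =
        (Spec.map ψ).appTop (j.appLE (f ⁻¹ᵁ i.opensRange) ⊤ hV b) := h2
    rw [hb] at h4
    exact h3.symm.trans (congrArg (Scheme.ΓSpecIso S).hom h4.symm)
  · obtain ⟨a, ha⟩ := hi.2 ((Scheme.ΓSpecIso R).inv α)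
    refine ⟨a, hj.1 ?_⟩
    have h1 : f.app i.opensRange ≫ j.appLE (f ⁻¹ᵁ i.opensRange) ⊤ hV =
        i.appLE i.opensRange ⊤ hU ≫ (Spec.map φ).appTop := by
      rw [Scheme.Hom.app_eq_appLE, Scheme.Hom.appTop, Scheme.Hom.app_eq_appLE]
      refine (Scheme.Hom.appLE_comp_appLE _ _ _ _ _ _ _).trans
        (Eq.trans ?_ (Scheme.Hom.appLE_comp_appLE _ _ _ _ _ _ _).symm)
      congr 1
    have h2 : j.appLE (f ⁻¹ᵁ i.opensRange) ⊤ hV (f.app i.opensRange a) =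
        (Spec.map φ).appTop (i.appLE i.opensRange ⊤ hU a) := congrArg (fun χ => χ.hom a) h1
    have h3 : (Scheme.ΓSpecIso S).inv (φ α) = (Spec.map φ).appTop ((Scheme.ΓSpecIso R).inv α) :=
      congrArg (fun χ => χ.hom α) (Scheme.ΓSpecIso_inv_naturality φ)
    rw [h2, ha, ← h3, hα]
    exact congrArg (fun χ => χ.hom (j.appLE (f ⁻¹ᵁ i.opensRange) ⊤ hV b))
      (Scheme.ΓSpecIso S).hom_inv_id

/-- Functions on the preimage of a chart that are invariant under the kernel of the isogeny of tori
descend to the chart. -/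
theorem Fan.Sublattice.exists_app_eq (L : F.Sublattice) {e : ℕ} (he0 : e ≠ 0)
    (he : ∀ v ∈ F.lattice, e • v ∈ L.carrier) {ζ : Kˣ} (hζ : IsPrimitiveRoot ζ e) (σ : F.cones)
    (b : Γ(L.fan.toricVariety K, L.toricCover K ⁻¹ᵁ (F.chartι K σ).opensRange))
    (hb : ∀ c, ∀ hc : c ∈ isogenyKernel K F.lattice L.carrier,
      actOn (L.toricCover K) (L.action_toricCover hc) _ b = b) :
    ∃ a, (L.toricCover K).app (F.chartι K σ).opensRange a = b := by
  have hi : @IsOpenImmersion (Spec (.of (ChartRing K F.lattice σ.1))) _ (F.chartι K σ) :=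
    inferInstanceAs (IsOpenImmersion (F.chartι K σ))
  have hj : @IsOpenImmersion (Spec (.of (ChartRing K L.carrier σ.1))) _ (L.chartι K σ) :=
    inferInstanceAs (IsOpenImmersion (L.chartι K σ))
  obtain ⟨β, hβ, h⟩ := exists_section_of_spec (L.toricCover K)
    (CommRingCat.ofHom (chartMap K L.le (le_refl σ.1)).toRingHom) (F.chartι K σ) (L.chartι K σ)
    (L.chartι_toricCover K σ) (L.preimage_opensRange σ) b
  obtain ⟨α, hα⟩ := exists_chartMap_eq he0 L.le he hζ σ.1 β fun c hc =>
    hβ _ (L.action_toricCover hc) (CommRingCat.ofHom (twist K c σ.1).toRingHom)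
      (L.chartι_action c σ) (hb c hc)
  exact h α hα

variable [FiniteDimensional ℝ V]

theorem Fan.Sublattice.finite_isogenyKernel (L : F.Sublattice) {e : ℕ} (he0 : e ≠ 0)
    (he : ∀ v ∈ F.lattice, e • v ∈ L.carrier) {ζ : Kˣ} (hζ : IsPrimitiveRoot ζ e) :
    Finite (isogenyKernel K F.lattice L.carrier) := by
  have := L.discreteTopology
  have : IsZLattice ℝ L.carrier := L.fan.isZLattice
  have : Finite (F.lattice.toAddSubgroup ⧸
      L.carrier.toAddSubgroup.addSubgroupOf F.lattice.toAddSubgroup) :=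
    @AddSubgroup.finite_quotient_of_finiteIndex _ _ _ ⟨L.relIndex_ne_zero⟩
  choose v hv using rootHom_surjective he0 L.le he hζ
  refine Finite.of_injective (fun c => QuotientAddGroup.mk (s :=
    L.carrier.toAddSubgroup.addSubgroupOf F.lattice.toAddSubgroup) (v c).toAdd) fun c c' h => ?_
  have h1 := (rootHom_eq_one_iff he0 he hζ ((v c)⁻¹ * v c')).2 (QuotientAddGroup.eq.1 h)
  rwa [map_mul, map_inv, hv, hv, inv_mul_eq_one] at h1

/-- The kernel of the isogeny of tori acts transitively on the fibres over each chart: a finite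
group of automorphisms of a ring is transitive on the primes over a prime of the ring of
invariants. -/
theorem Fan.Sublattice.exists_twistHom_eq (L : F.Sublattice) {e : ℕ} (he0 : e ≠ 0)
    (he : ∀ v ∈ F.lattice, e • v ∈ L.carrier) {ζ : Kˣ} (hζ : IsPrimitiveRoot ζ e) (σ : F.cones)
    {x y : chart K L.carrier σ.1}
    (h : chartHom K L.le (le_refl σ.1) x = chartHom K L.le (le_refl σ.1) y) :
    ∃ c ∈ isogenyKernel K F.lattice L.carrier, twistHom c σ.1 x = y := by
  have := L.finite_isogenyKernel he0 he hζ
  let := (chartMap K L.le (le_refl σ.1)).toRingHom.toAlgebra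
  let : MulSemiringAction (isogenyKernel K F.lattice L.carrier) (ChartRing K L.carrier σ.1) :=
    { smul := fun c x => twist K c.1 σ.1 x
      one_smul := fun x => congrArg (fun φ => φ x) (twist_one σ.1)
      mul_smul := fun c c' x => congrArg (fun φ => φ x) (twist_mul c.1 c'.1 σ.1).symm
      smul_zero := fun c => map_zero (twist K c.1 σ.1)
      smul_add := fun c => map_add (twist K c.1 σ.1)
      smul_one := fun c => map_one (twist K c.1 σ.1)
      smul_mul := fun c => map_mul (twist K c.1 σ.1) }
  have hfix : ∀ (c : isogenyKernel K F.lattice L.carrier) (a : ChartRing K F.lattice σ.1),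
      twist K c.1 σ.1 (chartMap K L.le (le_refl σ.1) a) = chartMap K L.le (le_refl σ.1) a :=
    fun c a => congrArg (fun φ => φ a) (twist_comp_chartMap L.le c.2 σ.1)
  have : SMulCommClass (isogenyKernel K F.lattice L.carrier) (ChartRing K F.lattice σ.1)
      (ChartRing K L.carrier σ.1) := ⟨fun c a b => by
    rw [Algebra.smul_def, Algebra.smul_def]
    exact (map_mul (twist K c.1 σ.1) _ _).trans (congrArg (· * _) (hfix c a))⟩
  have : Algebra.IsInvariant (ChartRing K F.lattice σ.1) (ChartRing K L.carrier σ.1)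
      (isogenyKernel K F.lattice L.carrier) := ⟨fun b hb => by
    exact exists_chartMap_eq he0 L.le he hζ σ.1 b fun c hc => hb ⟨c, hc⟩⟩
  let x' : PrimeSpectrum (ChartRing K L.carrier σ.1) := x
  let y' : PrimeSpectrum (ChartRing K L.carrier σ.1) := y
  obtain ⟨c, hc⟩ := Algebra.IsInvariant.exists_smul_of_under_eq (ChartRing K F.lattice σ.1)
    (ChartRing K L.carrier σ.1) (isogenyKernel K F.lattice L.carrier) x'.asIdeal y'.asIdeal
    (congrArg PrimeSpectrum.asIdeal h)
  refine ⟨(c⁻¹).1, (c⁻¹).2, PrimeSpectrum.ext (Ideal.ext fun b => ?_)⟩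
  change b ∈ _ ↔ b ∈ y'.asIdeal
  rw [hc, Ideal.mem_pointwise_smul_iff_inv_smul_mem]
  rfl

/-- A toric cover whose degree is prime to the characteristic (in the form that the lattice
quotient has an exponent that is prime to it) is Galois. -/
theorem Fan.Sublattice.isGaloisCover [IsAlgClosed K] (L : F.Sublattice) {e : ℕ} (hK : (e : K) ≠ 0)
    (he : ∀ v ∈ F.lattice, e • v ∈ L.carrier) : IsGaloisCover (L.toricCover K) where
  isFinite := inferInstance
  isQuotient := by
    have he0 : e ≠ 0 := fun h => hK (by rw [h, Nat.cast_zero])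
    have : NeZero (e : K) := ⟨hK⟩
    obtain ⟨ζ, hζ⟩ : ∃ ζ : Kˣ, IsPrimitiveRoot ζ e := by
      obtain ⟨ζ, hζ⟩ := HasEnoughRootsOfUnity.exists_primitiveRoot K e
      exact ⟨(hζ.isUnit he0).unit, IsPrimitiveRoot.coe_units_iff.1 hζ⟩
    have hH : ∀ g ∈ (coverAction (L.toricCover K)).range,
        g.hom ≫ L.toricCover K = L.toricCover K := by
      rintro _ ⟨g, rfl⟩
      exact Over.w g.hom
    refine isQuotient_of_local _ (L.toricCover_surjective K) _ hH ?_ ?_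
    · intro x y hxy
      obtain ⟨σ, x, rfl⟩ := L.exists_chartι K x
      obtain ⟨y, rfl⟩ := L.mem_range_chartι K (σ := σ) (x := y)
        ⟨_, (L.toricCover_chartι K σ x).symm.trans hxy⟩
      rw [L.toricCover_chartι K, L.toricCover_chartι K] at hxy
      obtain ⟨c, hc, rfl⟩ := L.exists_twistHom_eq he0 he hζ σ
        ((F.chartι K σ).isOpenEmbedding.injective hxy)
      exact ⟨_, ⟨L.toCoverGroup ⟨c, hc⟩, rfl⟩,
        congrArg (fun φ => φ x) (L.chartι_action c σ)⟩
    · intro y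
      obtain ⟨σ, y, rfl⟩ := Toric.exists_chartι K F y
      have : IsAffine (chart K F.lattice σ.1) := inferInstanceAs (IsAffine (Spec _))
      refine ⟨(F.chartι K σ).opensRange, ⟨y, rfl⟩, isAffineOpen_opensRange (F.chartι K σ),
        fun b hb => ?_⟩
      exact L.exists_app_eq he0 he hζ σ b fun c hc => hb _ ⟨L.toCoverGroup ⟨c, hc⟩, rfl⟩

/-- The automorphism group of a toric cover as a quotient of the lattice of the base. -/
theorem Fan.Sublattice.exists_hom_coverGroup [IsAlgClosed K] (L : F.Sublattice) {e : ℕ}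
    (hK : (e : K) ≠ 0) (he : ∀ v ∈ F.lattice, e • v ∈ L.carrier) :
    ∃ Φ : Multiplicative F.lattice →* CoverGroup (L.toricCover K), Function.Surjective Φ ∧
      ∀ v, Φ v = 1 ↔ v.toAdd.1 ∈ L.carrier := by
  have he0 : e ≠ 0 := fun h => hK (by rw [h, Nat.cast_zero])
  have : NeZero (e : K) := ⟨hK⟩
  have := L.discreteTopology
  have : IsZLattice ℝ L.carrier := L.fan.isZLattice
  obtain ⟨ζ, hζ⟩ : ∃ ζ : Kˣ, IsPrimitiveRoot ζ e := by
    obtain ⟨ζ, hζ⟩ := HasEnoughRootsOfUnity.exists_primitiveRoot K e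
    exact ⟨(hζ.isUnit he0).unit, IsPrimitiveRoot.coe_units_iff.1 hζ⟩
  refine ⟨L.toCoverGroup.comp (rootHom he hζ.pow_eq_one),
    L.toCoverGroup_surjective.comp (rootHom_surjective he0 L.le he hζ), fun v => ?_⟩
  rw [MonoidHom.comp_apply, map_eq_one_iff _ L.toCoverGroup_injective,
    rootHom_eq_one_iff he0 he hζ]

end GaloisCover

section IntermediateCovers

variable {K : Type u} [Field K] {V : Type u} [NormedAddCommGroup V] [NormedSpace ℝ V] {F : Fan V}

/-- A sublattice contained in a second one, as a sublattice of the lattice of the fan of the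
second one. Its fan is by definition that of the first sublattice. -/
def Fan.Sublattice.ofLE (L L' : F.Sublattice) (h : L.carrier ≤ L'.carrier) : L'.fan.Sublattice where
  carrier := L.carrier
  le := h
  relIndex_ne_zero := fun h0 => L.relIndex_ne_zero (by
    have := AddSubgroup.relIndex_mul_relIndex L.carrier.toAddSubgroup L'.carrier.toAddSubgroup
      F.lattice.toAddSubgroup h L'.le
    rw [← this]
    exact mul_eq_zero_of_left h0 _)

theorem Fan.Sublattice.ofLE_toricCover_comp (L L' : F.Sublattice) (h : L.carrier ≤ L'.carrier) :
    (L.ofLE L' h).toricCover K ≫ L'.toricCover K = L.toricCover K := by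
  refine toricVariety_hom_ext (F := L.fan) fun σ => ?_
  have h1 := (L.ofLE L' h).chartι_toricCover K ⟨σ.1, σ.2⟩
  have h2 := L'.chartι_toricCover K ⟨σ.1, σ.2⟩
  have h3 := L.chartι_toricCover K ⟨σ.1, σ.2⟩
  refine (Category.assoc _ _ _).symm.trans ((congrArg (· ≫ L'.toricCover K) h1).trans ?_)
  refine (Category.assoc _ _ _).trans ((congrArg (chartHom K h (le_refl σ.1) ≫ ·) h2).trans ?_)
  refine (Category.assoc _ _ _).symm.trans (Eq.trans ?_ h3.symm)
  exact congrArg (· ≫ F.chartι K ⟨σ.1, σ.2⟩) (chartHom_comp K _ _ _ _)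

/-- The toric cover of an intermediate lattice is a quotient of a Galois toric cover. -/
theorem Fan.Sublattice.exists_isQuotientCover [FiniteDimensional ℝ V] [IsAlgClosed K]
    (L L' : F.Sublattice) (h : L.carrier ≤ L'.carrier) {e : ℕ} (hK : (e : K) ≠ 0)
    (he : ∀ v ∈ F.lattice, e • v ∈ L.carrier) :
    ∃ H, IsQuotientCover (L.toricCover K) (L'.toricCover K) H := by
  let q : L.fan.toricVariety K ⟶ L'.fan.toricVariety K := (L.ofLE L' h).toricCover K
  have hq : IsGaloisCover q := (L.ofLE L' h).isGaloisCover hK fun v hv => he v (L'.le hv)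
  have hcomp : q ≫ L'.toricCover K = L.toricCover K := L.ofLE_toricCover_comp L' h
  have hle : (coverAction q).range ≤ (coverAction (L.toricCover K)).range := by
    rintro _ ⟨g, rfl⟩
    have hg : (coverAction q g).hom ≫ L.toricCover K = L.toricCover K := by
      rw [← hcomp, ← Category.assoc]
      exact congrArg (· ≫ L'.toricCover K) (Over.w g.hom)
    exact ⟨Over.isoMk (coverAction q g) hg, Aut.ext rfl⟩
  refine ⟨(coverAction q).range.comap (coverAction (L.toricCover K)), q, hcomp, ?_⟩
  rw [Subgroup.map_comap_eq_self hle]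
  exact hq.isQuotient

end IntermediateCovers

/-! ### Rational functions on affine charts and their orders -/

section OrderOnCharts

variable {Y : Scheme.{u}} {R : CommRingCat.{u}} (i : Spec R ⟶ Y) [IsOpenImmersion i]

/-- An element of `R`, as a function on an open subset `Spec R` of `Y`. -/
noncomputable def sectionOf : R ⟶ Γ(Y, i ''ᵁ ⊤) :=
  (Scheme.ΓSpecIso R).inv ≫ (i.appIso ⊤).inv

theorem sectionOf_bijective : Function.Bijective (sectionOf i) := by
  have : IsIso (sectionOf i) := by rw [sectionOf]; infer_instance
  exact ConcreteCategory.bijective_of_isIso _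

theorem mem_image_top (p : Spec R) : i p ∈ i ''ᵁ ⊤ := ⟨p, trivial, rfl⟩

theorem mem_basicOpen_sectionOf (p : PrimeSpectrum R) (r : R) :
    i p ∈ Y.basicOpen (sectionOf i r) ↔ r ∉ p.asIdeal := by
  have h1 : i.appLE (i ''ᵁ ⊤) ⊤ (i.preimage_image_eq ⊤).ge (sectionOf i r) =
      (Scheme.ΓSpecIso R).inv r := by
    have h2 : sectionOf i ≫ i.appLE (i ''ᵁ ⊤) ⊤ (i.preimage_image_eq ⊤).ge =
        (Scheme.ΓSpecIso R).inv := by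
      rw [← i.appIso_hom', sectionOf, Category.assoc, Iso.inv_hom_id, Category.comp_id]
    exact congrArg (fun φ => φ.hom r) h2
  have h3 := Scheme.basicOpen_appLE i ⊤ (i ''ᵁ ⊤) (i.preimage_image_eq ⊤).ge (sectionOf i r)
  rw [h1, top_inf_eq] at h3
  have h4 : i p ∈ Y.basicOpen (sectionOf i r) ↔ p ∈ (Spec R).basicOpen
      ((Scheme.ΓSpecIso R).inv r) := by rw [h3]; rfl
  rw [h4, basicOpen_eq_of_affine]
  rfl

theorem isUnit_germ_sectionOf_iff (p : PrimeSpectrum R) (r : R) :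
    IsUnit (Y.presheaf.germ _ (i p) (mem_image_top i p) (sectionOf i r)) ↔ r ∉ p.asIdeal := by
  rw [← mem_basicOpen_sectionOf i p r, Scheme.mem_basicOpen]

theorem map_comap_maximalIdeal_stalk {U : Y.Opens} (hU : IsAffineOpen U) {y : Y} (hy : y ∈ U) :
    ((IsLocalRing.maximalIdeal (Y.presheaf.stalk y)).comap (Y.presheaf.germ U y hy).hom).map
      (Y.presheaf.germ U y hy).hom = IsLocalRing.maximalIdeal (Y.presheaf.stalk y) := by
  let := TopCat.Presheaf.algebra_section_stalk Y.presheaf (⟨y, hy⟩ : U)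
  have hloc := hU.isLocalization_stalk ⟨y, hy⟩
  exact IsLocalization.map_under (hU.primeIdealOf ⟨y, hy⟩).asIdeal.primeCompl
    (Y.presheaf.stalk y) _

/-- The maximal ideal of the local ring at a point of a chart whose prime ideal is principal. -/
theorem maximalIdeal_stalk_eq_span (p : PrimeSpectrum R) {t : R}
    (ht : p.asIdeal = Ideal.span {t}) :
    IsLocalRing.maximalIdeal (Y.presheaf.stalk (i p)) =
      Ideal.span {Y.presheaf.germ _ (i p) (mem_image_top i p) (sectionOf i t)} := by
  have hU : IsAffineOpen (i ''ᵁ ⊤) := (isAffineOpen_top _).image_of_isOpenImmersion i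
  have h2 : (IsLocalRing.maximalIdeal (Y.presheaf.stalk (i p))).comap
      (Y.presheaf.germ _ (i p) (mem_image_top i p)).hom = Ideal.span {sectionOf i t} := by
    ext s
    obtain ⟨r, rfl⟩ := (sectionOf_bijective i).2 s
    rw [Ideal.mem_comap, IsLocalRing.mem_maximalIdeal, mem_nonunits_iff]
    refine (not_congr (isUnit_germ_sectionOf_iff i p r)).trans ?_
    rw [not_not, ht, Ideal.mem_span_singleton, Ideal.mem_span_singleton]
    refine ⟨fun h => map_dvd _ h, fun ⟨c, hc⟩ => ?_⟩
    obtain ⟨c, rfl⟩ := (sectionOf_bijective i).2 c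
    exact ⟨c, (sectionOf_bijective i).1 (by rw [hc, map_mul])⟩
  have h3 := map_comap_maximalIdeal_stalk hU (mem_image_top i p)
  rw [h2, Ideal.map_span, Set.image_singleton] at h3
  exact h3.symm

variable [IsIntegral Y]

instance [IsDomain R] : Nonempty (i ''ᵁ ⊤ : Y.Opens) :=
  ⟨⟨i (⊥ : PrimeSpectrum R), mem_image_top i _⟩⟩

variable [IsDomain R]

/-- An element of `R`, as a rational function on an integral scheme `Y` that contains `Spec R` as an
open subset. -/
noncomputable def ratFun : R →+* Y.functionField :=
  (sectionOf i ≫ Y.germToFunctionField (i ''ᵁ ⊤)).hom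

theorem ratFun_injective : Function.Injective (ratFun i) :=
  (Y.germToFunctionField_injective _).comp (sectionOf_bijective i).1

theorem exists_ratFun_div (f : Y.functionField) :
    ∃ a b : R, b ≠ 0 ∧ f = ratFun i a / ratFun i b := by
  have hU : IsAffineOpen (i ''ᵁ ⊤) := (isAffineOpen_top _).image_of_isOpenImmersion i
  have := functionField_isFractionRing_of_isAffineOpen Y (i ''ᵁ ⊤) hU
  obtain ⟨a, b, hb, rfl⟩ := IsFractionRing.div_surjective (A := Γ(Y, i ''ᵁ ⊤)) f
  obtain ⟨a, rfl⟩ := (sectionOf_bijective i).2 a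
  obtain ⟨b, rfl⟩ := (sectionOf_bijective i).2 b
  refine ⟨a, b, ?_, rfl⟩
  rintro rfl
  exact nonZeroDivisors.ne_zero hb (map_zero _)

theorem ratFun_comp {S : CommRingCat.{u}} [IsDomain S] (j : Spec S ⟶ Y) [IsOpenImmersion j]
    (φ : R ⟶ S) (h : Spec.map φ ≫ i = j) (r : R) : ratFun j (φ r) = ratFun i r := by
  subst h
  have hle : (Spec.map φ ≫ i) ''ᵁ ⊤ ≤ i ''ᵁ ⊤ := by
    rintro _ ⟨x, -, rfl⟩
    exact ⟨Spec.map φ x, trivial, rfl⟩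
  have h1 : sectionOf i ≫ Y.presheaf.map (homOfLE hle).op = φ ≫ sectionOf (Spec.map φ ≫ i) := by
    rw [← cancel_mono ((Spec.map φ ≫ i).appIso ⊤).hom]
    have h2 : Y.presheaf.map (homOfLE hle).op ≫ ((Spec.map φ ≫ i).appIso ⊤).hom =
        (i.appIso ⊤).hom ≫ (Spec.map φ).appTop := by
      rw [Scheme.Hom.appIso_hom', Scheme.Hom.map_appLE, Scheme.Hom.appIso_hom', Scheme.Hom.appTop,
        Scheme.Hom.app_eq_appLE]
      exact (Scheme.Hom.appLE_comp_appLE _ _ _ _ _ _ _).symm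
    rw [Category.assoc, h2, sectionOf, sectionOf, Category.assoc, Iso.inv_hom_id_assoc,
      Category.assoc, Category.assoc, Iso.inv_hom_id, Category.comp_id]
    exact (Scheme.ΓSpecIso_inv_naturality φ).symm
  have h2 := congrArg (fun χ => Y.germToFunctionField _ (χ.hom r)) h1
  refine h2.symm.trans ?_
  exact congrArg (fun χ => χ.hom (sectionOf i r)) (Y.presheaf.germ_res (homOfLE hle)
    (genericPoint Y) (((genericPoint_spec Y).mem_open_set_iff ((Spec.map φ ≫ i) ''ᵁ ⊤).isOpen).mpr
      (by rw [Set.univ_inter]; exact ⟨_, mem_image_top _ (⊥ : PrimeSpectrum S)⟩)))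

variable [IsLocallyNoetherian Y]

theorem ord_ratFun_of_notMem (p : PrimeSpectrum R) {r : R} (hr : r ∉ p.asIdeal) :
    Scheme.ord (ratFun i r) (i p) = 0 := by
  rw [← mem_basicOpen_sectionOf i p r] at hr
  have : Nonempty (Y.basicOpen (sectionOf i r)) := ⟨⟨_, hr⟩⟩
  have hu : IsUnit (Y.presheaf.map (homOfLE (Y.basicOpen_le (sectionOf i r))).op
      (sectionOf i r)) := RingedSpace.isUnit_res_basicOpen _ (sectionOf i r)
  have h := Scheme.ord_of_isUnit hu hr
  have h2 := congrArg (fun χ => χ.hom (sectionOf i r))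
    (Y.presheaf.germ_res (homOfLE (Y.basicOpen_le (sectionOf i r))) (genericPoint Y)
      (((genericPoint_spec Y).mem_open_set_iff (Y.basicOpen _).isOpen).mpr
        (by rw [Set.univ_inter]; exact ⟨_, hr⟩)))
  exact (congrArg (fun f => Scheme.ord f (i p)) h2).symm.trans h

theorem ord_ratFun_nonneg (p : PrimeSpectrum R) {r : R} (hr : r ≠ 0) :
    0 ≤ Scheme.ord (ratFun i r) (i p) := by
  have h := Scheme.ord_le_smul (x := i p) (mem_image_top i p) (a := sectionOf i r)
    (fun h => hr ((sectionOf_bijective i).1 (by rw [h, map_zero]))) 1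
  rwa [ord_one, Algebra.smul_def, mul_one] at h

theorem ord_ratFun_of_span (p : PrimeSpectrum R) (hp : Order.coheight (i p) = 1) {t : R}
    (ht : p.asIdeal = Ideal.span {t}) (ht0 : t ≠ 0) :
    Scheme.ord (ratFun i t) (i p) = 1 := by
  have h0 : ratFun i t ≠ 0 := fun h => ht0 (ratFun_injective i (by rw [h, map_zero]))
  rw [Scheme.ord_eq_iff hp h0, Scheme.ordHom]
  have : Ring.KrullDimLE 1 (Y.presheaf.stalk (i p)) := krullDimLE_of_coheight_le hp.le
  have h1 := maximalIdeal_stalk_eq_span i p ht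
  set g := Y.presheaf.germ _ (i p) (mem_image_top i p) (sectionOf i t) with hg
  have h2 : algebraMap (Y.presheaf.stalk (i p)) Y.functionField g = ratFun i t :=
    Scheme.algebraMap_germ_eq_germToFunctionField _ (mem_image_top i p) _
  have hg0 : g ≠ 0 := fun h => h0 (by rw [← h2, h, map_zero])
  have h3 : Ring.ord (Y.presheaf.stalk (i p)) g = (1 : ℕ) := by
    rw [Nat.cast_one, Ring.ord, Module.length_eq_one_iff, isSimpleModule_iff_isCoatom, ← h1]
    exact (IsLocalRing.maximalIdeal.isMaximal _).out
  rw [← h2, Ring.ordFrac_eq_ord _ hg0,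
    Ring.ordMonoidWithZeroHom_eq_coe _ (mem_nonZeroDivisors_of_ne_zero hg0) h3]
  rfl

/-- A regular function that vanishes at a point of codimension one whose prime ideal is principal
has positive order there. -/
theorem ord_ratFun_pos (p : PrimeSpectrum R) (hp : Order.coheight (i p) = 1) {t : R}
    (ht : p.asIdeal = Ideal.span {t}) (ht0 : t ≠ 0) {r : R} (hr0 : r ≠ 0) (hr : r ∈ p.asIdeal) :
    0 < Scheme.ord (ratFun i r) (i p) := by
  rw [ht, Ideal.mem_span_singleton] at hr
  obtain ⟨c, rfl⟩ := hr
  have hc : c ≠ 0 := right_ne_zero_of_mul hr0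
  have hne : ∀ {a : R}, a ≠ 0 → ratFun i a ≠ 0 := fun ha h =>
    ha (ratFun_injective i (by rw [h, map_zero]))
  rw [map_mul, Scheme.ord_mul (hne ht0) (hne hc), ord_ratFun_of_span i p hp ht ht0]
  have := ord_ratFun_nonneg i p hc
  omega

end OrderOnCharts

/-! ### Points of codimension one and the divisors of characters -/

section PrimeDivisors

variable {K : Type u} [Field K] {V : Type u} [NormedAddCommGroup V] [NormedSpace ℝ V] (F : Fan V)

variable (K) in
/-- The chart `U_σ` of the toric variety, as a morphism from the spectrum of a ring. -/
noncomputable def Fan.specι (σ : F.cones) :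
    Spec (.of (ChartRing K F.lattice σ.1)) ⟶ F.toricVariety K :=
  F.chartι K σ

instance (σ : F.cones) : IsOpenImmersion (F.specι K σ) :=
  inferInstanceAs (IsOpenImmersion (F.chartι K σ))

instance (σ : F.cones) : IsDomain (CommRingCat.of (ChartRing K F.lattice σ.1)) :=
  inferInstanceAs (IsDomain (ChartRing K F.lattice σ.1))

variable (K) in
/-- The functions on a chart, as rational functions on the toric variety. -/
noncomputable def Fan.rat (σ : F.cones) :
    ChartRing K F.lattice σ.1 →+* (F.toricVariety K).functionField :=
  ratFun (F.specι K σ)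

theorem Fan.rat_injective (σ : F.cones) : Function.Injective (F.rat K σ) :=
  ratFun_injective (F.specι K σ)

theorem Fan.rat_chartMap {τ σ : F.cones} (h : τ.1 ≤ σ.1) (x : ChartRing K F.lattice σ.1) :
    F.rat K τ (chartMap K (le_refl F.lattice) h x) = F.rat K σ x :=
  ratFun_comp (F.specι K σ) (F.specι K τ)
    (CommRingCat.ofHom (chartMap K (le_refl F.lattice) h).toRingHom) (F.chartHom_chartι K h) x

theorem height_eq_one_of_coheight {σ : F.cones} (p : PrimeSpectrum (ChartRing K F.lattice σ.1))
    (h : Order.coheight (F.chartι K σ p) = 1) : p.asIdeal.height = 1 :=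
  (idealHeight_eq_coheight (.of (ChartRing K F.lattice σ.1)) p).trans
    ((coheight_eq_of_isOpenImmersion (F.chartι K σ)).symm.trans h)

theorem coheight_of_height_eq_one {σ : F.cones} (p : PrimeSpectrum (ChartRing K F.lattice σ.1))
    (h : p.asIdeal.height = 1) : Order.coheight (F.chartι K σ p) = 1 :=
  (coheight_eq_of_isOpenImmersion (F.chartι K σ)).trans
    ((idealHeight_eq_coheight (.of (ChartRing K F.lattice σ.1)) p).symm.trans h)

/-- A nonzero prime ideal contained in a prime ideal of height one is equal to it. -/
theorem eq_of_le_of_height_eq_one {R : Type*} [CommRing R] [IsDomain R] {Q P : Ideal R}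
    [Q.IsPrime] [P.IsPrime] (h : Q ≤ P) (hQ : Q ≠ ⊥) (hP : P.height = 1) : Q = P := by
  by_contra hne
  have h1 := Ideal.height_add_one_le_of_lt_of_isPrime (lt_of_le_of_ne h hne)
  have h2 := Ideal.height_add_one_le_of_lt_of_isPrime (bot_lt_iff_ne_bot.2 hQ)
  rw [hP] at h1
  have h3 : (1 : ℕ∞) ≤ Q.height := le_trans le_add_self h2
  have h4 : (1 : ℕ∞) + 1 ≤ 1 := (add_le_add_left h3 1).trans h1
  exact absurd h4 (by decide)

variable [FiniteDimensional ℝ V]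

/-- The points of codimension one of a toric variety lie in the torus or are the generic points of
the torus-invariant prime divisors: if `r` is a ray of the minimal cone whose chart contains the
point, then all characters on this chart that are not zero on `r` vanish at the point, so that the
point lies on `D_r`. -/
theorem Fan.exists_of_coheight_eq_one {y : F.toricVariety K} (hy : Order.coheight y = 1) :
    (∃ x, F.chartι K (zeroCone F) x = y) ∨ ∃ r : F.Ray, y = r.divisor K := by
  classical
  have : Finite F.cones := F.finite
  obtain ⟨σ₀, x₀, hx₀⟩ := exists_chartι K F y
  let T : Set F.cones := {σ | ∃ x, F.chartι K σ x = y}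
  obtain ⟨τ, hτ⟩ := T.toFinite.exists_minimal ⟨σ₀, x₀, hx₀⟩
  obtain ⟨p, rfl⟩ := hτ.prop
  by_cases hne : τ = zeroCone F
  · subst hne
    exact Or.inl ⟨p, rfl⟩
  have hne' : τ.1 ≠ ⊥ := fun h => hne (Subtype.ext h)
  obtain ⟨r, hr⟩ := exists_ray_le F τ.2 hne'
  refine Or.inr ⟨r, ?_⟩
  let P : PrimeSpectrum (ChartRing K F.lattice τ.1) := p
  have hmem : ∀ (m : Module.Dual ℝ V) (hm : m ∈ dualMonoid F.lattice τ.1), m r.gen ≠ 0 →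
      chi K F.lattice τ.1 ⟨m, hm⟩ ∈ P.asIdeal := by
    intro m hm hmr
    by_contra hnot
    let τ' : PointedCone ℝ V := τ.1 ⊓ (LinearMap.ker m).restrictScalars _
    have hface : ∀ v, v ∈ τ' ↔ v ∈ τ.1 ∧ m v = 0 := fun v => Iff.rfl
    have hτ' : τ' ∈ F.cones := F.face_mem _ τ.2 _ ⟨m, hm, hface⟩
    have hle : τ' ≤ τ.1 := inf_le_left
    have hrange : P ∈ Set.range (chartHom K (le_refl F.lattice) hle) := by
      rw [chartHom_range K F τ.2 hle hm hface]
      exact hnot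
    obtain ⟨z, hz⟩ := hrange
    have hz' : F.chartι K ⟨τ', hτ'⟩ z = F.chartι K τ p := by
      rw [← F.chartHom_chartι K (τ := ⟨τ', hτ'⟩) (σ := τ) hle]
      exact congrArg (F.chartι K τ) hz
    have h1 : τ ≤ ⟨τ', hτ'⟩ := hτ.le_of_le ⟨z, hz'⟩ hle
    exact hmr ((hface _).1 (h1 (hr r.gen_mem_cone))).2
  let ψ : ChartRing K F.lattice τ.1 →ₐ[K] ChartRing K F.lattice r.cone.1 :=
    (r.orbitHom K).comp (chartMap K (le_refl F.lattice) hr)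
  let Q : Ideal (ChartRing K F.lattice τ.1) := RingHom.ker ψ.toRingHom
  have hQ : Q.IsPrime := RingHom.ker_isPrime _
  have hψ : ∀ x : ChartRing K F.lattice τ.1,
      ∃ z, chartMap K (le_refl F.lattice) hr z = ψ x ∧ x - z ∈ P.asIdeal := by
    intro x
    induction x using AddMonoidAlgebra.induction_linear with
    | zero => exact ⟨0, by rw [map_zero, map_zero], by rw [sub_zero]; exact zero_mem _⟩
    | add x y hx hy =>
      obtain ⟨z, hz, hz'⟩ := hx
      obtain ⟨w, hw, hw'⟩ := hy
      exact ⟨z + w, by rw [map_add, map_add, hz, hw], by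
        rw [add_sub_add_comm]; exact add_mem hz' hw'⟩
    | single m a =>
      have h1 : ψ (AddMonoidAlgebra.single m a) = if m.1 r.gen = 0 then
          chartMap K (le_refl F.lattice) hr (AddMonoidAlgebra.single m a) else 0 := by
        change r.orbitHom K (chartMap K (le_refl F.lattice) hr _) = _
        rw [chartMap_single, r.orbitHom_chi K]
        rfl
      by_cases hm : m.1 r.gen = 0
      · exact ⟨_, by rw [h1, if_pos hm], by rw [sub_self]; exact zero_mem _⟩
      · refine ⟨0, by rw [h1, if_neg hm, map_zero], ?_⟩
        rw [sub_zero, single_eq_smul_chi K]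
        exact Submodule.smul_of_tower_mem _ a (hmem m.1 m.2 hm)
  have hQP : Q ≤ P.asIdeal := by
    intro x hx
    obtain ⟨z, hz, hz'⟩ := hψ x
    rw [show ψ x = 0 from hx, map_eq_zero_iff _ (chartMap_injective K _ _)] at hz
    rwa [hz, sub_zero] at hz'
  have hQ0 : Q ≠ ⊥ := by
    obtain ⟨l, hl, hpos⟩ := exists_strictlyPositive F τ.2
    have hlr := (hpos _ (hr r.gen_mem_cone) r.gen_ne_zero).ne'
    refine (Submodule.ne_bot_iff _).2 ⟨chi K F.lattice τ.1 ⟨l, hl⟩, ?_, ?_⟩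
    · change r.orbitHom K (chartMap K (le_refl F.lattice) hr (chi K F.lattice τ.1 ⟨l, hl⟩)) = 0
      rw [chartMap_chi, chi, r.orbitHom_chi K, if_neg hlr]
    · simp [chi]
  have heq : Q = P.asIdeal :=
    eq_of_le_of_height_eq_one hQP hQ0 (height_eq_one_of_coheight F P hy)
  have hp : chartHom K (le_refl F.lattice) hr (r.orbitPoint K) = P :=
    PrimeSpectrum.ext (heq ▸ rfl)
  have h := congrArg (fun φ => φ (r.orbitPoint K))
    (F.chartHom_chartι K (τ := r.cone) (σ := τ) hr)
  exact (congrArg (F.chartι K τ) hp.symm).trans h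

end PrimeDivisors

section CharacterDivisors

variable {K : Type u} [Field K] {V : Type u} [NormedAddCommGroup V] [NormedSpace ℝ V] (F : Fan V)

variable (K) in
/-- If `m` takes the value one on the integral generator of a ray, then the prime ideal of the
orbit of the ray is generated by `χ^m`. -/
theorem Fan.Ray.ker_orbitHom_eq_span {F : Fan V} (r : F.Ray) (m : dualMonoid F.lattice r.cone.1)
    (h : m.1 r.gen = 1) :
    RingHom.ker (r.orbitHom K).toRingHom = Ideal.span {chi K F.lattice r.cone.1 m} := by
  have hsub : ∀ f : ChartRing K F.lattice r.cone.1,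
      f - r.orbitHom K f ∈ Ideal.span {chi K F.lattice r.cone.1 m} := by
    intro f
    induction f using AddMonoidAlgebra.induction_linear with
    | zero => simp
    | add f g hf hg =>
      rw [map_add, add_sub_add_comm]
      exact add_mem hf hg
    | single u a =>
      rw [r.orbitHom_chi K]
      split_ifs with hu
      · simp
      · obtain ⟨k, hk⟩ := u.2.1 _ r.gen_mem
        have hpos : 0 < u.1 r.gen := lt_of_le_of_ne (u.2.2 _ r.gen_mem_cone) (Ne.symm hu)
        have hk1 : (1 : ℝ) ≤ k := by
          rw [hk] at hpos
          exact_mod_cast hpos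
        have hw : u.1 - m.1 ∈ dualMonoid F.lattice r.cone.1 := by
          refine (r.mem_dualMonoid_iff _).2 ⟨sub_mem u.2.1 m.2.1, ?_⟩
          rw [LinearMap.sub_apply, h, hk]
          linarith
        rw [sub_zero]
        refine Ideal.mem_span_singleton.2 ⟨AddMonoidAlgebra.single ⟨_, hw⟩ a, ?_⟩
        rw [chi, AddMonoidAlgebra.single_mul_single, one_mul]
        congr 1
        exact Subtype.ext (add_sub_cancel m.1 u.1).symm
  refine le_antisymm (fun f hf => ?_) ((Ideal.span_singleton_le_iff_mem _).2 ?_)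
  · have := hsub f
    rwa [show r.orbitHom K f = 0 from hf, sub_zero] at this
  · change r.orbitHom K (AddMonoidAlgebra.single _ _) = 0
    rw [r.orbitHom_chi K, if_neg (by rw [h]; exact one_ne_zero)]

variable [FiniteDimensional ℝ V]

variable (K) in
/-- The functions on the torus, as rational functions on the toric variety. -/
noncomputable def Fan.torusRat :
    ChartRing K F.lattice ⊥ →+* (F.toricVariety K).functionField :=
  F.rat K (zeroCone F)

variable (K) in
/-- The character `χ^m`, as a rational function on the toric variety. -/
noncomputable def Fan.charFun (m : dualLattice F.lattice) : (F.toricVariety K).functionField :=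
  F.torusRat K (torusChi K F.lattice m)

theorem Fan.charFun_ne_zero (m : dualLattice F.lattice) : F.charFun K m ≠ 0 := fun h =>
  (isUnit_torusChi K m).ne_zero (F.rat_injective (zeroCone F) (h.trans (map_zero _).symm))

theorem Fan.charFun_add (m m' : dualLattice F.lattice) :
    F.charFun K (m + m') = F.charFun K m * F.charFun K m' := by
  rw [charFun, torusChi_add, map_mul, charFun, charFun]

theorem Fan.torusRat_chartMap (σ : F.cones) (x : ChartRing K F.lattice σ.1) :
    F.torusRat K (chartMap K (le_refl F.lattice) bot_le x) = F.rat K σ x :=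
  F.rat_chartMap (τ := zeroCone F) (σ := σ) bot_le x

theorem Fan.charFun_eq_rat {σ : F.cones} {m : dualLattice F.lattice}
    (hm : m.1 ∈ dualMonoid F.lattice σ.1) :
    F.charFun K m = F.rat K σ (chi K F.lattice σ.1 ⟨m.1, hm⟩) := by
  rw [← F.torusRat_chartMap, chartMap_chi]
  rfl

variable (K) in
/-- The order of the characters at a point of a toric variety. -/
noncomputable def Fan.ordChar (y : F.toricVariety K) : dualLattice F.lattice →+ ℤ :=
  AddMonoidHom.mk' (fun m => Scheme.ord (F.charFun K m) y) fun m m' => by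
    rw [F.charFun_add, Scheme.ord_mul (F.charFun_ne_zero m) (F.charFun_ne_zero m')]

theorem Fan.ordChar_apply (y : F.toricVariety K) (m : dualLattice F.lattice) :
    F.ordChar K y m = Scheme.ord (F.charFun K m) y := rfl

theorem Fan.ordChar_eq_zero {y : F.toricVariety K} (σ : F.cones) (hy : y ∈ Set.range (F.chartι K σ))
    {m : dualLattice F.lattice} (hm : m.1 ∈ dualMonoid F.lattice σ.1)
    (hm' : -m.1 ∈ dualMonoid F.lattice σ.1) : F.ordChar K y m = 0 := by
  obtain ⟨p, rfl⟩ := hy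
  have h1 : 0 ≤ F.ordChar K (F.chartι K σ p) m := by
    rw [F.ordChar_apply, F.charFun_eq_rat hm]
    exact ord_ratFun_nonneg (F.specι K σ) p (by simp [chi])
  have h2 : 0 ≤ F.ordChar K (F.chartι K σ p) (-m) := by
    rw [F.ordChar_apply, F.charFun_eq_rat (m := -m) hm']
    exact ord_ratFun_nonneg (F.specι K σ) p (by simp [chi])
  rw [map_neg] at h2
  omega

theorem Fan.ordChar_torus (x : chart K F.lattice (zeroCone F).1) (m : dualLattice F.lattice) :
    F.ordChar K (F.chartι K (zeroCone F) x) m = 0 :=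
  F.ordChar_eq_zero (zeroCone F) ⟨x, rfl⟩ (mem_dualMonoid_bot.2 m.2)
    (mem_dualMonoid_bot.2 (-m).2)

/-- The order of the character `χ^m` along the divisor of a ray with integral generator `r` is
`m(r)`. -/
theorem Fan.ordChar_divisor (r : F.Ray) (m : dualLattice F.lattice) :
    (F.ordChar K (r.divisor K) m : ℝ) = m.1 r.gen := by
  obtain ⟨m₀, hm₀, h1⟩ := r.exists_apply_eq_one
  have hm₀' : m₀ ∈ dualMonoid F.lattice r.cone.1 :=
    (r.mem_dualMonoid_iff _).2 ⟨hm₀, by rw [h1]; exact zero_le_one⟩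
  have hord : F.ordChar K (r.divisor K) ⟨m₀, hm₀⟩ = 1 := by
    rw [F.ordChar_apply, F.charFun_eq_rat (m := ⟨m₀, hm₀⟩) hm₀']
    exact ord_ratFun_of_span (F.specι K r.cone) (r.orbitPoint K) (r.coheight_divisor K)
      (r.ker_orbitHom_eq_span K _ h1) (by simp [chi])
  obtain ⟨k, hk⟩ := m.2 _ r.gen_mem
  have hzero : (m - k • ⟨m₀, hm₀⟩ : dualLattice F.lattice).1 r.gen = 0 := by
    change m.1 r.gen - (k • m₀) r.gen = 0
    rw [hk, LinearMap.smul_apply, h1, zsmul_eq_mul, mul_one, sub_self]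
  have h2 : F.ordChar K (r.divisor K) (m - k • ⟨m₀, hm₀⟩) = 0 := by
    refine F.ordChar_eq_zero r.cone ⟨_, rfl⟩ ?_ ?_
    · exact (r.mem_dualMonoid_iff _).2 ⟨(m - k • ⟨m₀, hm₀⟩ : dualLattice F.lattice).2, hzero.ge⟩
    · refine (r.mem_dualMonoid_iff _).2 ⟨neg_mem (m - k • ⟨m₀, hm₀⟩ : dualLattice F.lattice).2, ?_⟩
      rw [LinearMap.neg_apply, hzero, neg_zero]
  rw [map_sub, map_zsmul, hord, smul_eq_mul, mul_one, sub_eq_zero] at h2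
  rw [h2, hk]

theorem Fan.Ray.divisor_injective : Function.Injective (fun r : F.Ray => r.divisor K) := by
  intro r s h
  have h1 : r.gen = s.gen := by
    rw [← sub_eq_zero]
    refine eq_zero_of_forall_dualLattice (N := F.lattice) fun m hm => ?_
    rw [map_sub, sub_eq_zero, ← F.ordChar_divisor (K := K) r ⟨m, hm⟩,
      ← F.ordChar_divisor (K := K) s ⟨m, hm⟩]
    exact congrArg (fun y => (F.ordChar K y ⟨m, hm⟩ : ℝ)) h
  cases r; cases s; cases h1; rfl

theorem Fan.Ray.divisor_ne_torus (r : F.Ray) (x : chart K F.lattice (zeroCone F).1) :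
    F.chartι K (zeroCone F) x ≠ r.divisor K := by
  intro h
  obtain ⟨m, hm, h1⟩ := r.exists_apply_eq_one
  have h2 := F.ordChar_divisor (K := K) r ⟨m, hm⟩
  rw [← h, F.ordChar_torus, h1] at h2
  simp at h2

theorem Fan.ord_torusRat_of_isUnit {u : ChartRing K F.lattice ⊥} (hu : IsUnit u) :
    ∃ m, ∀ r : F.Ray, Scheme.ord (F.torusRat K u) (r.divisor K) = F.ordChar K (r.divisor K) m := by
  obtain ⟨m, c, hc, rfl⟩ := exists_eq_smul_torusChi K hu
  refine ⟨m, fun r => ?_⟩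
  have h1 : F.torusRat K (algebraMap K _ c) = F.rat K r.cone (algebraMap K _ c) := by
    rw [← F.torusRat_chartMap, AlgHom.commutes]
  have hcu : IsUnit (algebraMap K (ChartRing K F.lattice r.cone.1) c) := hc.isUnit.map _
  have h2 : Scheme.ord (F.torusRat K (algebraMap K _ c)) (r.divisor K) = 0 := by
    rw [h1]
    exact ord_ratFun_of_notMem (F.specι K r.cone) (r.orbitPoint K) fun h =>
      (r.orbitPoint K).2.ne_top (Ideal.eq_top_of_isUnit_mem _ h hcu)
  have h3 : F.torusRat K (algebraMap K _ c) ≠ 0 := by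
    rw [h1]
    exact (hcu.map (F.rat K r.cone)).ne_zero
  rw [Algebra.smul_def, map_mul]
  refine (Scheme.ord_mul h3 (F.charFun_ne_zero m)).trans ?_
  rw [h2, zero_add]
  rfl

theorem torus_isNoetherianRing : IsNoetherianRing (ChartRing K F.lattice ⊥) :=
  have : Algebra.FiniteType K (ChartRing K F.lattice ⊥) := chartRing_finiteType K F (zeroCone F)
  Algebra.FiniteType.isNoetherianRing K _

theorem height_span_prime {R : Type*} [CommRing R] [IsDomain R] [IsNoetherianRing R] {q : R}
    (hq : Prime q) : (Ideal.span {q}).height = 1 := by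
  have hp : (Ideal.span {q}).IsPrime := (Ideal.span_singleton_prime hq.ne_zero).2 hq
  refine le_antisymm ?_ (Order.one_le_iff_ne_zero.2 fun h => ?_)
  · have : (Ideal.span {q}).IsPrincipal := ⟨⟨q, rfl⟩⟩
    exact Ideal.height_le_one_of_isPrincipal_of_mem_minimalPrimes (Ideal.span {q}) _
      ⟨⟨hp, le_refl _⟩, fun Q hQ _ => hQ.2⟩
  · exact hq.ne_zero (Ideal.span_singleton_eq_bot.1 (Ideal.height_eq_zero_iff_eq_bot.1 h))

/-- A nonzero rational function without zeros and poles on the torus is a constant multiple of a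
character: the ring of functions on the torus is factorial, and its units are known. -/
theorem Fan.exists_ord_eq_ordChar {f : (F.toricVariety K).functionField} (hf : f ≠ 0)
    (h : ∀ x, Order.coheight (F.chartι K (zeroCone F) x) = 1 →
      Scheme.ord f (F.chartι K (zeroCone F) x) = 0) :
    ∃ m, ∀ r : F.Ray, Scheme.ord f (r.divisor K) = F.ordChar K (r.divisor K) m := by
  have := torusRing_ufd K F.lattice
  have := torus_isNoetherianRing (K := K) F
  have hne : ∀ {a}, a ≠ 0 → F.torusRat K a ≠ 0 := fun ha h0 =>
    ha (F.rat_injective (zeroCone F) (h0.trans (map_zero _).symm))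
  -- a prime factor of the numerator or the denominator would be a zero or a pole on the torus
  have key : ∀ a b : ChartRing K F.lattice ⊥, a ≠ 0 → IsRelPrime a b →
      (∀ x, Order.coheight (F.chartι K (zeroCone F) x) = 1 →
        Scheme.ord (F.torusRat K a) (F.chartι K (zeroCone F) x) =
          Scheme.ord (F.torusRat K b) (F.chartι K (zeroCone F) x)) → IsUnit a := by
    intro a b ha hab hord
    by_contra hu
    obtain ⟨q, hq, hqa⟩ := WfDvdMonoid.exists_irreducible_factor hu ha
    have hq' : Prime q := hq.prime
    let p : PrimeSpectrum (ChartRing K F.lattice ⊥) :=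
      ⟨Ideal.span {q}, (Ideal.span_singleton_prime hq'.ne_zero).2 hq'⟩
    have hp : Order.coheight (F.chartι K (zeroCone F) p) = 1 :=
      coheight_of_height_eq_one F (σ := zeroCone F) p
        (height_span_prime (R := ChartRing K F.lattice ⊥) hq')
    have h1 : 0 < Scheme.ord (F.torusRat K a) (F.chartι K (zeroCone F) p) :=
      ord_ratFun_pos (F.specι K (zeroCone F)) p hp rfl hq'.ne_zero ha
        (Ideal.mem_span_singleton.2 hqa)
    have h2 : Scheme.ord (F.torusRat K b) (F.chartι K (zeroCone F) p) = 0 :=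
      ord_ratFun_of_notMem (F.specι K (zeroCone F)) p fun hb =>
        hq'.not_isUnit (hab hqa (Ideal.mem_span_singleton.1 hb))
    rw [hord _ hp, h2] at h1
    exact lt_irrefl _ h1
  obtain ⟨a, b, hb, hfab⟩ := exists_ratFun_div (F.specι K (zeroCone F)) f
  have ha : a ≠ 0 := by
    rintro rfl
    exact hf (by rw [hfab, map_zero, zero_div])
  obtain ⟨a', b', c, hrel, hca, hcb⟩ :=
    UniqueFactorizationMonoid.exists_reduced_factors (R := ChartRing K F.lattice ⊥) a ha b
  have hc : c ≠ 0 := left_ne_zero_of_mul (hca.trans_ne ha)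
  have ha' : a' ≠ 0 := right_ne_zero_of_mul (hca.trans_ne ha)
  have hb' : b' ≠ 0 := right_ne_zero_of_mul (hcb.trans_ne hb)
  have hfb : F.torusRat K a' = f * F.torusRat K b' := by
    have h1 : f * F.torusRat K b = F.torusRat K a := by
      rw [hfab]
      exact div_mul_cancel₀ _ (hne hb)
    rw [← hca, ← hcb, map_mul, map_mul, mul_left_comm] at h1
    exact (mul_left_cancel₀ (hne hc) h1).symm
  have hord : ∀ y, Scheme.ord (F.torusRat K a') y =
      Scheme.ord f y + Scheme.ord (F.torusRat K b') y := fun y => by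
    rw [hfb, Scheme.ord_mul hf (hne hb')]
  have hord' : ∀ x, Order.coheight (F.chartι K (zeroCone F) x) = 1 →
      Scheme.ord (F.torusRat K a') (F.chartι K (zeroCone F) x) =
        Scheme.ord (F.torusRat K b') (F.chartι K (zeroCone F) x) := fun x hx => by
    rw [hord, h x hx, zero_add]
  obtain ⟨m, hm⟩ := F.ord_torusRat_of_isUnit (key a' b' ha' hrel hord')
  obtain ⟨n, hn⟩ := F.ord_torusRat_of_isUnit
    (key b' a' hb' hrel.symm fun x hx => (hord' x hx).symm)
  refine ⟨m - n, fun r => ?_⟩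
  have := hord (r.divisor K)
  rw [hm, hn] at this
  rw [map_sub]
  omega

/-- A point of codimension one of the torus is the divisor of a rational function on the torus. -/
theorem Fan.exists_ord_eq_single {x : chart K F.lattice (zeroCone F).1}
    (hx : Order.coheight (F.chartι K (zeroCone F) x) = 1) :
    ∃ f : (F.toricVariety K).functionField, f ≠ 0 ∧
      Scheme.ord f (F.chartι K (zeroCone F) x) = 1 ∧
      ∀ z, Order.coheight (F.chartι K (zeroCone F) z) = 1 → z ≠ x →
        Scheme.ord f (F.chartι K (zeroCone F) z) = 0 := by
  have := torusRing_ufd K F.lattice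
  let p : PrimeSpectrum (ChartRing K F.lattice ⊥) := x
  have hp : p.asIdeal.height = 1 := height_eq_one_of_coheight F (σ := zeroCone F) p hx
  have hp0 : p.asIdeal ≠ ⊥ := fun h => by
    rw [h, Ideal.height_bot] at hp
    exact zero_ne_one hp
  obtain ⟨q, hqp, hq⟩ := Ideal.IsPrime.exists_mem_prime_of_ne_bot p.2 hp0
  have hspan : ∀ z : PrimeSpectrum (ChartRing K F.lattice ⊥), z.asIdeal.height = 1 →
      q ∈ z.asIdeal → Ideal.span {q} = z.asIdeal := fun z hz hqz =>
    have : (Ideal.span {q}).IsPrime := (Ideal.span_singleton_prime hq.ne_zero).2 hq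
    eq_of_le_of_height_eq_one ((Ideal.span_singleton_le_iff_mem _).2 hqz)
      (fun h => hq.ne_zero (Ideal.span_singleton_eq_bot.1 h)) hz
  refine ⟨F.torusRat K q, fun h0 => hq.ne_zero
    (F.rat_injective (zeroCone F) (h0.trans (map_zero _).symm)), ?_, fun z hz hzx => ?_⟩
  · exact ord_ratFun_of_span (F.specι K (zeroCone F)) p hx (hspan p hp hqp).symm hq.ne_zero
  · let z' : PrimeSpectrum (ChartRing K F.lattice ⊥) := z
    refine ord_ratFun_of_notMem (F.specι K (zeroCone F)) z' fun hqz => hzx ?_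
    have h1 := hspan z' (height_eq_one_of_coheight F (σ := zeroCone F) z' hz) hqz
    exact PrimeSpectrum.ext (h1.symm.trans (hspan p hp hqp))

end CharacterDivisors

/-! ### The class group of a toric variety -/

section ClassGroup

variable {K : Type u} [Field K] {V : Type u} [NormedAddCommGroup V] [NormedSpace ℝ V]
  [FiniteDimensional ℝ V] (F : Fan V)

variable (K) in
/-- The torus-invariant divisor `∑ a_r D_r`. -/
noncomputable def Fan.invDivisor : (F.Ray →₀ ℤ) →+ WeilDivisor (F.toricVariety K) :=
  (Finsupp.mapDomain.addMonoidHom (fun r : F.Ray => r.divisor K)).codRestrict _ fun a y hy => by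
    by_contra h
    refine hy (Finsupp.mapDomain_of_notMem_range _ _ ?_)
    rintro ⟨r, rfl⟩
    exact h (r.coheight_divisor K)

theorem Fan.invDivisor_divisor (a : F.Ray →₀ ℤ) (r : F.Ray) :
    (F.invDivisor K a).1 (r.divisor K) = a r :=
  Finsupp.mapDomain_apply (Fan.Ray.divisor_injective F) a r

theorem Fan.invDivisor_of_ne (a : F.Ray →₀ ℤ) {y : F.toricVariety K}
    (h : ∀ r : F.Ray, y ≠ r.divisor K) : (F.invDivisor K a).1 y = 0 :=
  Finsupp.mapDomain_of_notMem_range _ _ (by rintro ⟨r, hr⟩; exact h r hr.symm)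

variable (K) in
/-- The homomorphism `ℤ^n → Cl(Y)`, `e_r ↦ [D_r]`. -/
noncomputable def Fan.invClass : (F.Ray →₀ ℤ) →+ Cl (F.toricVariety K) :=
  (QuotientAddGroup.mk' (principalDivisors (F.toricVariety K))).comp (F.invDivisor K)

theorem Fan.invClass_single (r : F.Ray) : F.invClass K (Finsupp.single r 1) =
    primeDivisorClass (r.divisor K) (r.coheight_divisor K) := by
  refine congrArg QuotientAddGroup.mk (Subtype.ext ?_)
  exact Finsupp.mapDomain_single

/-- The order at a point, as a homomorphism on nonzero rational functions. -/
noncomputable def ordUnits {X : Scheme.{u}} [IsIntegral X] [IsLocallyNoetherian X] (x : X) :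
    Additive X.functionFieldˣ →+ ℤ :=
  AddMonoidHom.mk' (fun f => Scheme.ord (f.toMul : X.functionField) x) fun f g =>
    Scheme.ord_mul f.toMul.ne_zero g.toMul.ne_zero

/-- The torus-invariant divisors generate the class group, as every point of codimension one of
the torus is principal. -/
theorem Fan.invClass_surjective : Function.Surjective (F.invClass K) := by
  classical
  intro D
  obtain ⟨D, rfl⟩ := QuotientAddGroup.mk_surjective D
  let T : Finset (F.toricVariety K) :=
    D.1.support.filter fun y => y ∈ Set.range (F.chartι K (zeroCone F))
  have hex : ∀ y : F.toricVariety K, ∃ f : (F.toricVariety K).functionFieldˣ, y ∈ T →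
      ∀ z, Order.coheight (F.chartι K (zeroCone F) z) = 1 →
        ordUnits (F.chartι K (zeroCone F) z) (Additive.ofMul f) =
          if F.chartι K (zeroCone F) z = y then 1 else 0 := by
    intro y
    by_cases hy : y ∈ T
    · obtain ⟨hD, x, rfl⟩ := Finset.mem_filter.1 hy
      obtain ⟨f, hf, h1, h0⟩ := F.exists_ord_eq_single (D.2 _ (Finsupp.mem_support_iff.1 hD))
      refine ⟨Units.mk0 f hf, fun _ z hz => ?_⟩
      split_ifs with h
      · rw [h]
        exact h1
      · exact h0 z hz fun hzx => h (by rw [hzx])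
    · exact ⟨1, fun h => (hy h).elim⟩
  choose g hg using hex
  let f : Additive (F.toricVariety K).functionFieldˣ := ∑ y ∈ T, D.1 y • Additive.ofMul (g y)
  have hf : ∀ z, Order.coheight (F.chartι K (zeroCone F) z) = 1 →
      ordUnits (F.chartι K (zeroCone F) z) f = D.1 (F.chartι K (zeroCone F) z) := by
    intro z hz
    rw [map_sum, Finset.sum_congr rfl fun y hy => by
      rw [map_zsmul, hg y hy z hz, smul_eq_mul, mul_ite, mul_one, mul_zero], Finset.sum_ite_eq]
    refine ite_eq_left_iff.2 fun h => ?_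
    by_contra h0
    exact h (Finset.mem_filter.2 ⟨Finsupp.mem_support_iff.2 (Ne.symm h0), z, rfl⟩)
  refine ⟨Finsupp.equivFunOnFinite.symm fun r =>
    D.1 (r.divisor K) - ordUnits (r.divisor K) f, QuotientAddGroup.eq.2 ?_⟩
  refine ⟨(f.toMul : (F.toricVariety K).functionField), f.toMul.ne_zero, fun y => ?_⟩
  change -((F.invDivisor K _).1 y) + D.1 y = _
  by_cases hy : Order.coheight y = 1
  · rcases F.exists_of_coheight_eq_one hy with ⟨x, rfl⟩ | ⟨r, rfl⟩
    · rw [F.invDivisor_of_ne _ fun r => r.divisor_ne_torus F x, neg_zero, zero_add]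
      exact (hf x hy).symm
    · rw [F.invDivisor_divisor, Finsupp.equivFunOnFinite_symm_apply_apply, neg_sub, sub_add_cancel]
      rfl
  · rw [Scheme.ord_eq_zero_of_coheight_neq_one hy, F.invDivisor_of_ne, neg_zero, zero_add]
    · by_contra h
      exact hy (D.2 y h)
    · rintro r rfl
      exact hy (r.coheight_divisor K)

/-- The divisor of a character. -/
noncomputable def Fan.charDivisor (m : dualLattice F.lattice) : F.Ray →₀ ℤ :=
  Finsupp.equivFunOnFinite.symm fun r => pairing F.lattice ⟨r.gen, r.gen_mem⟩ m

theorem Fan.ord_charFun_divisor (m : dualLattice F.lattice) (r : F.Ray) :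
    Scheme.ord (F.charFun K m) (r.divisor K) = F.charDivisor m r := by
  have h := F.ordChar_divisor (K := K) r m
  rw [← pairing_cast ⟨r.gen, r.gen_mem⟩ m] at h
  exact_mod_cast h

theorem Fan.invClass_charDivisor (m : dualLattice F.lattice) :
    F.invClass K (F.charDivisor m) = 0 := by
  refine (QuotientAddGroup.eq_zero_iff _).2 ⟨F.charFun K m, F.charFun_ne_zero m, fun y => ?_⟩
  by_cases hy : Order.coheight y = 1
  · rcases F.exists_of_coheight_eq_one hy with ⟨x, rfl⟩ | ⟨r, rfl⟩
    · rw [F.invDivisor_of_ne _ fun r => r.divisor_ne_torus F x]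
      exact (F.ordChar_torus x m).symm
    · rw [F.invDivisor_divisor, F.ord_charFun_divisor]
  · rw [Scheme.ord_eq_zero_of_coheight_neq_one hy, F.invDivisor_of_ne]
    rintro r rfl
    exact hy (r.coheight_divisor K)

theorem Fan.exists_charDivisor_eq {a : F.Ray →₀ ℤ} (h : F.invClass K a = 0) :
    ∃ m, F.charDivisor m = a := by
  obtain ⟨f, hf, hord⟩ := (QuotientAddGroup.eq_zero_iff _).1 h
  obtain ⟨m, hm⟩ := F.exists_ord_eq_ordChar hf fun x hx => by
    rw [← hord, F.invDivisor_of_ne _ fun r => r.divisor_ne_torus F x]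
  refine ⟨m, Finsupp.ext fun r => ?_⟩
  rw [← F.ord_charFun_divisor (K := K), ← F.ordChar_apply, ← hm, ← hord, F.invDivisor_divisor]

/-- The homomorphisms from the class group to `ℤ` are the linear relations between the integral
generators of the rays. -/
theorem Fan.exists_hom_cl_iff [Fintype F.Ray] (a : F.Ray → ℤ) :
    (∃ ψ : Cl (F.toricVariety K) →+ ℤ,
      ∀ r : F.Ray, ψ (primeDivisorClass (r.divisor K) (r.coheight_divisor K)) = a r) ↔
      ∑ r, a r • r.gen = 0 := by
  let Ψ : (F.Ray →₀ ℤ) →+ ℤ := Finsupp.liftAddHom fun r => (a r) • AddMonoidHom.id ℤ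
  have hΨ : ∀ r, Ψ (Finsupp.single r 1) = a r := fun r => by simp [Ψ]
  have hchar : ∀ m, (Ψ (F.charDivisor m) : ℝ) = m.1 (∑ r, a r • r.gen) := by
    intro m
    have h1 : Ψ (F.charDivisor m) = ∑ r, a r * F.charDivisor m r := by
      simp only [Ψ, Finsupp.liftAddHom_apply]
      rw [Finsupp.sum_fintype _ _ (fun r => by simp)]
      simp
    rw [h1, map_sum]
    push_cast
    refine Finset.sum_congr rfl fun r _ => ?_
    rw [map_zsmul, zsmul_eq_mul]
    congr 1
    exact pairing_cast ⟨r.gen, r.gen_mem⟩ m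
  constructor
  · rintro ⟨ψ, hψ⟩
    refine eq_zero_of_forall_dualLattice (N := F.lattice) fun m hm => ?_
    have h2 : ψ.comp (F.invClass K) = Ψ := Finsupp.addHom_ext' fun r => AddMonoidHom.ext_int (by
      change ψ (F.invClass K (Finsupp.single r 1)) = Ψ (Finsupp.single r 1)
      rw [F.invClass_single, hψ, hΨ])
    rw [← hchar ⟨m, hm⟩, ← h2, AddMonoidHom.comp_apply, F.invClass_charDivisor, map_zero,
      Int.cast_zero]
  · intro h
    have hker : (F.invClass K).ker ≤ Ψ.ker := by
      intro x hx
      obtain ⟨m, rfl⟩ := F.exists_charDivisor_eq hx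
      have := hchar m
      rw [h, map_zero] at this
      exact_mod_cast this
    refine ⟨(F.invClass K).liftOfSurjective F.invClass_surjective ⟨Ψ, hker⟩, fun r => ?_⟩
    rw [← F.invClass_single, ← hΨ]
    exact AddMonoidHom.liftOfRightInverse_comp_apply _ _ _ ⟨Ψ, hker⟩ _

end ClassGroup

/-! ### The rays of a complete fan with torsion-free class group generate the lattice -/

section GlobalFunctions

/-- Global functions on a complete integral scheme over an algebraically closed field are
constant. The function is given as the pullback of `b` along a morphism `g` to an affine scheme, and
its value on a chart `Spec R` is expressed by `ψ`. -/
theorem exists_algebraMap_eq_of_universallyClosed {K : Type u} [Field K] [IsAlgClosed K]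
    {Y : Scheme.{u}} [IsIntegral Y] (f : Y ⟶ Spec (.of K)) [UniversallyClosed f]
    {R : CommRingCat.{u}} (i : Spec R ⟶ Y) (φ : CommRingCat.of K ⟶ R)
    (hφ : i ≫ f = Spec.map φ) (B : CommRingCat.{u}) (g : Y ⟶ Spec B) (ψ : B ⟶ R)
    (hψ : i ≫ g = Spec.map ψ) (b : B) : ∃ c : K, ψ.hom b = φ.hom c := by
  let G := (Scheme.ΓSpecIso (.of K)).inv ≫ f.appTop
  have hG : G.hom.IsIntegral := by
    apply RingHom.isIntegral_respectsIso.2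
      (e := (Scheme.ΓSpecIso (.of K)).symm.commRingCatIsoToRingEquiv)
    exact isIntegral_appTop_of_universallyClosed f
  obtain ⟨c, hc⟩ := (IsAlgClosed.ringHom_bijective_of_isIntegral (k := K) G.hom hG).2
    (((Scheme.ΓSpecIso B).inv ≫ g.appTop).hom b)
  refine ⟨c, ?_⟩
  have key : ∀ {A : CommRingCat.{u}} (h : Y ⟶ Spec A) (χ : A ⟶ R) (_ : i ≫ h = Spec.map χ),
      (Scheme.ΓSpecIso A).inv ≫ h.appTop ≫ i.appTop ≫ (Scheme.ΓSpecIso R).hom = χ := by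
    intro A h χ e
    rw [← Category.assoc h.appTop, ← Scheme.Hom.comp_appTop, e, Scheme.ΓSpecIso_naturality,
      Iso.inv_hom_id_assoc]
  have h1 := congrArg (fun φ => φ.hom b) (key g ψ hψ)
  have h2 := congrArg (fun φ => φ.hom c) (key f φ hφ)
  have h3 := congrArg (fun x => (i.appTop ≫ (Scheme.ΓSpecIso R).hom).hom x) hc
  exact h1.symm.trans (h3.symm.trans h2)

variable {K : Type u} [Field K] {V : Type u} [NormedAddCommGroup V] [NormedSpace ℝ V]
  [FiniteDimensional ℝ V] (F : Fan V)

variable (K) in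
/-- The global function `χ^m` for a character `m` that is nonnegative on all cones, as a morphism
to the affine line. -/
noncomputable def Fan.globalChar (m : Module.Dual ℝ V)
    (h : ∀ σ ∈ F.cones, m ∈ dualMonoid F.lattice σ) :
    F.toricVariety K ⟶ Spec (.of (Polynomial K)) :=
  colimit.desc (chartDiagram K F.lattice F.cones)
    { pt := Spec (.of (Polynomial K))
      ι :=
        { app := fun σ => Spec.map (CommRingCat.ofHom
            (Polynomial.aeval (chi K F.lattice σ.1 ⟨m, h σ.1 σ.2⟩)).toRingHom)
          naturality := fun τ σ f => by
            change Spec.map _ ≫ Spec.map _ = Spec.map _ ≫ 𝟙 _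
            rw [Category.comp_id, ← Spec.map_comp, ← CommRingCat.ofHom_comp]
            congr 2
            refine Polynomial.ringHom_ext (fun a => ?_) ?_
            · change chartMap K (le_refl F.lattice) (leOfHom f)
                (Polynomial.aeval _ (Polynomial.C a)) =
                Polynomial.aeval _ (Polynomial.C a)
              rw [Polynomial.aeval_C, Polynomial.aeval_C, AlgHom.commutes]
            · change chartMap K (le_refl F.lattice) (leOfHom f) (Polynomial.aeval _ Polynomial.X) =
                Polynomial.aeval _ Polynomial.X
              rw [Polynomial.aeval_X, Polynomial.aeval_X, chi, chartMap_single]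
              rfl } }

/-- The rays of a complete fan are not contained in a rational hyperplane: a character vanishing
on them would be a nonconstant global function. -/
theorem Fan.eq_zero_of_forall_ray [IsAlgClosed K] [IsProper (F.structureMorphism K)]
    {m : Module.Dual ℝ V} (hm : m ∈ dualLattice F.lattice) (h : ∀ r : F.Ray, m r.gen = 0) :
    m = 0 := by
  have hmem : ∀ σ ∈ F.cones, m ∈ dualMonoid F.lattice σ := by
    refine fun σ hσ => ⟨hm, fun v hv => le_of_eq ?_⟩
    by_contra h0
    obtain ⟨r, -, hr⟩ := exists_ray_apply_ne_zero F hσ hm ⟨v, hv, Ne.symm h0⟩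
    exact hr (h r)
  obtain ⟨σ, hσ⟩ := F.nonempty
  obtain ⟨c, hc⟩ := exists_algebraMap_eq_of_universallyClosed (F.structureMorphism K)
    (F.specι K ⟨σ, hσ⟩) (CommRingCat.ofHom (algebraMap K (ChartRing K F.lattice σ)))
    (colimit.ι_desc _ _) _ (F.globalChar K m hmem)
    (CommRingCat.ofHom (Polynomial.aeval (chi K F.lattice σ ⟨m, hmem σ hσ⟩)).toRingHom)
    (colimit.ι_desc _ _) Polynomial.X
  have h1 : chi K F.lattice σ ⟨m, hmem σ hσ⟩ = algebraMap K (ChartRing K F.lattice σ) c :=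
    (Polynomial.aeval_X _).symm.trans hc
  have h2 : (AddMonoidAlgebra.single ⟨m, hmem σ hσ⟩ 1 : ChartRing K F.lattice σ) =
    AddMonoidAlgebra.single 0 c := h1
  rcases AddMonoidAlgebra.single_inj.1 h2 with h3 | h3
  · exact congrArg Subtype.val h3.1
  · exact (one_ne_zero h3.1).elim

end GlobalFunctions

section Generation

variable {V : Type u} [NormedAddCommGroup V] [NormedSpace ℝ V] (F : Fan V)

/-- The subgroup generated by the integral generators of the rays. -/
def Fan.raySpan : Submodule ℤ V := Submodule.span ℤ (Set.range fun r : F.Ray => r.gen)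

theorem Fan.gen_mem_raySpan (r : F.Ray) : r.gen ∈ F.raySpan := Submodule.subset_span ⟨r, rfl⟩

theorem Fan.raySpan_le : F.raySpan ≤ F.lattice :=
  Submodule.span_le.2 (by rintro _ ⟨r, rfl⟩; exact r.gen_mem)

theorem apply_eq_zero_of_mem_raySpan {m : Module.Dual ℝ V} (h : ∀ r : F.Ray, m r.gen = 0) {v : V}
    (hv : v ∈ F.raySpan) : m v = 0 := by
  have h1 : F.raySpan ≤ LinearMap.ker (m.restrictScalars ℤ) :=
    Submodule.span_le.2 (by rintro _ ⟨r, rfl⟩; exact h r)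
  exact h1 hv

variable [FiniteDimensional ℝ V]

theorem Fan.relIndex_ne_zero_of_torsion {N' : Submodule ℤ V}
    (h : ∀ v ∈ F.lattice, ∃ k : ℤ, k ≠ 0 ∧ k • v ∈ N') :
    N'.toAddSubgroup.relIndex F.lattice.toAddSubgroup ≠ 0 := by
  have : Module.Finite ℤ F.lattice := ZLattice.module_finite ℝ F.lattice
  have ht : Module.IsTorsion ℤ (F.lattice ⧸ N'.comap F.lattice.subtype) := by
    intro x
    obtain ⟨v, rfl⟩ := Submodule.Quotient.mk_surjective _ x
    obtain ⟨k, hk, hv⟩ := h v v.2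
    refine ⟨⟨k, mem_nonZeroDivisors_of_ne_zero hk⟩, ?_⟩
    exact (Submodule.Quotient.mk_eq_zero _).2 hv
  have hfin := Module.finite_of_fg_torsion _ ht
  have : Finite (F.lattice.toAddSubgroup ⧸
    N'.toAddSubgroup.addSubgroupOf F.lattice.toAddSubgroup) := hfin
  have : (N'.toAddSubgroup.addSubgroupOf F.lattice.toAddSubgroup).FiniteIndex :=
    AddSubgroup.finiteIndex_of_finite_quotient
  exact this.index_ne_zero

/-- A homomorphism from `N` to `ℤ` is an element of the dual lattice. -/
theorem exists_dualLattice_eq {N : Submodule ℤ V} [DiscreteTopology N] [IsZLattice ℝ N]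
    (φ : N →ₗ[ℤ] ℤ) : ∃ m ∈ dualLattice N, ∀ v : N, m v.1 = φ v := by
  obtain ⟨m, hm⟩ := exists_dual_extension (N := N)
    ((Int.castAddHom ℝ).comp φ.toAddMonoidHom)
  exact ⟨m, fun v hv => ⟨φ ⟨v, hv⟩, hm ⟨v, hv⟩⟩, hm⟩

/-- The rays of a complete fan generate a sublattice of finite index: otherwise there would be a
nonzero homomorphism `N → ℤ` vanishing on them. -/
theorem Fan.exists_smul_mem_raySpan (K : Type u) [Field K] [IsAlgClosed K]
    [IsProper (F.structureMorphism K)] {v : V}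
    (hv : v ∈ F.lattice) : ∃ k : ℤ, k ≠ 0 ∧ k • v ∈ F.raySpan := by
  have : Module.Finite ℤ F.lattice := ZLattice.module_finite ℝ F.lattice
  let S := F.raySpan.comap F.lattice.subtype
  let Q := (F.lattice ⧸ S) ⧸ Submodule.torsion ℤ (F.lattice ⧸ S)
  have : Module.Free ℤ Q := inferInstance
  have h0 : Submodule.Quotient.mk (p := Submodule.torsion ℤ (F.lattice ⧸ S))
      (Submodule.Quotient.mk (p := S) ⟨v, hv⟩) = 0 := by
    refine (Module.forall_dual_apply_eq_zero_iff ℤ _).1 fun f => ?_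
    obtain ⟨m, hm, hmf⟩ := exists_dualLattice_eq
      (f.comp ((Submodule.mkQ (Submodule.torsion ℤ (F.lattice ⧸ S))).comp (Submodule.mkQ S)))
    have hm0 : m = 0 := F.eq_zero_of_forall_ray (K := K) hm fun r => by
      have hr : Submodule.mkQ S ⟨r.gen, r.gen_mem⟩ = 0 :=
        (Submodule.Quotient.mk_eq_zero S).2 (F.gen_mem_raySpan r)
      rw [hmf ⟨r.gen, r.gen_mem⟩, LinearMap.comp_apply, LinearMap.comp_apply, hr, map_zero,
        map_zero, Int.cast_zero]
    have := hmf ⟨v, hv⟩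
    rw [hm0, LinearMap.zero_apply] at this
    exact_mod_cast this.symm
  obtain ⟨k, hk⟩ := (Submodule.mem_torsion_iff _).1 ((Submodule.Quotient.mk_eq_zero _).1 h0)
  exact ⟨k, nonZeroDivisors.ne_zero k.2, (Submodule.Quotient.mk_eq_zero S).1 hk⟩

/-- If the class group is torsion-free, the rays generate the lattice: a form `m` that is integral
on the rays has a multiple in `M`, so that `∑ m(r) D_r` is a torsion class, hence is the divisor of
a character, which has to be `m`. -/
theorem Fan.raySpan_eq (K : Type u) [Field K] [IsAlgClosed K]
    [IsProper (F.structureMorphism K)] (ht : IsAddTorsionFree (Cl (F.toricVariety K))) :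
    F.raySpan = F.lattice := by
  let L : F.Sublattice := ⟨F.raySpan, F.raySpan_le,
    F.relIndex_ne_zero_of_torsion fun v hv => F.exists_smul_mem_raySpan K hv⟩
  have : DiscreteTopology F.raySpan := L.discreteTopology
  have : IsZLattice ℝ F.raySpan := L.fan.isZLattice
  obtain ⟨e, he0, he⟩ := L.exists_smul_mem
  refine le_antisymm F.raySpan_le fun v hv => mem_lattice_of_forall_dualLattice fun m hm => ?_
  have hem : e • m ∈ dualLattice F.lattice := fun w hw => by
    obtain ⟨k, hk⟩ := hm _ (he w hw)
    exact ⟨k, by rw [← hk, map_nsmul]; rfl⟩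
  let a : F.Ray →₀ ℤ := Finsupp.equivFunOnFinite.symm fun r =>
    pairing F.raySpan ⟨r.gen, F.gen_mem_raySpan r⟩ ⟨m, hm⟩
  have ha : ∀ r, (a r : ℝ) = m r.gen := fun r => pairing_cast _ _
  have hchar : ∀ (m' : dualLattice F.lattice) r, (F.charDivisor m' r : ℝ) = m'.1 r.gen :=
    fun m' r => pairing_cast _ _
  have hea : e • a = F.charDivisor ⟨_, hem⟩ := Finsupp.ext fun r => by
    have : ((e • a) r : ℝ) = F.charDivisor ⟨_, hem⟩ r := by
      rw [hchar, Finsupp.smul_apply, nsmul_eq_mul]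
      push_cast
      rw [ha]
      simp
    exact_mod_cast this
  have h0 : F.invClass K a = 0 := by
    refine nsmul_right_injective he0 ?_
    change e • F.invClass K a = e • 0
    rw [← map_nsmul, hea, F.invClass_charDivisor, smul_zero]
  obtain ⟨m', hm'⟩ := F.exists_charDivisor_eq h0
  have hmm : m = m'.1 := dual_ext_of_lattice (N := F.raySpan) fun w hw => by
    rw [← sub_eq_zero, ← LinearMap.sub_apply]
    refine apply_eq_zero_of_mem_raySpan F (fun r => ?_) hw
    rw [LinearMap.sub_apply, ← ha, ← hchar, hm', sub_self]
  rw [hmm]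
  exact m'.2 v hv

end Generation

/-! ### Stalk maps of morphisms given by ring homomorphisms on charts -/

section StalksOnCharts

variable {X Y : Scheme.{u}} {R S : CommRingCat.{u}} (f : X ⟶ Y) (i : Spec R ⟶ Y)
  [IsOpenImmersion i] (j : Spec S ⟶ X) [IsOpenImmersion j]

/-- The homomorphism from the coordinate ring of a chart to the local ring at a point `y` of the
chart. -/
noncomputable def toStalk {y : Y} (hy : y ∈ i ''ᵁ ⊤) : R ⟶ Y.presheaf.stalk y :=
  sectionOf i ≫ Y.presheaf.germ _ y hy

theorem maximalIdeal_eq_span_toStalk {y : Y} (hy : y ∈ i ''ᵁ ⊤) (p : PrimeSpectrum R)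
    (h : i p = y) {t : R} (ht : p.asIdeal = Ideal.span {t}) :
    IsLocalRing.maximalIdeal (Y.presheaf.stalk y) = Ideal.span {(toStalk i hy).hom t} := by
  subst h
  exact maximalIdeal_stalk_eq_span i p ht

theorem toStalk_formallyUnramified {y : Y} (hy : y ∈ i ''ᵁ ⊤) :
    (toStalk i hy).hom.FormallyUnramified := by
  refine RingHom.FormallyUnramified.comp
    (RingHom.FormallyUnramified.of_surjective (sectionOf_bijective i).2) ?_
  let := TopCat.Presheaf.algebra_section_stalk Y.presheaf (⟨y, hy⟩ : (i ''ᵁ ⊤ : Y.Opens))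
  have hU : IsAffineOpen (i ''ᵁ ⊤) := (isAffineOpen_top _).image_of_isOpenImmersion i
  have hloc := hU.isLocalization_stalk ⟨y, hy⟩
  exact Algebra.FormallyUnramified.of_isLocalization
    (hU.primeIdealOf ⟨y, hy⟩).asIdeal.primeCompl

variable {f i j}

theorem sectionOf_appLE {φ : R ⟶ S} (h : j ≫ f = Spec.map φ ≫ i)
    (hle : j ''ᵁ ⊤ ≤ f ⁻¹ᵁ (i ''ᵁ ⊤)) :
    sectionOf i ≫ f.appLE (i ''ᵁ ⊤) (j ''ᵁ ⊤) hle = φ ≫ sectionOf j := by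
  rw [← cancel_mono (j.appIso ⊤).hom]
  have h1 : f.appLE (i ''ᵁ ⊤) (j ''ᵁ ⊤) hle ≫ (j.appIso ⊤).hom =
      (i.appIso ⊤).hom ≫ (Spec.map φ).appTop := by
    rw [Scheme.Hom.appIso_hom', Scheme.Hom.appIso_hom', Scheme.Hom.appTop,
      Scheme.Hom.app_eq_appLE, Scheme.Hom.appLE_comp_appLE]
    have h2 : ∀ {g g' : Spec S ⟶ Y} (_ : g = g') {U : Y.Opens} {W : (Spec S).Opens} (e e'),
        g.appLE U W e = g'.appLE U W e' := by
      rintro g _ rfl U W e e'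
      rfl
    exact (h2 h _ _).trans (Scheme.Hom.appLE_comp_appLE _ _ _ _ _ _ _).symm
  rw [Category.assoc, h1, sectionOf, sectionOf, Category.assoc, Iso.inv_hom_id_assoc,
    Category.assoc, Category.assoc, Iso.inv_hom_id, Category.comp_id]
  exact (Scheme.ΓSpecIso_inv_naturality φ).symm

theorem toStalk_stalkMap {φ : R ⟶ S} (h : j ≫ f = Spec.map φ ≫ i) {x : X} (hx : x ∈ j ''ᵁ ⊤)
    (hy : f x ∈ i ''ᵁ ⊤) : toStalk i hy ≫ f.stalkMap x = φ ≫ toStalk j hx := by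
  have hle : j ''ᵁ ⊤ ≤ f ⁻¹ᵁ (i ''ᵁ ⊤) := by
    rintro _ ⟨z, -, rfl⟩
    refine ⟨Spec.map φ z, trivial, ?_⟩
    exact (congrArg (fun g : Spec S ⟶ Y => g z) h).symm
  rw [toStalk, toStalk, ← Category.assoc φ, ← sectionOf_appLE h hle, Category.assoc,
    Scheme.Hom.germ_stalkMap, Scheme.Hom.appLE, Category.assoc, Category.assoc,
    TopCat.Presheaf.germ_res]

/-- A morphism that is given on charts by a formally unramified ring homomorphism has formally
unramified stalk maps. -/
theorem stalkMap_formallyUnramified {φ : R ⟶ S} (h : j ≫ f = Spec.map φ ≫ i)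
    (hφ : φ.hom.FormallyUnramified) {x : X} (hx : x ∈ j ''ᵁ ⊤) (hy : f x ∈ i ''ᵁ ⊤) :
    (f.stalkMap x).hom.FormallyUnramified := by
  have h1 : ((f.stalkMap x).hom.comp (toStalk i hy).hom).FormallyUnramified := by
    have h2 := congrArg (fun χ => χ.hom) (toStalk_stalkMap h hx hy)
    have h3 : (f.stalkMap x).hom.comp (toStalk i hy).hom = (toStalk j hx).hom.comp φ.hom := h2
    rw [h3]
    exact RingHom.FormallyUnramified.comp hφ (toStalk_formallyUnramified j hx)
  exact RingHom.FormallyUnramified.of_comp h1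

/-- If the local rings at `f x` and `x` have uniformizers `t` and `t'` on the charts and `t` is
`t' ^ e` up to a unit, then the ramification order at `x` is `e`. -/
theorem map_maximalIdeal_stalkMap {φ : R ⟶ S} (h : j ≫ f = Spec.map φ ≫ i) {x : X}
    (p : PrimeSpectrum S) (hp : j p = x) (q : PrimeSpectrum R) (hq : i q = f x) {t : R} {t' u : S}
    (ht : q.asIdeal = Ideal.span {t}) (ht' : p.asIdeal = Ideal.span {t'}) {e : ℕ}
    (hu : IsUnit u) (htt : φ.hom t = t' ^ e * u) :
    (IsLocalRing.maximalIdeal (Y.presheaf.stalk (f x))).map (f.stalkMap x).hom =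
      IsLocalRing.maximalIdeal (X.presheaf.stalk x) ^ e := by
  have hx : x ∈ j ''ᵁ ⊤ := hp ▸ mem_image_top j p
  have hy : f x ∈ i ''ᵁ ⊤ := hq ▸ mem_image_top i q
  have h1 : (f.stalkMap x).hom ((toStalk i hy).hom t) = (toStalk j hx).hom (φ.hom t) :=
    congrArg (fun χ => χ.hom t) (toStalk_stalkMap h hx hy)
  rw [maximalIdeal_eq_span_toStalk i hy q hq ht, maximalIdeal_eq_span_toStalk j hx p hp ht',
    Ideal.map_span, Set.image_singleton, h1, htt, map_mul, map_pow, Ideal.span_singleton_pow,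
    Ideal.span_singleton_mul_right_unit (hu.map _)]

/-- The powers of the maximal ideal of the local ring at a point with a uniformizer are distinct. -/
theorem maximalIdeal_pow_injective [IsIntegral Y] {y : Y} (p : PrimeSpectrum R) (h : i p = y)
    {t : R} (ht : p.asIdeal = Ideal.span {t}) (ht0 : t ≠ 0) :
    Function.Injective fun n : ℕ => IsLocalRing.maximalIdeal (Y.presheaf.stalk y) ^ n := by
  have hy : y ∈ i ''ᵁ ⊤ := h ▸ mem_image_top i p
  have h1 := maximalIdeal_eq_span_toStalk i hy p h ht
  have h0 : (toStalk i hy).hom t ≠ 0 := by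
    intro h0
    have : Y.presheaf.germ _ y hy (sectionOf i t) = 0 := h0
    have h2 : sectionOf i t = 0 :=
      germ_injective_of_isIntegral Y y hy (this.trans (map_zero _).symm)
    exact ht0 ((sectionOf_bijective i).1 (h2.trans (map_zero _).symm))
  have hn : ¬ IsUnit ((toStalk i hy).hom t) := by
    rw [← mem_nonunits_iff, ← IsLocalRing.mem_maximalIdeal, h1]
    exact Ideal.mem_span_singleton_self _
  intro a b hab
  change _ ^ a = _ ^ b at hab
  rw [h1, Ideal.span_singleton_pow, Ideal.span_singleton_pow] at hab
  exact le_antisymm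
    ((pow_dvd_pow_iff h0 hn).1 (Ideal.span_singleton_le_span_singleton.1 hab.ge))
    ((pow_dvd_pow_iff h0 hn).1 (Ideal.span_singleton_le_span_singleton.1 hab.le))

end StalksOnCharts

/-! ### Ramification of toric covers -/

section Unramified

variable {K : Type u} [Field K] {V : Type u} [NormedAddCommGroup V] [NormedSpace ℝ V] {F : Fan V}

variable (K) in
/-- An isogeny of tori of degree prime to the characteristic is unramified, as
`e χ^{(e - 1) m} dχ^m = dχ^{e m} = 0` for a character `m` of `N'`. -/
theorem chartMap_formallyUnramified {N N' : Submodule ℤ V} (h : N' ≤ N) {e : ℕ} (hK : (e : K) ≠ 0)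
    (he : ∀ v ∈ N, e • v ∈ N') :
    (chartMap K h (le_refl (⊥ : PointedCone ℝ V))).toRingHom.FormallyUnramified := by
  let := (chartMap K h (le_refl (⊥ : PointedCone ℝ V))).toRingHom.toAlgebra
  change Algebra.FormallyUnramified (ChartRing K N ⊥) (ChartRing K N' ⊥)
  have halg : ∀ x, algebraMap (ChartRing K N ⊥) (ChartRing K N' ⊥) x =
    chartMap K h (le_refl _) x := fun _ => rfl
  let D := KaehlerDifferential.D (ChartRing K N ⊥) (ChartRing K N' ⊥)
  have hchi : ∀ m : dualMonoid N' (⊥ : PointedCone ℝ V), D (chi K N' ⊥ m) = 0 := by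
    intro m
    have h1 : D (chi K N' ⊥ m ^ e) = 0 := by
      rw [chi_pow_eq_chartMap K h he m, ← halg]
      exact D.map_algebraMap _
    rw [Derivation.leibniz_pow, ← Nat.cast_smul_eq_nsmul (ChartRing K N' ⊥), smul_smul] at h1
    have h2 : IsUnit ((e : ChartRing K N' ⊥) * chi K N' ⊥ m ^ (e - 1)) := by
      refine IsUnit.mul ?_ (IsUnit.pow _ (isUnit_torusChi K ⟨m.1, m.2.1⟩))
      have h3 := (IsUnit.mk0 _ hK).map (algebraMap K (ChartRing K N' ⊥))
      rwa [map_natCast] at h3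
    obtain ⟨w, hw⟩ := h2
    rw [← hw] at h1
    exact (smul_eq_zero_iff_eq w).1 h1
  have hD : ∀ x, D x = 0 := by
    intro x
    induction x using AddMonoidAlgebra.induction_linear with
    | zero => exact map_zero _
    | add x y hx hy => rw [map_add, hx, hy, add_zero]
    | single m a =>
      have h2 : (AddMonoidAlgebra.single m a : ChartRing K N' ⊥) =
          algebraMap (ChartRing K N ⊥) _ (AddMonoidAlgebra.single 0 a) * chi K N' ⊥ m := by
        rw [halg, chartMap_single, chi, AddMonoidAlgebra.single_mul_single, mul_one, map_zero,
          zero_add]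
      rw [h2, Derivation.leibniz, hchi, D.map_algebraMap, smul_zero, smul_zero, add_zero]
  refine ⟨subsingleton_of_forall_eq 0 fun ω => ?_⟩
  have hω : ω ∈ Submodule.span (ChartRing K N' ⊥) (Set.range D) := by
    rw [KaehlerDifferential.span_range_derivation]
    trivial
  refine (Submodule.mem_bot (ChartRing K N' ⊥)).1 (Submodule.span_le.2 ?_ hω)
  rintro _ ⟨x, rfl⟩
  exact hD x

theorem Fan.Sublattice.stalkMap_formallyUnramified [FiniteDimensional ℝ V] (L : F.Sublattice)
    {e : ℕ} (hK : (e : K) ≠ 0) (he : ∀ v ∈ F.lattice, e • v ∈ L.carrier) {x : L.fan.toricVariety K}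
    (hx : L.toricCover K x ∈ Set.range (F.chartι K (zeroCone F))) :
    ((L.toricCover K).stalkMap x).hom.FormallyUnramified := by
  obtain ⟨p, rfl⟩ := L.mem_range_chartι K hx
  refine Toric.stalkMap_formallyUnramified (i := F.specι K (zeroCone F))
    (j := L.fan.specι K ⟨(zeroCone F).1, (zeroCone F).2⟩)
    (φ := CommRingCat.ofHom (chartMap K L.le (le_refl (zeroCone F).1)).toRingHom)
    (L.chartι_toricCover K (zeroCone F)) (chartMap_formallyUnramified K L.le hK he)
    ⟨p, trivial, rfl⟩ ?_
  obtain ⟨q, hq⟩ := hx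
  exact ⟨q, trivial, hq⟩

end Unramified

section Ramification

variable {K : Type u} [Field K] {V : Type u} [NormedAddCommGroup V] [NormedSpace ℝ V] {F : Fan V}

theorem span_nsmul_singleton (v : V) {e : ℕ} (he0 : e ≠ 0) :
    Submodule.span {c : ℝ // 0 ≤ c} {e • v} = Submodule.span {c : ℝ // 0 ≤ c} {v} := by
  refine le_antisymm (Submodule.span_le.2 (Set.singleton_subset_iff.2
    (nsmul_mem (Submodule.mem_span_singleton_self _) e)))
    (Submodule.span_le.2 (Set.singleton_subset_iff.2
      (Submodule.mem_span_singleton.2 ⟨⟨(e : ℝ)⁻¹, by positivity⟩, ?_⟩)))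
  change (e : ℝ)⁻¹ • (e • v) = v
  rw [← Nat.cast_smul_eq_nsmul ℝ, smul_smul, inv_mul_cancel₀ (Nat.cast_ne_zero.2 he0), one_smul]

theorem Fan.Ray.mem_dualMonoid_of_nonneg (r : F.Ray) {N : Submodule ℤ V} {m : Module.Dual ℝ V}
    (hm : m ∈ dualLattice N) (h0 : 0 ≤ m r.gen) : m ∈ dualMonoid N r.cone.1 := by
  refine ⟨hm, fun v hv => ?_⟩
  obtain ⟨a, rfl⟩ := Submodule.mem_span_singleton.1 hv
  have : m (a • r.gen) = (a : ℝ) * m r.gen := map_smul m (a : ℝ) r.gen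
  rw [this]
  exact mul_nonneg a.2 h0

/-- The ray of the fan `(N', Σ)` over a ray `r` of `Σ` with integral generator `r`, when `e` is the
order of `r` in `N / N'`: its integral generator is `e r`. -/
def Fan.Sublattice.ray (L : F.Sublattice) (r : F.Ray) {e : ℕ} (he0 : e ≠ 0)
    (he : ∀ k : ℤ, k • r.gen ∈ L.carrier ↔ (e : ℤ) ∣ k) : L.fan.Ray where
  gen := e • r.gen
  gen_mem := by
    have := (he e).2 dvd_rfl
    rwa [natCast_zsmul] at this
  gen_ne_zero h := r.gen_ne_zero (by
    rw [← Nat.cast_smul_eq_nsmul ℝ] at h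
    exact (smul_eq_zero_iff_right (Nat.cast_ne_zero.2 he0)).1 h)
  cone_mem := by
    rw [span_nsmul_singleton _ he0]
    exact r.cone_mem
  generates := fun v hv hvr => by
    rw [span_nsmul_singleton _ he0] at hvr
    obtain ⟨k, rfl⟩ := r.generates v (L.le hv) hvr
    have h1 := (he k).1 (by rw [natCast_zsmul]; exact hv)
    obtain ⟨l, rfl⟩ := Int.natCast_dvd_natCast.1 h1
    exact ⟨l, by rw [smul_smul, mul_comm]⟩

theorem Fan.Sublattice.ray_gen (L : F.Sublattice) (r : F.Ray) {e : ℕ} (he0 : e ≠ 0)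
    (he : ∀ k : ℤ, k • r.gen ∈ L.carrier ↔ (e : ℤ) ∣ k) : (L.ray r he0 he).gen = e • r.gen := rfl

variable (K) in
theorem Fan.Ray.isPrime_span_chi (r : F.Ray) {σ : PointedCone ℝ V}
    (hσ : ∀ v, v ∈ σ ↔ v ∈ r.cone.1) (m : dualMonoid F.lattice σ) (h : m.1 r.gen = 1) :
    (Ideal.span {chi K F.lattice σ m}).IsPrime := by
  obtain rfl : σ = r.cone.1 := Submodule.ext hσ
  rw [← r.ker_orbitHom_eq_span K m h]
  exact RingHom.ker_isPrime _

variable [FiniteDimensional ℝ V]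

/-- Uniformizers on the charts at a point over `D_r`, where `r` has order `e` in `N / N'`: if `m`
in `M` and `m'` in `M'` take the value one on `r` and on `e r`, then `m - e m'` vanishes on `r`, so
that `χ^m` is `(χ^{m'})^e` up to a unit. -/
theorem Fan.Sublattice.exists_uniformizer (L : F.Sublattice) (r : F.Ray) {e : ℕ} (he0 : e ≠ 0)
    (he : ∀ k : ℤ, k • r.gen ∈ L.carrier ↔ (e : ℤ) ∣ k) {x : L.fan.toricVariety K}
    (hx : L.toricCover K x = r.divisor K) :
    ∃ (p : PrimeSpectrum (ChartRing K L.carrier r.cone.1))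
      (t : ChartRing K F.lattice r.cone.1) (t' u : ChartRing K L.carrier r.cone.1),
      L.chartι K r.cone p = x ∧ (r.orbitPoint K).asIdeal = Ideal.span {t} ∧
        p.asIdeal = Ideal.span {t'} ∧ t' ≠ 0 ∧ IsUnit u ∧
        chartMap K L.le (le_refl r.cone.1) t = t' ^ e * u := by
  obtain ⟨p, hp⟩ := L.mem_range_chartι K (σ := r.cone) ⟨r.orbitPoint K, hx.symm⟩
  have hpq : chartHom K L.le (le_refl r.cone.1) p = r.orbitPoint K := by
    refine (F.chartι K r.cone).isOpenEmbedding.injective ?_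
    refine (L.toricCover_chartι K r.cone p).symm.trans ?_
    rw [hp]
    exact hx
  have hcomap : Ideal.comap (chartMap K L.le (le_refl r.cone.1)).toRingHom
      (PrimeSpectrum.asIdeal (R := ChartRing K L.carrier r.cone.1) p) =
      (r.orbitPoint K).asIdeal :=
    congrArg (PrimeSpectrum.asIdeal (R := ChartRing K F.lattice r.cone.1)) hpq
  obtain ⟨m, hm, hmr⟩ := r.exists_apply_eq_one
  obtain ⟨m', hm', hmr'⟩ := (L.ray r he0 he).exists_apply_eq_one
  have hmr'' : (e : ℝ) * m' r.gen = 1 := by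
    rw [← hmr', L.ray_gen, map_nsmul, nsmul_eq_mul]
  have he1 : (0 : ℝ) < e := Nat.cast_pos.2 (Nat.pos_of_ne_zero he0)
  have hpos : 0 ≤ m' r.gen := by
    by_contra! h
    nlinarith
  let d : Module.Dual ℝ V := m - e • m'
  have hd : d ∈ dualLattice L.carrier := sub_mem (dualLattice_anti L.le hm) (nsmul_mem hm' e)
  have hd0 : d r.gen = 0 := by
    change m r.gen - (e • m') r.gen = 0
    rw [LinearMap.smul_apply, nsmul_eq_mul, hmr, hmr'', sub_self]
  let μ : dualMonoid F.lattice r.cone.1 := ⟨m, (r.mem_dualMonoid_iff m).2 ⟨hm, by linarith⟩⟩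
  let μ' : dualMonoid L.carrier r.cone.1 := ⟨m', r.mem_dualMonoid_of_nonneg hm' hpos⟩
  let δ : dualMonoid L.carrier r.cone.1 := ⟨d, r.mem_dualMonoid_of_nonneg hd hd0.ge⟩
  let δ' : dualMonoid L.carrier r.cone.1 :=
    ⟨-d, r.mem_dualMonoid_of_nonneg (neg_mem hd) (by rw [LinearMap.neg_apply, hd0, neg_zero])⟩
  have hunit : IsUnit (chi K L.carrier r.cone.1 δ) :=
    IsUnit.of_mul_eq_one (chi K L.carrier r.cone.1 δ') (by
      rw [← chi_add, show δ + δ' = 0 from Subtype.ext (add_neg_cancel d)]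
      rfl)
  have hmap : chartMap K L.le (le_refl r.cone.1) (chi K F.lattice r.cone.1 μ) =
      chi K L.carrier r.cone.1 μ' ^ e * chi K L.carrier r.cone.1 δ := by
    rw [chartMap_chi, ← chi_nsmul, ← chi_add]
    exact congrArg _ (Subtype.ext (add_sub_cancel (e • m') m).symm)
  have hq := r.ker_orbitHom_eq_span K μ hmr
  have hq' : (r.orbitPoint K).asIdeal = Ideal.span {chi K F.lattice r.cone.1 μ} := hq
  refine ⟨p, _, _, _, hp, hq, ?_, by simp [chi], hunit, hmap⟩
  have hprime : (Ideal.span {chi K L.carrier r.cone.1 μ'}).IsPrime := by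
    refine (L.ray r he0 he).isPrime_span_chi K (fun v => ?_) μ' hmr'
    exact (SetLike.ext_iff.1 (span_nsmul_singleton r.gen he0) v).symm
  have hle : Ideal.span {chi K L.carrier r.cone.1 μ'} ≤
      PrimeSpectrum.asIdeal (R := ChartRing K L.carrier r.cone.1) p := by
    rw [Ideal.span_singleton_le_iff_mem]
    have h1 : chi K F.lattice r.cone.1 μ ∈ (r.orbitPoint K).asIdeal :=
      hq' ▸ Ideal.mem_span_singleton_self _
    rw [← hcomap, Ideal.mem_comap] at h1
    have h2 : chi K L.carrier r.cone.1 μ' ^ e * chi K L.carrier r.cone.1 δ ∈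
      PrimeSpectrum.asIdeal (R := ChartRing K L.carrier r.cone.1) p := hmap ▸ h1
    exact p.2.mem_of_pow_mem _ ((Ideal.mul_unit_mem_iff_mem _ hunit).1 h2)
  -- Both prime ideals lie over that of `D_r`, so they agree as the ring extension is integral.
  obtain ⟨n, hn, hmul⟩ := L.exists_smul_mem
  by_contra hne
  let := (chartMap K L.le (le_refl r.cone.1)).toRingHom.toAlgebra
  have : Algebra.IsIntegral (ChartRing K F.lattice r.cone.1) (ChartRing K L.carrier r.cone.1) :=
    ⟨chartMap_isIntegral K L.le hn hmul r.cone.1⟩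
  have hlt := Ideal.IsIntegral.comap_lt_comap (R := ChartRing K F.lattice r.cone.1)
    (lt_of_le_of_ne hle (Ne.symm hne))
  refine hlt.not_ge ?_
  change Ideal.comap (chartMap K L.le (le_refl r.cone.1)).toRingHom _ ≤ _
  rw [hcomap, hq', Ideal.span_singleton_le_iff_mem, Ideal.mem_comap]
  change chartMap K L.le (le_refl r.cone.1) (chi K F.lattice r.cone.1 μ) ∈ _
  rw [hmap]
  exact Ideal.mul_mem_right _ _ (Ideal.pow_mem_of_mem _ (Ideal.mem_span_singleton_self _) _
    (Nat.pos_of_ne_zero he0))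

/-- The ramification order of a toric cover over `D_r` is the order of `r` in `N / N'`. -/
theorem Fan.Sublattice.map_maximalIdeal (L : F.Sublattice) (r : F.Ray) {e : ℕ} (he0 : e ≠ 0)
    (he : ∀ k : ℤ, k • r.gen ∈ L.carrier ↔ (e : ℤ) ∣ k) {x : L.fan.toricVariety K}
    (hx : L.toricCover K x = r.divisor K) :
    (IsLocalRing.maximalIdeal ((F.toricVariety K).presheaf.stalk (L.toricCover K x))).map
      ((L.toricCover K).stalkMap x).hom =
      IsLocalRing.maximalIdeal ((L.fan.toricVariety K).presheaf.stalk x) ^ e := by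
  obtain ⟨p, t, t', u, hp, ht, ht', -, hu, htt⟩ := L.exists_uniformizer r he0 he hx
  exact map_maximalIdeal_stalkMap (i := F.specι K r.cone)
    (j := L.fan.specι K ⟨r.cone.1, r.cone.2⟩)
    (φ := CommRingCat.ofHom (chartMap K L.le (le_refl r.cone.1)).toRingHom)
    (L.chartι_toricCover K r.cone) p hp (r.orbitPoint K) hx.symm ht ht' hu htt

theorem Fan.Sublattice.maximalIdeal_pow_injective (L : F.Sublattice) (r : F.Ray) {e : ℕ}
    (he0 : e ≠ 0) (he : ∀ k : ℤ, k • r.gen ∈ L.carrier ↔ (e : ℤ) ∣ k)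
    {x : L.fan.toricVariety K} (hx : L.toricCover K x = r.divisor K) :
    Function.Injective fun n : ℕ =>
      IsLocalRing.maximalIdeal ((L.fan.toricVariety K).presheaf.stalk x) ^ n := by
  obtain ⟨p, t, t', u, hp, ht, ht', h0, hu, htt⟩ := L.exists_uniformizer r he0 he hx
  exact Toric.maximalIdeal_pow_injective (i := L.fan.specι K ⟨r.cone.1, r.cone.2⟩) p hp ht' h0

end Ramification

/-! ### Branched toric covers -/

section Branched

variable {K : Type u} [Field K] {V : Type u} [NormedAddCommGroup V] [NormedSpace ℝ V] {F : Fan V}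

theorem Fan.Sublattice.exists_order (L : F.Sublattice) (r : F.Ray) :
    ∃ e : ℕ, e ≠ 0 ∧ ∀ k : ℤ, k • r.gen ∈ L.carrier ↔ (e : ℤ) ∣ k := by
  obtain ⟨a, ha⟩ := Int.subgroup_cyclic
    (L.carrier.toAddSubgroup.comap (zmultiplesHom V r.gen))
  have h : ∀ k : ℤ, k • r.gen ∈ L.carrier ↔ (a.natAbs : ℤ) ∣ k := by
    intro k
    rw [Int.natAbs_dvd, ← Int.mem_zmultiples_iff, AddSubgroup.zmultiples_eq_closure, ← ha]
    rfl
  refine ⟨a.natAbs, fun h0 => ?_, h⟩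
  obtain ⟨n, hn, hmem⟩ := L.exists_smul_mem
  have h1 := (h n).1 (by rw [natCast_zsmul]; exact hmem _ r.gen_mem)
  rw [h0, Nat.cast_zero, zero_dvd_iff] at h1
  exact hn (by exact_mod_cast h1)

/-- The subgroup generated by the multiples `d_r r` of the integral generators of the rays. -/
def Fan.minLattice (F : Fan V) (d : F.Ray → ℕ) : Submodule ℤ V :=
  Submodule.span ℤ (Set.range fun r : F.Ray => d r • r.gen)

theorem Fan.smul_gen_mem_minLattice (d : F.Ray → ℕ) (r : F.Ray) {k : ℤ} (h : (d r : ℤ) ∣ k) :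
    k • r.gen ∈ F.minLattice d := by
  obtain ⟨l, rfl⟩ := h
  rw [mul_comm, mul_smul, natCast_zsmul]
  exact Submodule.smul_mem _ _ (Submodule.subset_span ⟨r, rfl⟩)

theorem Fan.minLattice_le_lattice (d : F.Ray → ℕ) : F.minLattice d ≤ F.lattice :=
  Submodule.span_le.2 (by rintro _ ⟨r, rfl⟩; exact nsmul_mem r.gen_mem _)

theorem Fan.prod_smul_mem_minLattice [Fintype F.Ray] (d : F.Ray → ℕ) {v : V}
    (hv : v ∈ F.raySpan) : (∏ r, d r) • v ∈ F.minLattice d := by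
  induction hv using Submodule.span_induction with
  | mem v hv =>
    obtain ⟨r, rfl⟩ := hv
    change (∏ r, d r) • r.gen ∈ _
    rw [← natCast_zsmul]
    exact F.smul_gen_mem_minLattice d r
      (Int.natCast_dvd_natCast.2 (Finset.dvd_prod_of_mem d (Finset.mem_univ r)))
  | zero => rw [smul_zero]; exact zero_mem _
  | add v w _ _ hv hw => rw [smul_add]; exact add_mem hv hw
  | smul a v _ hv => rw [smul_comm]; exact Submodule.smul_mem _ a hv

variable [FiniteDimensional ℝ V]

/-- The ramification orders of a branched toric cover are the orders of the integral generators of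
the rays in `N / N'`. -/
theorem Fan.Sublattice.smul_mem_iff_of_isBranched (L : F.Sublattice) {d : F.Ray → ℕ}
    (h : IsBranchedWithOrders (L.toricCover K) (fun r : F.Ray => r.divisor K) d) (r : F.Ray)
    (k : ℤ) : k • r.gen ∈ L.carrier ↔ (d r : ℤ) ∣ k := by
  obtain ⟨e, he0, he⟩ := L.exists_order r
  obtain ⟨x, hx⟩ := L.toricCover_surjective K (r.divisor K)
  have h1 := L.map_maximalIdeal r he0 he hx
  have h2 : d r = e := L.maximalIdeal_pow_injective (K := K) r he0 he hx
    ((h.ramificationOrder r x hx).symm.trans h1)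
  rw [h2, he]

/-- A toric cover is branched on the `D_r` with the orders of the integral generators of the rays in
`N / N'`, provided that an exponent `e` of this group is prime to the characteristic: it is
unramified over the torus. -/
theorem Fan.Sublattice.isBranchedWithOrders (L : F.Sublattice) {d : F.Ray → ℕ}
    (hd : ∀ r, 0 < d r) (h : ∀ (r : F.Ray) (k : ℤ), k • r.gen ∈ L.carrier ↔ (d r : ℤ) ∣ k)
    {e : ℕ} (hK : (e : K) ≠ 0) (he : ∀ v ∈ F.lattice, e • v ∈ L.carrier) :
    IsBranchedWithOrders (L.toricCover K) (fun r : F.Ray => r.divisor K) d where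
  unramified x hx hne := by
    refine L.stalkMap_formallyUnramified hK he ?_
    rcases F.exists_of_coheight_eq_one hx with h | ⟨r, hr⟩
    · exact h
    · exact (hne r hr).elim
  ramificationOrder r x hx := L.map_maximalIdeal r (hd r).ne' (h r) hx

/-- The sublattice `N'_min` of a fan whose rays generate the lattice. -/
def Fan.minSublattice (F : Fan V) (d : F.Ray → ℕ) (hd : ∀ r, 0 < d r)
    (hF : F.raySpan = F.lattice) : F.Sublattice where
  carrier := F.minLattice d
  le := F.minLattice_le_lattice d
  relIndex_ne_zero := F.relIndex_ne_zero_of_torsion fun v hv => by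
    have := Fintype.ofFinite F.Ray
    refine ⟨(∏ r, d r : ℕ), ?_, ?_⟩
    · exact Int.natCast_ne_zero.2 (Finset.prod_ne_zero_iff.2 fun r _ => (hd r).ne')
    · rw [natCast_zsmul]
      exact F.prod_smul_mem_minLattice d (hF ▸ hv)

end Branched

section MaximalCover

variable {K : Type u} [Field K] {V : Type u} [NormedAddCommGroup V] [NormedSpace ℝ V]
  [FiniteDimensional ℝ V] (F : Fan V) (d : F.Ray → ℕ)

variable (K) in
/-- The surjection from `ℤ^n` to `G_max`. -/
noncomputable def Fan.mkGmax : (F.Ray → ℤ) →+ Gmax K F d :=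
  (QuotientAddGroup.mk' (Kmin K F d)).comp
    (AddMonoidHom.mk' (fun c r => (c r : ZMod (d r))) fun a b => by
      funext r
      exact Int.cast_add _ _)

theorem Fan.mkGmax_surjective : Function.Surjective (F.mkGmax K d) := by
  intro x
  obtain ⟨y, rfl⟩ := QuotientAddGroup.mk_surjective x
  choose c hc using fun r => ZMod.intCast_surjective (y r)
  exact ⟨c, congrArg QuotientAddGroup.mk (funext hc)⟩

variable {F d}

/-- `G_max` is `N / N'_min`: by the description of `Hom(Cl(Y), ℤ)` as the group of relations between
the integral generators of the rays, `c` is zero in `G_max` if and only if it is congruent to a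
relation modulo the `d_r`. -/
theorem Fan.mkGmax_eq_zero_iff [Fintype F.Ray] (c : F.Ray → ℤ) :
    F.mkGmax K d c = 0 ↔ ∑ r, c r • r.gen ∈ F.minLattice d := by
  refine (QuotientAddGroup.eq_zero_iff _).trans ?_
  constructor
  · rintro ⟨ψ, hψ⟩
    let a : F.Ray → ℤ := fun r => ψ (primeDivisorClass (r.divisor K) (r.coheight_divisor K))
    have ha := (F.exists_hom_cl_iff a).1 ⟨ψ, fun r => rfl⟩
    have h : ∑ r, c r • r.gen = ∑ r, (c r - a r) • r.gen := by
      simp only [sub_smul, Finset.sum_sub_distrib, ha, sub_zero]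
    rw [h]
    refine sum_mem fun r _ => F.smul_gen_mem_minLattice d r ?_
    exact (ZMod.intCast_eq_intCast_iff_dvd_sub _ _ _).1 (congrFun hψ r)
  · intro h
    obtain ⟨b, hb⟩ := (Submodule.mem_span_range_iff_exists_fun ℤ).1 h
    have hrel : ∑ r, (c r - b r * d r) • r.gen = 0 := by
      simp only [sub_smul, Finset.sum_sub_distrib, ← hb, mul_smul, natCast_zsmul, sub_self]
    obtain ⟨ψ, hψ⟩ := (F.exists_hom_cl_iff (K := K) _).2 hrel
    refine ⟨ψ, funext fun r => ?_⟩
    change ((ψ _ : ℤ) : ZMod (d r)) = (c r : ZMod (d r))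
    rw [hψ]
    simp

/-- The generator of `ℤ/d_r` corresponds to the class of `r` in `N / N'_min`. -/
theorem toGmax_injective_iff (r : F.Ray) :
    Function.Injective (toGmax K F d r) ↔
      ∀ k : ℤ, k • r.gen ∈ F.minLattice d ↔ (d r : ℤ) ∣ k := by
  classical
  have := Fintype.ofFinite F.Ray
  have key : ∀ k : ℤ, toGmax K F d r (k : ZMod (d r)) = 0 ↔ k • r.gen ∈ F.minLattice d := by
    intro k
    have h1 : toGmax K F d r (k : ZMod (d r)) = F.mkGmax K d (Pi.single r k) := by
      refine congrArg QuotientAddGroup.mk (funext fun s => ?_)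
      rw [AddMonoidHom.single_apply]
      change _ = ((Pi.single r k : F.Ray → ℤ) s : ZMod (d s))
      by_cases h : s = r
      · subst h
        rw [Pi.single_eq_same, Pi.single_eq_same]
      · rw [Pi.single_eq_of_ne h, Pi.single_eq_of_ne h, Int.cast_zero]
    have h2 : ∑ s, (Pi.single r k : F.Ray → ℤ) s • s.gen = k • r.gen := by
      rw [Finset.sum_eq_single r (fun s _ h => by rw [Pi.single_eq_of_ne h, zero_smul])
        (fun h => (h (Finset.mem_univ r)).elim), Pi.single_eq_same]
    rw [h1, F.mkGmax_eq_zero_iff, h2]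
  rw [injective_iff_map_eq_zero]
  constructor
  · intro h k
    refine ⟨fun hk => ?_, F.smul_gen_mem_minLattice d r⟩
    exact (ZMod.intCast_zmod_eq_zero_iff_dvd _ _).1 (h _ ((key k).2 hk))
  · intro h a ha
    obtain ⟨k, rfl⟩ := ZMod.intCast_surjective a
    exact (ZMod.intCast_zmod_eq_zero_iff_dvd _ _).2 ((h k).1 ((key k).1 ha))

/-- The Galois group of the cover of `N'_min` and `G_max` are both quotients of `ℤ^n`, by the same
subgroup: the vectors `c` with `∑ c_r r` in `N'_min`. -/
theorem Fan.minSublattice_coverGroup [IsAlgClosed K] (hd : ∀ r, 0 < d r)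
    (hF : F.raySpan = F.lattice) {e : ℕ} (hK : (e : K) ≠ 0)
    (he : ∀ v ∈ F.lattice, e • v ∈ F.minLattice d) :
    Nonempty (CoverGroup ((F.minSublattice d hd hF).toricCover K) ≃*
      Multiplicative (Gmax K F d)) := by
  have := Fintype.ofFinite F.Ray
  obtain ⟨Φ, hΦ, hker⟩ := (F.minSublattice d hd hF).exists_hom_coverGroup hK he
  let Ξ : (F.Ray → ℤ) →+ F.lattice :=
    AddMonoidHom.mk' (fun c => ∑ r, c r • ⟨r.gen, r.gen_mem⟩) fun a b => by
      simp only [Pi.add_apply, add_smul, Finset.sum_add_distrib]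
  have hΞ : ∀ c, (Ξ c).1 = ∑ r, c r • r.gen := fun c => by
    change F.lattice.subtype (∑ r, c r • ⟨r.gen, r.gen_mem⟩) = _
    rw [map_sum]
    rfl
  have hsurj : Function.Surjective Ξ := by
    rintro ⟨v, hv⟩
    rw [← hF] at hv
    obtain ⟨c, hc⟩ := (Submodule.mem_span_range_iff_exists_fun ℤ).1 hv
    exact ⟨c, Subtype.ext ((hΞ c).trans hc)⟩
  let f := Φ.comp (AddMonoidHom.toMultiplicative Ξ)
  let g := AddMonoidHom.toMultiplicative (F.mkGmax K d)
  have hf : Function.Surjective f := hΦ.comp hsurj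
  have hg : Function.Surjective g := F.mkGmax_surjective d
  have hfg : f.ker = g.ker := by
    ext c
    have h1 : f c = 1 ↔ (Ξ c.toAdd).1 ∈ F.minLattice d := hker _
    have h2 : g c = 1 ↔ F.mkGmax K d c.toAdd = 0 := Iff.rfl
    rw [MonoidHom.mem_ker, MonoidHom.mem_ker, h1, h2, F.mkGmax_eq_zero_iff, hΞ]
  exact ⟨(QuotientGroup.quotientKerEquivOfSurjective f hf).symm.trans
    ((QuotientGroup.quotientMulEquivOfEq hfg).trans
      (QuotientGroup.quotientKerEquivOfSurjective g hg))⟩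

end MaximalCover

end Toric

theorem theorem3p4 {K : Type u} [Field K] [IsAlgClosed K]
    {V : Type u} [NormedAddCommGroup V] [NormedSpace ℝ V] [FiniteDimensional ℝ V]
    (F : Toric.Fan V)
    (hcomplete : AlgebraicGeometry.IsProper (F.structureMorphism K))
    (htorsion : IsAddTorsionFree (Toric.Cl (F.toricVariety K)))
    (d : F.Ray → ℕ) (hd : ∀ r, 0 < d r) (hchar : ∀ r, (d r : K) ≠ 0) :
    ((∃ L : F.Sublattice,
        Toric.IsBranchedWithOrders (L.toricCover K) (fun r : F.Ray => r.divisor K) d) ↔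
      ∀ r, Function.Injective (Toric.toGmax K F d r)) ∧
    ((∀ r, Function.Injective (Toric.toGmax K F d r)) →
      ∃ Lmax : F.Sublattice,
        Lmax.carrier = Submodule.span ℤ (Set.range fun r : F.Ray => d r • r.gen) ∧
        Toric.IsBranchedWithOrders (Lmax.toricCover K) (fun r : F.Ray => r.divisor K) d ∧
        Toric.IsGaloisCover (Lmax.toricCover K) ∧
        Nonempty (Toric.CoverGroup (Lmax.toricCover K) ≃* Multiplicative (Toric.Gmax K F d)) ∧
        ∀ L : F.Sublattice,
          Toric.IsBranchedWithOrders (L.toricCover K) (fun r : F.Ray => r.divisor K) d →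
          ∃ H : Subgroup (Toric.CoverGroup (Lmax.toricCover K)),
            Toric.IsQuotientCover (Lmax.toricCover K) (L.toricCover K) H) := by
  have := Fintype.ofFinite F.Ray
  have hF : F.raySpan = F.lattice := F.raySpan_eq K htorsion
  have hK : ((∏ r, d r : ℕ) : K) ≠ 0 := by
    rw [Nat.cast_prod]
    exact Finset.prod_ne_zero_iff.2 fun r _ => hchar r
  have he : ∀ v ∈ F.lattice, (∏ r, d r) • v ∈ F.minLattice d := fun v hv =>
    F.prod_smul_mem_minLattice d (hF ▸ hv)
  have hle : ∀ L : F.Sublattice,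
      Toric.IsBranchedWithOrders (L.toricCover K) (fun r : F.Ray => r.divisor K) d →
      F.minLattice d ≤ L.carrier := by
    intro L hL
    refine Submodule.span_le.2 ?_
    rintro _ ⟨r, rfl⟩
    have h := (L.smul_mem_iff_of_isBranched hL r (d r)).2 dvd_rfl
    rwa [natCast_zsmul] at h
  have hmax : (∀ r, Function.Injective (Toric.toGmax K F d r)) →
      Toric.IsBranchedWithOrders ((F.minSublattice d hd hF).toricCover K)
        (fun r : F.Ray => r.divisor K) d := fun h =>
    (F.minSublattice d hd hF).isBranchedWithOrders hd
      (fun r => (Toric.toGmax_injective_iff r).1 (h r)) hK he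
  refine ⟨⟨?_, fun h => ⟨_, hmax h⟩⟩, fun h => ⟨F.minSublattice d hd hF, rfl, hmax h,
    (F.minSublattice d hd hF).isGaloisCover hK he, F.minSublattice_coverGroup hd hF hK he,
    fun L hL => (F.minSublattice d hd hF).exists_isQuotientCover L (hle L hL) hK he⟩⟩
  rintro ⟨L, hL⟩ r
  refine (Toric.toGmax_injective_iff r).2 fun k => ⟨fun hk => ?_, F.smul_gen_mem_minLattice d r⟩
  exact (L.smul_mem_iff_of_isBranched hL r k).1 (hle L hL hk)
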